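/- Let $m,n\ge 0$ be integers with $N=m+n\ge 3$, let $\gamma\ge 0$, and assume $m\ge 1$ or $\gamma=0$. Write $z=(x,y)\in\mathbb{R}^m\times\mathbb{R}^n=\mathbb{R}^N$ and put $$N_\gamma=m+(1+\gamma)n,\qquad d(z)=\left(|x|^{2(\gamma+1)}+|y|^2\right)^{\frac1{2(\gamma+1)}},\qquad \nabla_\gamma u=\left(\nabla_x u,\ (1+\gamma)|x|^\gamma\nabla_y u\right)$$ (with $|x|^0=1$). Let $\Omega\subset\mathbb{R}^N$ be a bounded open set, and let $\mathcal{H}_\gamma(\Omega)$ be the completion of $C_c^\infty(\Omega)$ with respect to the norm $\|u\|_\gamma=\left(\int_\Omega|\nabla_\gamma u|^2\,dz\right)^{1/2}$, whose elements are regarded as functions in $L^2(\Omega)$. Let $\lambda>0$, $0<\mu<N_\gamma$ and $2^*_{\gamma,\mu}=\frac{2N_\gamma-\mu}{N_\gamma-2}$. For $u\in\mathcal{H}_\gamma(\Omega)$ set $$D(u)=\int_\Omega\left(\int_\Omega\frac{|u(w)|^{2^*_{\gamma,\mu}}}{d(z-w)^\mu}\,dw\right)|u(z)|^{2^*_{\gamma,\mu}}\,dz,$$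 $$J_\gamma(u)=\frac12\int_\Omega|\nabla_\gamma u|^2\,dz-\frac\lambda2\int_\Omega|u|^2\,dz-\frac1{2\cdot 2^*_{\gamma,\mu}}D(u),\qquad S_\Omega=\inf_{u\in\mathcal{H}_\gamma(\Omega)\setminus\{0\}}\frac{\int_\Omega|\nabla_\gamma u|^2\,dz}{D(u)^{1/2^*_{\gamma,\mu}}}.$$ Then $J_\gamma$ satisfies the Palais–Smale condition at every level $c\in\mathbb{R}$ with $$c<\frac{N_\gamma+2-\mu}{4N_\gamma-2\mu}\,S_\Omega^{\frac{2N_\gamma-\mu}{N_\gamma+2-\mu}},$$ that is, every sequence $(u_k)$ in $\mathcal{H}_\gamma(\Omega)$ such that $J_\gamma(u_k)\to c$ and $J_\gamma'(u_k)\to 0$ in the dual space of $\mathcal{H}_\gamma(\Omega)$ has a subsequence that converges in the norm of $\mathcal{H}_\gamma(\Omega)$. -/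

import Mathlib

open MeasureTheory Filter Topology
open scoped NNReal

noncomputable section

namespace Grushin

/-- The space `ℝ^m × ℝ^n`; a point is `z = (x, y)`, and `volume` is the Lebesgue measure. -/
abbrev Space (m n : ℕ) : Type := EuclideanSpace ℝ (Fin m) × EuclideanSpace ℝ (Fin n)

/-- The values of Grushin gradients: `ℝ^m × ℝ^n` with the Euclidean norm and inner product. -/
abbrev GradSpace (m n : ℕ) : Type :=
  WithLp 2 (EuclideanSpace ℝ (Fin m) × EuclideanSpace ℝ (Fin n))

/-- The homogeneous dimension `N_γ = m + (1 + γ) n`. -/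
def homDim (m n : ℕ) (γ : ℝ≥0) : ℝ := m + (1 + (γ : ℝ)) * n

/-- The critical exponent `2^*_{γ,μ} = (2 N_γ - μ) / (N_γ - 2)`. -/
def critExp (m n : ℕ) (γ : ℝ≥0) (μ : ℝ) : ℝ := (2 * homDim m n γ - μ) / (homDim m n γ - 2)

/-- The homogeneous norm `d(z) = (|x|^{2(γ+1)} + |y|^2)^{1/(2(γ+1))}`. -/
def homNorm {m n : ℕ} (γ : ℝ≥0) (z : Space m n) : ℝ :=
  (‖z.1‖ ^ (2 * ((γ : ℝ) + 1)) + ‖z.2‖ ^ (2 : ℝ)) ^ (1 / (2 * ((γ : ℝ) + 1)))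

/-- The Grushin gradient `∇_γ u = (∇_x u, (1 + γ) |x|^γ ∇_y u)` (with `|x|^0 = 1`). -/
def grad {m n : ℕ} (γ : ℝ≥0) (u : Space m n → ℝ) (z : Space m n) : GradSpace m n :=
  WithLp.toLp 2
    (gradient (fun x => u (x, z.2)) z.1,
      ((1 + (γ : ℝ)) * ‖z.1‖ ^ (γ : ℝ)) • gradient (fun y => u (z.1, y)) z.2)

/-- The space `C_c^∞(Ω)`, as a type of its own so that it can carry the norm
`‖φ‖_γ = (∫_Ω |∇_γ φ|^2)^{1/2}`. -/
def Test {m n : ℕ} (_γ : ℝ≥0) (Ω : TopologicalSpace.Opens (Space m n)) : Type :=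
  TestFunction Ω ℝ ⊤

section

variable {m n : ℕ} {γ : ℝ≥0} {Ω : TopologicalSpace.Opens (Space m n)}

instance : AddCommGroup (Test γ Ω) := inferInstanceAs (AddCommGroup (TestFunction Ω ℝ ⊤))

instance : Module ℝ (Test γ Ω) := inferInstanceAs (Module ℝ (TestFunction Ω ℝ ⊤))

/-- The underlying function of a test function. -/
def Test.fn (φ : Test γ Ω) : Space m n → ℝ := TestFunction.toFun φ

theorem Test.contDiff (φ : Test γ Ω) : ContDiff ℝ (⊤ : ℕ∞) φ.fn := TestFunction.contDiff' φ

theorem Test.hasCompactSupport (φ : Test γ Ω) : HasCompactSupport φ.fn :=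
  TestFunction.hasCompactSupport' φ

theorem Test.fn_add (φ ψ : Test γ Ω) : (φ + ψ).fn = φ.fn + ψ.fn := rfl

theorem Test.fn_smul (c : ℝ) (φ : Test γ Ω) : (c • φ).fn = c • φ.fn := rfl

theorem Test.differentiable (φ : Test γ Ω) : Differentiable ℝ φ.fn :=
  φ.contDiff.differentiable (by simp)

theorem gradient_fst {u : Space m n → ℝ} (hu : Differentiable ℝ u) (z : Space m n) :
    gradient (fun x => u (x, z.2)) z.1 =
      (InnerProductSpace.toDual ℝ (EuclideanSpace ℝ (Fin m))).symm
        ((fderiv ℝ u z).comp (ContinuousLinearMap.inl ℝ _ _)) := by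
  have h : HasFDerivAt (fun x => u (x, z.2))
      ((fderiv ℝ u z).comp (ContinuousLinearMap.inl ℝ _ _)) z.1 :=
    HasFDerivAt.comp z.1 (hu z).hasFDerivAt (hasFDerivAt_prodMk_left z.1 z.2)
  rw [gradient, h.fderiv]

theorem gradient_snd {u : Space m n → ℝ} (hu : Differentiable ℝ u) (z : Space m n) :
    gradient (fun y => u (z.1, y)) z.2 =
      (InnerProductSpace.toDual ℝ (EuclideanSpace ℝ (Fin n))).symm
        ((fderiv ℝ u z).comp (ContinuousLinearMap.inr ℝ _ _)) := by
  have h : HasFDerivAt (fun y => u (z.1, y))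
      ((fderiv ℝ u z).comp (ContinuousLinearMap.inr ℝ _ _)) z.2 :=
    HasFDerivAt.comp z.2 (hu z).hasFDerivAt (hasFDerivAt_prodMk_right z.1 z.2)
  rw [gradient, h.fderiv]

theorem grad_eq {u : Space m n → ℝ} (hu : Differentiable ℝ u) :
    grad γ u = fun z => WithLp.toLp 2
      ((InnerProductSpace.toDual ℝ (EuclideanSpace ℝ (Fin m))).symm
          ((fderiv ℝ u z).comp (ContinuousLinearMap.inl ℝ _ _)),
        ((1 + (γ : ℝ)) * ‖z.1‖ ^ (γ : ℝ)) •
          (InnerProductSpace.toDual ℝ (EuclideanSpace ℝ (Fin n))).symm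
            ((fderiv ℝ u z).comp (ContinuousLinearMap.inr ℝ _ _))) := by
  funext z
  rw [grad, gradient_fst hu, gradient_snd hu]

theorem Test.grad_add (φ ψ : Test γ Ω) :
    grad γ (φ + ψ).fn = grad γ φ.fn + grad γ ψ.fn := by
  rw [grad_eq (φ + ψ).differentiable, grad_eq φ.differentiable, grad_eq ψ.differentiable]
  funext z
  rw [Test.fn_add, fderiv_add (φ.differentiable z) (ψ.differentiable z)]
  simp [← WithLp.toLp_add, ContinuousLinearMap.add_comp]

theorem Test.grad_smul (c : ℝ) (φ : Test γ Ω) :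
    grad γ (c • φ).fn = c • grad γ φ.fn := by
  rw [grad_eq (c • φ).differentiable, grad_eq φ.differentiable]
  funext z
  rw [Test.fn_smul, fderiv_const_smul (φ.differentiable z)]
  simp [← WithLp.toLp_smul, ContinuousLinearMap.smul_comp, smul_comm c]

theorem Test.continuous_grad (φ : Test γ Ω) : Continuous (grad γ φ.fn) := by
  rw [grad_eq φ.differentiable]
  have h : Continuous (fderiv ℝ φ.fn) := φ.contDiff.continuous_fderiv (by simp)
  have h1 : Continuous fun z : Space m n => ‖z.1‖ ^ (γ : ℝ) :=
    continuous_fst.norm.rpow_const fun _ => Or.inr γ.2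
  refine (WithLp.prod_continuous_toLp 2 _ _).comp (Continuous.prodMk ?_ ?_)
  · exact (LinearIsometryEquiv.continuous _).comp (h.clm_comp continuous_const)
  · exact (continuous_const.mul h1).smul
      ((LinearIsometryEquiv.continuous _).comp (h.clm_comp continuous_const))


theorem Test.hasCompactSupport_grad (φ : Test γ Ω) : HasCompactSupport (grad γ φ.fn) := by
  rw [grad_eq φ.differentiable]
  refine (φ.hasCompactSupport.fderiv (𝕜 := ℝ)).mono ?_
  intro z hz
  rw [Function.mem_support] at hz ⊢
  intro h
  exact hz (by simp [h])

/-- The Grushin gradient `C_c^∞(Ω) → L^2(Ω; ℝ^m × ℝ^n)`. -/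
def Test.gradL2 (γ : ℝ≥0) (Ω : TopologicalSpace.Opens (Space m n)) :
    Test γ Ω →ₗ[ℝ] Lp (GradSpace m n) 2 (volume.restrict (Ω : Set (Space m n))) where
  toFun φ := (φ.continuous_grad.memLp_of_hasCompactSupport φ.hasCompactSupport_grad).toLp
  map_add' φ ψ := by
    rw [← MemLp.toLp_add]
    congr 1
    exact Test.grad_add φ ψ
  map_smul' c φ := by
    rw [RingHom.id_apply, ← MemLp.toLp_const_smul]
    congr 1
    exact Test.grad_smul c φ

theorem Test.inner_gradL2 (φ ψ : Test γ Ω) :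
    inner ℝ (Test.gradL2 γ Ω φ) (Test.gradL2 γ Ω ψ) =
      ∫ z in (Ω : Set (Space m n)), inner ℝ (grad γ φ.fn z) (grad γ ψ.fn z) := by
  rw [L2.inner_def]
  refine integral_congr_ae ?_
  filter_upwards [(φ.continuous_grad.memLp_of_hasCompactSupport
      φ.hasCompactSupport_grad).coeFn_toLp (μ := volume.restrict (Ω : Set (Space m n))) (p := 2),
    (ψ.continuous_grad.memLp_of_hasCompactSupport
      ψ.hasCompactSupport_grad).coeFn_toLp (μ := volume.restrict (Ω : Set (Space m n))) (p := 2)]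
    with z h1 h2
  exact congrArg₂ (inner ℝ) h1 h2

/-- The inclusion `C_c^∞(Ω) → L^2(Ω)`. -/
def Test.fnL2 (φ : Test γ Ω) : Lp ℝ 2 (volume.restrict (Ω : Set (Space m n))) :=
  (φ.contDiff.continuous.memLp_of_hasCompactSupport φ.hasCompactSupport).toLp

instance : SeminormedAddCommGroup (Test γ Ω) :=
  SeminormedAddCommGroup.induced (Test γ Ω) _ (Test.gradL2 γ Ω)

/-- The inner product `⟨φ, ψ⟩_γ = ∫_Ω ∇_γ φ · ∇_γ ψ` on `C_c^∞(Ω)`. -/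
instance : InnerProductSpace ℝ (Test γ Ω) where
  norm_smul_le c φ := by
    change ‖Test.gradL2 γ Ω (c • φ)‖ ≤ ‖c‖ * ‖Test.gradL2 γ Ω φ‖
    rw [map_smul, norm_smul]
  inner φ ψ := ∫ z in (Ω : Set (Space m n)), inner ℝ (grad γ φ.fn z) (grad γ ψ.fn z)
  norm_sq_eq_re_inner φ := by
    rw [← Test.inner_gradL2, real_inner_self_eq_norm_sq]
    rfl
  conj_inner_symm φ ψ := by
    simp [real_inner_comm]
  add_left φ ψ χ := by
    simp only [← Test.inner_gradL2, map_add, inner_add_left]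
  smul_left φ ψ c := by
    simp only [← Test.inner_gradL2, map_smul, inner_smul_left]

theorem Test.isometry_gradL2 : Isometry (Test.gradL2 γ Ω) :=
  AddMonoidHomClass.isometry_of_norm (Test.gradL2 γ Ω) fun _ => rfl

/-- The Hilbert space `H_γ(Ω)`: the completion of `C_c^∞(Ω)` with respect to `‖·‖_γ`. -/
abbrev H (γ : ℝ≥0) (Ω : TopologicalSpace.Opens (Space m n)) : Type :=
  UniformSpace.Completion (Test γ Ω)

/-- The function in `L^2(Ω)` that an element of `H_γ(Ω)` is: the continuous extension of
`φ ↦ φ` from `C_c^∞(Ω)` to the completion. It exists by the Poincaré inequality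
`‖φ‖_{L^2} ≤ C ‖φ‖_γ`, valid for bounded `Ω` when `m ≥ 1` or `γ = 0`. -/
def H.toL2 (u : H γ Ω) : Lp ℝ 2 (volume.restrict (Ω : Set (Space m n))) :=
  UniformSpace.Completion.extension Test.fnL2 u

/-- The Grushin gradient of an element of `H_γ(Ω)`: the continuous extension of `φ ↦ ∇_γ φ`. -/
def H.gradL2 (u : H γ Ω) : Lp (GradSpace m n) 2 (volume.restrict (Ω : Set (Space m n))) :=
  UniformSpace.Completion.extension (Test.gradL2 γ Ω) u

/-- The Dirichlet integral `∫_Ω |∇_γ u|^2`. -/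
def dirichlet (u : H γ Ω) : ℝ := ∫ z in (Ω : Set (Space m n)), ‖u.gradL2 z‖ ^ 2

theorem dirichlet_eq_norm_sq (u : H γ Ω) : dirichlet u = ‖u‖ ^ 2 := by
  have h : dirichlet u = ‖u.gradL2‖ ^ 2 := by
    rw [← real_inner_self_eq_norm_sq, L2.inner_def]
    simp only [real_inner_self_eq_norm_sq]
    rfl
  rw [h]
  congr 1
  refine UniformSpace.Completion.induction_on (p := fun u : H γ Ω => ‖u.gradL2‖ = ‖u‖) u ?_ ?_
  · exact isClosed_eq UniformSpace.Completion.continuous_extension.norm (by fun_prop)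
  · intro φ
    rw [H.gradL2, UniformSpace.Completion.extension_coe Test.isometry_gradL2.uniformContinuous,
      UniformSpace.Completion.norm_coe]
    rfl

/-- The Choquard term
`∫_Ω (∫_Ω |u(w)|^{2^*_{γ,μ}} / d(z - w)^μ dw) |u(z)|^{2^*_{γ,μ}} dz`. -/
def choquard (μ : ℝ) (u : H γ Ω) : ℝ :=
  ∫ z in (Ω : Set (Space m n)),
    (∫ w in (Ω : Set (Space m n)), |u.toL2 w| ^ critExp m n γ μ / homNorm γ (z - w) ^ μ) *
      |u.toL2 z| ^ critExp m n γ μ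

/-- The energy functional `J_γ` on `H_γ(Ω)`. -/
def energy (lam μ : ℝ) (u : H γ Ω) : ℝ :=
  1 / 2 * dirichlet u - lam / 2 * (∫ z in (Ω : Set (Space m n)), |u.toL2 z| ^ 2) -
    1 / (2 * critExp m n γ μ) * choquard μ u

/-- The best constant `S_Ω = inf_{u ≠ 0} ∫_Ω |∇_γ u|^2 / (Choquard term)^{1 / 2^*_{γ,μ}}`. -/
def bestConst (γ : ℝ≥0) (Ω : TopologicalSpace.Opens (Space m n)) (μ : ℝ) : ℝ :=
  ⨅ u : {u : H γ Ω // u ≠ 0}, dirichlet u.1 / choquard μ u.1 ^ (1 / critExp m n γ μ)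

end

/-- A Palais–Smale sequence of the functional `J` at level `c`: `J(u_k) → c` and `J'(u_k) → 0` in
the dual space, where `J'` is the Fréchet derivative. -/
def IsPalaisSmaleSeq {E : Type*} [NormedAddCommGroup E] [NormedSpace ℝ E] (J : E → ℝ) (c : ℝ)
    (u : ℕ → E) : Prop :=
  Tendsto (fun k => J (u k)) atTop (𝓝 c) ∧ Tendsto (fun k => ‖fderiv ℝ J (u k)‖) atTop (𝓝 0)

/-- The Palais–Smale condition at level `c`: every Palais–Smale sequence at level `c` has a
subsequence that converges in norm. -/
def PalaisSmaleCondition {E : Type*} [NormedAddCommGroup E] [NormedSpace ℝ E] (J : E → ℝ)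
    (c : ℝ) : Prop :=
  ∀ u : ℕ → E, IsPalaisSmaleSeq J c u →
    ∃ (u₀ : E) (k : ℕ → ℕ), StrictMono k ∧ Tendsto (fun j => u (k j)) atTop (𝓝 u₀)

end Grushin

end

noncomputable section

namespace Grushin

open scoped ENNReal

/-! Write Q for the homogeneous dimension, p for the critical exponent and r = 2Q/(2Q-μ), so that rp
= 2Q/(Q-2) is the Sobolev exponent; put θ = 1/2 - 1/(2p).

Compactness (`tendsto_zero_of_palaisSmale`). A bounded Palais–Smale sequence has, along a
subsequence, the form v_j + u₀ with v_j weakly null, null in L² and null almost everywhere. The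
squared norm and, by Brezis–Lieb, the Choquard term D both split into the part of v_j and the part
of u₀. Testing J' with u₀ gives ‖u₀‖² - λ|u₀|₂² - D(u₀) = 0; testing it with the sequence gives
‖v_j‖² - D(v_j) → 0. Since J - J'(u)u/2 = θ D, both ‖v_j‖² and D(v_j) tend to b = c/θ - D(u₀) ≤ c/θ
< S^(p/(p-1)). The definition of S gives S b^(1/p) ≤ b, so either b = 0 or b ≥ S^(p/(p-1)); hence b
= 0 and v_j → 0 in norm.

Boundedness (`palaisSmale_bounded`). No size restriction is put on λ, so the L² term is not absorbed
by a Poincaré inequality. Instead θ D is controlled by J and J', D controls the L¹ norm because the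
kernel is bounded below on a bounded domain, and L² is interpolated between L¹ and the Sobolev
space.

Analytic input. Everything specific to the Grushin gradient rests on the family of maps `slide`:
moving a point by such a map of size t changes a function by O(t)‖∇_γ u‖ in L²
(`lintegral_slide_sub_sq_le`), while integrating over the unit ball of slides is bounded by t^(-Q)
times the L¹ norm (`lintegral_slide_le`). The two facts give the Sobolev inequality (`sobolev`,
through truncation at dyadic levels) and the Rellich theorem (`tendsto_embed_two_of_weak`). The
Hardy–Littlewood–Sobolev inequality (`isBoundedKernel_kern`) makes D a bounded form in |u|^p ∈ L^r,
and `hasFDerivAt_absPow` makes it differentiable. The variational argument is carried out for an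
abstract energy `modelEnergy` and then specialised. -/

theorem lintegral_sq_le {α : Type*} [MeasurableSpace α] (π : Measure α) {g : α → ℝ≥0∞}
    (hg : AEMeasurable g π) : (∫⁻ a, g a ∂π) ^ 2 ≤ π Set.univ * ∫⁻ a, g a ^ 2 ∂π := by
  have h := ENNReal.lintegral_mul_le_Lp_mul_Lq π Real.HolderConjugate.two_two
    (aemeasurable_const (b := (1 : ℝ≥0∞))) hg
  simp only [Pi.mul_apply, one_mul, ENNReal.one_rpow, lintegral_const] at h
  calc (∫⁻ a, g a ∂π) ^ 2
      ≤ ((π Set.univ) ^ (1 / 2 : ℝ) * (∫⁻ a, g a ^ (2 : ℝ) ∂π) ^ (1 / 2 : ℝ)) ^ 2 := by gcongr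
    _ = π Set.univ * ∫⁻ a, g a ^ 2 ∂π := by
      rw [← ENNReal.mul_rpow_of_nonneg _ _ (by norm_num), ← ENNReal.rpow_natCast,
        ← ENNReal.rpow_mul]
      simp

/-! ### Translations in L² are controlled by the gradient. -/

section Translation

variable {E : Type*} [NormedAddCommGroup E] [InnerProductSpace ℝ E] [FiniteDimensional ℝ E]

theorem norm_gradient (ψ : E → ℝ) (x : E) : ‖gradient ψ x‖ = ‖fderiv ℝ ψ x‖ := by
  simp [gradient]

theorem enorm_sub_sq_le {ψ : E → ℝ} (hψ : ContDiff ℝ 1 ψ) (x v : E) :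
    ‖ψ (x + v) - ψ x‖ₑ ^ 2 ≤
      ‖v‖ₑ ^ 2 * ∫⁻ s in Set.Icc (0 : ℝ) 1, ‖gradient ψ (x + s • v)‖ₑ ^ 2 := by
  have hc : Continuous fun s : ℝ => fderiv ℝ ψ (x + s • v) :=
    (hψ.continuous_fderiv (by simp)).comp (by fun_prop)
  have hd : ∀ s : ℝ, HasDerivAt (fun s : ℝ => ψ (x + s • v)) (fderiv ℝ ψ (x + s • v) v) s := by
    intro s
    have h1 : HasDerivAt (fun s : ℝ => x + s • v) v s := by
      simpa using ((hasDerivAt_id s).smul_const v).const_add x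
    exact ((hψ.differentiable (by simp)) _).hasFDerivAt.comp_hasDerivAt s h1
  have h1 := intervalIntegral.integral_eq_sub_of_hasDerivAt (a := 0) (b := 1)
    (fun s _ => hd s) ((hc.clm_apply continuous_const).intervalIntegrable 0 1)
  simp only [one_smul, zero_smul, add_zero] at h1
  have hm : Measurable fun s : ℝ => ‖gradient ψ (x + s • v)‖ₑ := by
    have : (fun s : ℝ => ‖gradient ψ (x + s • v)‖ₑ) = fun s => ‖fderiv ℝ ψ (x + s • v)‖ₑ := by
      funext s
      rw [← ofReal_norm, norm_gradient, ofReal_norm]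
    rw [this]
    exact hc.enorm.measurable
  have h2 : ‖ψ (x + v) - ψ x‖ₑ ≤
      ‖v‖ₑ * ∫⁻ s in Set.Icc (0 : ℝ) 1, ‖gradient ψ (x + s • v)‖ₑ := by
    rw [← h1, intervalIntegral.integral_of_le zero_le_one, ← integral_Icc_eq_integral_Ioc,
      ← lintegral_const_mul _ hm]
    refine (enorm_integral_le_lintegral_enorm _).trans (lintegral_mono fun s => ?_)
    rw [← ofReal_norm, ← ofReal_norm, ← ofReal_norm, norm_gradient, mul_comm,
      ← ENNReal.ofReal_mul (norm_nonneg _)]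
    exact ENNReal.ofReal_le_ofReal (ContinuousLinearMap.le_opNorm _ _)
  calc ‖ψ (x + v) - ψ x‖ₑ ^ 2
      ≤ (‖v‖ₑ * ∫⁻ s in Set.Icc (0 : ℝ) 1, ‖gradient ψ (x + s • v)‖ₑ) ^ 2 := by gcongr
    _ ≤ _ := by
      rw [mul_pow]
      gcongr
      simpa using lintegral_sq_le (volume.restrict (Set.Icc (0 : ℝ) 1)) hm.aemeasurable

variable [MeasurableSpace E] [BorelSpace E]

theorem lintegral_comp_add_smul (μ : Measure E) [μ.IsAddHaarMeasure] (f : E → ℝ≥0∞) (y : E)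
    {s : ℝ} (hs : 0 < s) :
    ∫⁻ k, f (y + s • k) ∂μ = ENNReal.ofReal (s ^ Module.finrank ℝ E)⁻¹ * ∫⁻ k, f k ∂μ := by
  rw [← (measurableEmbedding_const_smul₀ hs.ne').lintegral_map (fun k => f (y + k)),
    Measure.map_addHaar_smul μ hs.ne', lintegral_smul_measure, lintegral_add_left_eq_self,
    abs_of_nonneg (by positivity), smul_eq_mul]

/-- The pointwise bound integrates the gradient along the segment from x to x + v. After Tonelli,
translation invariance makes the integral over x independent of the position s on the segment. -/
theorem lintegral_enorm_sub_sq_le (μ : Measure E) [μ.IsAddHaarMeasure] {ψ : E → ℝ}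
    (hψ : ContDiff ℝ 1 ψ) (v : E) :
    ∫⁻ x, ‖ψ (x + v) - ψ x‖ₑ ^ 2 ∂μ ≤ ‖v‖ₑ ^ 2 * ∫⁻ x, ‖gradient ψ x‖ₑ ^ 2 ∂μ := by
  have hg : Continuous (gradient ψ) :=
    (LinearIsometryEquiv.continuous _).comp (hψ.continuous_fderiv (by simp))
  have hm : Measurable fun a : E × ℝ => ‖gradient ψ (a.1 + a.2 • v)‖ₑ ^ 2 :=
    ((hg.comp (by fun_prop : Continuous fun a : E × ℝ => a.1 + a.2 • v)).enorm.measurable.pow_const 2)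
  calc ∫⁻ x, ‖ψ (x + v) - ψ x‖ₑ ^ 2 ∂μ
      ≤ ∫⁻ x, ‖v‖ₑ ^ 2 * (∫⁻ s in Set.Icc (0 : ℝ) 1, ‖gradient ψ (x + s • v)‖ₑ ^ 2) ∂μ :=
        lintegral_mono fun x => enorm_sub_sq_le hψ x v
    _ = ‖v‖ₑ ^ 2 * ∫⁻ x, (∫⁻ s in Set.Icc (0 : ℝ) 1, ‖gradient ψ (x + s • v)‖ₑ ^ 2) ∂μ :=
        lintegral_const_mul _ hm.lintegral_prod_right'
    _ = ‖v‖ₑ ^ 2 * ∫⁻ s in Set.Icc (0 : ℝ) 1, ∫⁻ x, ‖gradient ψ (x + s • v)‖ₑ ^ 2 ∂μ := by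
        rw [lintegral_lintegral_swap (f := fun (x : E) (s : ℝ) => ‖gradient ψ (x + s • v)‖ₑ ^ 2)
          hm.aemeasurable]
    _ = _ := by
        congr 1
        simp_rw [lintegral_add_right_eq_self (fun x => ‖gradient ψ x‖ₑ ^ 2)]
        simp

end Translation

/-! ### Slides: displacements adapted to the degenerate gradient. -/

section Slide

variable {m n : ℕ} {γ : ℝ≥0}

/-- The sign of `⟨x, e⟩`, with value `1` on the hyperplane. -/
def side (e x : EuclideanSpace ℝ (Fin m)) : ℝ := if 0 ≤ inner ℝ x e then 1 else -1

/-- A translation in `x` by a vector of length about `t`, away from `x = 0`, followed by a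
translation in `y` adapted to the Grushin gradient. -/
def slide (γ : ℝ≥0) (e : EuclideanSpace ℝ (Fin m)) (t : ℝ) (z w : Space m n) : Space m n :=
  (z.1 + t • ((2 * side e z.1) • e + w.1),
    z.2 + (t * ‖z.1 + t • ((2 * side e z.1) • e + w.1)‖ ^ (γ : ℝ)) • w.2)

theorem measurable_slide (γ : ℝ≥0) (e : EuclideanSpace ℝ (Fin m)) (t : ℝ) :
    Measurable fun a : Space m n × Space m n => slide γ e t a.1 a.2 := by
  have h0 : Measurable (side e) :=
    Measurable.ite (measurableSet_le measurable_const (by fun_prop)) measurable_const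
      measurable_const
  have h1 : Measurable fun a : Space m n × Space m n =>
      a.1.1 + t • ((2 * side e a.1.1) • e + a.2.1) := by
    have := h0.comp (measurable_fst.comp measurable_fst :
      Measurable fun a : Space m n × Space m n => a.1.1)
    have h2 : Measurable fun a : Space m n × Space m n => (2 * side e a.1.1) • e :=
      (this.const_mul 2).smul_const e
    fun_prop
  refine h1.prodMk ?_
  have h3 : Measurable fun a : Space m n × Space m n =>
      ‖a.1.1 + t • ((2 * side e a.1.1) • e + a.2.1)‖ ^ (γ : ℝ) := h1.norm.pow_const _
  exact (measurable_snd.comp measurable_fst).add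
    ((h3.const_mul t).smul (measurable_snd.comp measurable_snd))

theorem side_eq (e x : EuclideanSpace ℝ (Fin m)) : side e x = 1 ∨ side e x = -1 := by
  unfold side
  split_ifs <;> simp

/-- Pair with the unit vector ±e on the side of x: x contributes |⟨x, e⟩| ≥ 0, the fixed shift
contributes 2t, and h costs at most t. This is why the shift carries the factor 2. -/
theorem le_norm_shift {e : EuclideanSpace ℝ (Fin m)} (he : ‖e‖ = 1) {t : ℝ} (ht : 0 < t)
    (x : EuclideanSpace ℝ (Fin m)) {h : EuclideanSpace ℝ (Fin m)} (hh : ‖h‖ ≤ 1) :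
    t ≤ ‖x + t • ((2 * side e x) • e + h)‖ := by
  have h1 : inner ℝ (x + t • ((2 * side e x) • e + h)) (side e x • e) ≤
      ‖x + t • ((2 * side e x) • e + h)‖ := by
    refine (real_inner_le_norm _ _).trans_eq ?_
    rcases side_eq e x with h | h <;> simp [h, he]
  refine le_trans ?_ h1
  have h2 : |inner ℝ h e| ≤ 1 := by
    refine (abs_real_inner_le_norm _ _).trans ?_
    rw [he, mul_one]
    exact hh
  have h3 := abs_le.1 h2
  simp only [inner_add_left, inner_smul_left, inner_smul_right, real_inner_self_eq_norm_sq, he]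
  unfold side
  split_ifs with h4
  · simp
    nlinarith
  · simp
    nlinarith

/-- For fixed h the slide is affine in k with Jacobian (t|x'|^γ)^n, and |x'| ≥ t bounds this below
by t^((1+γ)n); the x-component is affine in h with Jacobian t^m. The product of the two bounds is
t^Q. If γ = 0 the weight is 1 and no direction e is needed. -/
theorem lintegral_slide_le (e : EuclideanSpace ℝ (Fin m)) (he : γ ≠ 0 → ‖e‖ = 1) {t : ℝ}
    (ht : 0 < t) {g : Space m n → ℝ≥0∞} (hg : Measurable g) (z : Space m n) :
    ∫⁻ w in Metric.ball 0 1, g (slide γ e t z w) ≤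
      ENNReal.ofReal (t ^ homDim m n γ)⁻¹ * ∫⁻ w, g w := by
  set x' : EuclideanSpace ℝ (Fin m) → EuclideanSpace ℝ (Fin m) :=
    fun h => z.1 + t • ((2 * side e z.1) • e + h) with hx'
  have hmeas : Measurable fun w : Space m n => g (slide γ e t z w) :=
    hg.comp ((measurable_slide γ e t).comp (measurable_const.prodMk measurable_id))
  have hG : Measurable fun x => ∫⁻ y, g (x, y) := hg.lintegral_prod_right'
  have hball : Metric.ball (0 : Space m n) 1 =
      Metric.ball (0 : EuclideanSpace ℝ (Fin m)) 1 ×ˢ Metric.ball 0 1 :=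
    (ball_prod_same _ _ _).symm
  calc ∫⁻ w in Metric.ball 0 1, g (slide γ e t z w)
      = ∫⁻ h in Metric.ball 0 1, ∫⁻ k in Metric.ball 0 1, g (slide γ e t z (h, k)) := by
        rw [hball, Measure.volume_eq_prod, ← Measure.prod_restrict,
          lintegral_prod _ hmeas.aemeasurable]
    _ ≤ ∫⁻ h in Metric.ball 0 1, ENNReal.ofReal (t ^ ((1 + (γ : ℝ)) * n))⁻¹ *
          ∫⁻ y, g (x' h, y) := by
        refine setLIntegral_mono' Metric.isOpen_ball.measurableSet fun h hh => ?_
        have hpos : t ^ (1 + (γ : ℝ)) ≤ t * ‖x' h‖ ^ (γ : ℝ) := by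
          rw [Real.rpow_add ht, Real.rpow_one]
          refine mul_le_mul_of_nonneg_left ?_ ht.le
          by_cases hγ : γ = 0
          · simp [hγ]
          · exact Real.rpow_le_rpow ht.le
              (le_norm_shift (he hγ) ht z.1 (mem_ball_zero_iff.1 hh).le) γ.2
        have hs : 0 < t * ‖x' h‖ ^ (γ : ℝ) := (Real.rpow_pos_of_pos ht _).trans_le hpos
        calc ∫⁻ k in Metric.ball 0 1, g (slide γ e t z (h, k))
            ≤ ∫⁻ k, g (x' h, z.2 + (t * ‖x' h‖ ^ (γ : ℝ)) • k) := setLIntegral_le_lintegral _ _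
          _ = _ := lintegral_comp_add_smul volume (fun y => g (x' h, y)) z.2 hs
          _ ≤ _ := by
              gcongr
              rw [finrank_euclideanSpace_fin, Real.rpow_mul ht.le, Real.rpow_natCast]
              gcongr
    _ ≤ ∫⁻ h, ENNReal.ofReal (t ^ ((1 + (γ : ℝ)) * n))⁻¹ * ∫⁻ y, g (x' h, y) :=
        setLIntegral_le_lintegral _ _
    _ = ENNReal.ofReal (t ^ ((1 + (γ : ℝ)) * n))⁻¹ * ∫⁻ h, ∫⁻ y, g (x' h, y) :=
        lintegral_const_mul _ (hG.comp (by fun_prop))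
    _ = ENNReal.ofReal (t ^ ((1 + (γ : ℝ)) * n))⁻¹ *
          (ENNReal.ofReal (t ^ m)⁻¹ * ∫⁻ x, ∫⁻ y, g (x, y)) := by
        congr 1
        have := lintegral_comp_add_smul volume (fun x => ∫⁻ y, g (x, y))
          (z.1 + t • (2 * side e z.1) • e) ht
        rw [finrank_euclideanSpace_fin] at this
        rw [← this]
        refine lintegral_congr fun h => ?_
        simp only [hx', smul_add, add_assoc]
    _ = _ := by
        rw [← mul_assoc, ← ENNReal.ofReal_mul (by positivity), Measure.volume_eq_prod,
          lintegral_prod _ hg.aemeasurable]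
        congr 2
        rw [homDim, Real.rpow_add ht, Real.rpow_natCast, mul_inv, mul_comm]

theorem norm_grad_sq (u : Space m n → ℝ) (z : Space m n) :
    ‖grad γ u z‖ ^ 2 = ‖gradient (fun x => u (x, z.2)) z.1‖ ^ 2 +
      ‖((1 + (γ : ℝ)) * ‖z.1‖ ^ (γ : ℝ)) • gradient (fun y => u (z.1, y)) z.2‖ ^ 2 := by
  rw [WithLp.prod_norm_sq_eq_of_L2]
  rfl

theorem enorm_gradient_fst_le (u : Space m n → ℝ) (z : Space m n) :
    ‖gradient (fun x => u (x, z.2)) z.1‖ₑ ≤ ‖grad γ u z‖ₑ := by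
  rw [← ofReal_norm, ← ofReal_norm]
  refine ENNReal.ofReal_le_ofReal (abs_le_of_sq_le_sq' ?_ (norm_nonneg _)).2
  rw [norm_grad_sq]
  exact le_add_of_nonneg_right (sq_nonneg _)

theorem enorm_gradient_snd_le (u : Space m n → ℝ) (z : Space m n) :
    ‖‖z.1‖ ^ (γ : ℝ)‖ₑ * ‖gradient (fun y => u (z.1, y)) z.2‖ₑ ≤ ‖grad γ u z‖ₑ := by
  rw [← enorm_smul, ← ofReal_norm, ← ofReal_norm]
  refine ENNReal.ofReal_le_ofReal (abs_le_of_sq_le_sq' ?_ (norm_nonneg _)).2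
  rw [norm_grad_sq, mul_smul, norm_smul (1 + (γ : ℝ)), Real.norm_of_nonneg (by positivity)]
  refine le_add_of_nonneg_of_le (sq_nonneg _) ?_
  gcongr
  exact le_mul_of_one_le_left (norm_nonneg _) (by simp)

theorem continuous_grad {u : Space m n → ℝ} (hu : ContDiff ℝ 1 u) : Continuous (grad γ u) := by
  rw [grad_eq (hu.differentiable (by simp))]
  have h : Continuous (fderiv ℝ u) := hu.continuous_fderiv (by simp)
  have h1 : Continuous fun z : Space m n => ‖z.1‖ ^ (γ : ℝ) :=
    continuous_fst.norm.rpow_const fun _ => Or.inr γ.2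
  refine (WithLp.prod_continuous_toLp 2 _ _).comp (Continuous.prodMk ?_ ?_)
  · exact (LinearIsometryEquiv.continuous _).comp (h.clm_comp continuous_const)
  · exact (continuous_const.mul h1).smul
      ((LinearIsometryEquiv.continuous _).comp (h.clm_comp continuous_const))

theorem lintegral_shift_fst_le {u : Space m n → ℝ} (hu : ContDiff ℝ 1 u)
    (v : EuclideanSpace ℝ (Fin m)) :
    ∫⁻ z : Space m n, ‖u (z.1 + v, z.2) - u z‖ₑ ^ 2 ≤ ‖v‖ₑ ^ 2 * ∫⁻ z, ‖grad γ u z‖ₑ ^ 2 := by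
  have hc := hu.continuous
  have hg : Measurable fun z => ‖grad γ u z‖ₑ ^ 2 :=
    ((continuous_grad hu).enorm.measurable.pow_const 2)
  have hm : Measurable fun z : Space m n => ‖u (z.1 + v, z.2) - u z‖ₑ ^ 2 :=
    (((hc.comp (by fun_prop)).sub hc).enorm.measurable.pow_const 2)
  rw [Measure.volume_eq_prod, lintegral_prod_symm _ hm.aemeasurable,
    lintegral_prod_symm _ hg.aemeasurable, ← lintegral_const_mul _ hg.lintegral_prod_left']
  refine lintegral_mono fun y => ?_
  refine (lintegral_enorm_sub_sq_le volume (ψ := fun x => u (x, y))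
    (hu.comp (by fun_prop)) v).trans ?_
  gcongr with x
  exact enorm_gradient_fst_le u (x, y)

/-- The shift depends on x only, so on each fibre it is a constant translation, and its factor |x|^γ
is exactly the weight of the y-part of the Grushin gradient. -/
theorem lintegral_shift_snd_le {u : Space m n → ℝ} (hu : ContDiff ℝ 1 u) (t : ℝ)
    (k : EuclideanSpace ℝ (Fin n)) :
    ∫⁻ z : Space m n, ‖u (z.1, z.2 + (t * ‖z.1‖ ^ (γ : ℝ)) • k) - u z‖ₑ ^ 2 ≤
      (‖t‖ₑ * ‖k‖ₑ) ^ 2 * ∫⁻ z, ‖grad γ u z‖ₑ ^ 2 := by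
  have hc := hu.continuous
  have h1 : Continuous fun z : Space m n => ‖z.1‖ ^ (γ : ℝ) :=
    continuous_fst.norm.rpow_const fun _ => Or.inr γ.2
  have hg : Measurable fun z => ‖grad γ u z‖ₑ ^ 2 :=
    ((continuous_grad hu).enorm.measurable.pow_const 2)
  have hm : Measurable fun z : Space m n =>
      ‖u (z.1, z.2 + (t * ‖z.1‖ ^ (γ : ℝ)) • k) - u z‖ₑ ^ 2 :=
    (((hc.comp (g := u) (f := fun z : Space m n =>
      (z.1, z.2 + (t * ‖z.1‖ ^ (γ : ℝ)) • k)) (by fun_prop)).sub hc).enorm.measurable.pow_const 2)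
  rw [Measure.volume_eq_prod, lintegral_prod _ hm.aemeasurable,
    lintegral_prod _ hg.aemeasurable, ← lintegral_const_mul _ hg.lintegral_prod_right']
  refine lintegral_mono fun x => ?_
  have h2 : Continuous fun y => ‖gradient (fun y => u (x, y)) y‖ₑ := by
    refine Continuous.enorm ((LinearIsometryEquiv.continuous _).comp ?_)
    exact (hu.comp (by fun_prop : ContDiff ℝ 1 fun y => (x, y))).continuous_fderiv (by simp)
  have h3 := lintegral_enorm_sub_sq_le volume (ψ := fun y => u (x, y))
    (hu.comp (by fun_prop : ContDiff ℝ 1 fun y => (x, y))) ((t * ‖x‖ ^ (γ : ℝ)) • k)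
  have h4 : ∀ y, ‖(t * ‖x‖ ^ (γ : ℝ)) • k‖ₑ ^ 2 * ‖gradient (fun y => u (x, y)) y‖ₑ ^ 2 ≤
      (‖t‖ₑ * ‖k‖ₑ) ^ 2 * ‖grad γ u (x, y)‖ₑ ^ 2 := by
    intro y
    have h5 := enorm_gradient_snd_le (γ := γ) u (x, y)
    rw [← mul_pow, ← mul_pow, enorm_smul, enorm_mul]
    refine pow_le_pow_left' ?_ 2
    calc ‖t‖ₑ * ‖‖x‖ ^ (γ : ℝ)‖ₑ * ‖k‖ₑ * ‖gradient (fun y => u (x, y)) y‖ₑ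
        = ‖t‖ₑ * ‖k‖ₑ * (‖‖x‖ ^ (γ : ℝ)‖ₑ * ‖gradient (fun y => u (x, y)) y‖ₑ) := by ring
      _ ≤ _ := mul_le_mul_right h5 _
  rw [← lintegral_const_mul _ (h2.measurable.pow_const 2)] at h3
  refine (h3.trans (lintegral_mono h4)).trans ?_
  rw [lintegral_const_mul]
  exact hg.of_uncurry_left (f := fun x y => ‖grad γ u (x, y)‖ₑ ^ 2)

theorem enorm_add_sq_le (a b : ℝ) : ‖a + b‖ₑ ^ 2 ≤ 2 * ‖a‖ₑ ^ 2 + 2 * ‖b‖ₑ ^ 2 := by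
  calc ‖a + b‖ₑ ^ 2 ≤ (‖a‖ₑ + ‖b‖ₑ) ^ 2 := by gcongr; exact enorm_add_le a b
    _ ≤ _ := by
      have := ENNReal.rpow_add_le_mul_rpow_add_rpow ‖a‖ₑ ‖b‖ₑ (p := 2) (by norm_num)
      norm_num at this
      rwa [← mul_add]

/-- The difference is split at the intermediate point (x', y). The y-step uses the weight at the new
point x', so a translation in x reduces it to `lintegral_shift_snd_le`; the x-step is a translation
of length at most 3t. -/
theorem lintegral_slide_sub_sq_le (γ : ℝ≥0) (e : EuclideanSpace ℝ (Fin m)) (he : ‖e‖ ≤ 1) {t : ℝ}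
    (ht : 0 < t) {u : Space m n → ℝ} (hu : ContDiff ℝ 1 u) {w : Space m n} (hw : ‖w‖ ≤ 1) :
    ∫⁻ z, ‖u (slide γ e t z w) - u z‖ₑ ^ 2 ≤
      ENNReal.ofReal (40 * t ^ 2) * ∫⁻ z, ‖grad γ u z‖ₑ ^ 2 := by
  have hc := hu.continuous
  set E := ∫⁻ z, ‖grad γ u z‖ₑ ^ 2
  set v : ℝ → EuclideanSpace ℝ (Fin m) := fun σ => t • ((2 * σ) • e + w.1) with hv
  -- The slide is not a translation, because the sign depends on z. With the sign frozen to σ it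
  -- becomes one, and the sum over σ = ±1 dominates. Each sign costs 2·1 + 2·9 = 20, whence the
  -- constant 40.
  set F : ℝ → Space m n → ℝ≥0∞ := fun σ z =>
    2 * ‖u ((z.1 + v σ), z.2 + (t * ‖z.1 + v σ‖ ^ (γ : ℝ)) • w.2) - u (z.1 + v σ, z.2)‖ₑ ^ 2 +
    2 * ‖u (z.1 + v σ, z.2) - u z‖ₑ ^ 2 with hF
  have h1 : Continuous fun z : Space m n => ‖z.1‖ ^ (γ : ℝ) :=
    continuous_fst.norm.rpow_const fun _ => Or.inr γ.2
  have hm1 : ∀ σ, Measurable fun z : Space m n => ‖u (z.1 + v σ, z.2) - u z‖ₑ ^ 2 := fun σ =>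
    (((hc.comp (by fun_prop)).sub hc).enorm.measurable.pow_const 2)
  have hm2 : ∀ σ, Measurable fun z : Space m n =>
      ‖u ((z.1 + v σ), z.2 + (t * ‖z.1 + v σ‖ ^ (γ : ℝ)) • w.2) - u (z.1 + v σ, z.2)‖ₑ ^ 2 := by
    intro σ
    have h2 : Continuous fun z : Space m n => ‖z.1 + v σ‖ ^ (γ : ℝ) :=
      (continuous_fst.add continuous_const).norm.rpow_const fun _ => Or.inr γ.2
    exact (((hc.comp (g := u) (f := fun z : Space m n =>
      (z.1 + v σ, z.2 + (t * ‖z.1 + v σ‖ ^ (γ : ℝ)) • w.2)) (by fun_prop)).sub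
        (hc.comp (f := fun z : Space m n => (z.1 + v σ, z.2)) (by fun_prop))).enorm.measurable.pow_const 2)
  have hnv : ∀ σ : ℝ, |σ| = 1 → ‖v σ‖ ≤ 3 * t := by
    intro σ hσ
    have h2 : ‖w.1‖ ≤ 1 := (norm_fst_le w).trans hw
    rw [hv]
    simp only
    rw [norm_smul, Real.norm_of_nonneg ht.le]
    have h3 : ‖(2 * σ) • e + w.1‖ ≤ 3 := by
      refine (norm_add_le _ _).trans ?_
      rw [norm_smul, norm_mul, Real.norm_eq_abs σ, hσ]
      norm_num
      linarith
    nlinarith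
  have hFb : ∀ σ : ℝ, |σ| = 1 → ∫⁻ z, F σ z ≤ ENNReal.ofReal (20 * t ^ 2) * E := by
    intro σ hσ
    rw [hF]
    simp only
    rw [lintegral_add_left ((hm2 σ).const_mul 2), lintegral_const_mul _ (hm2 σ),
      lintegral_const_mul _ (hm1 σ)]
    have h2 : ∫⁻ z : Space m n,
        ‖u ((z.1 + v σ), z.2 + (t * ‖z.1 + v σ‖ ^ (γ : ℝ)) • w.2) - u (z.1 + v σ, z.2)‖ₑ ^ 2 ≤
        ENNReal.ofReal (t ^ 2) * E := by
      have h3 := (measurePreserving_add_right (volume : Measure (EuclideanSpace ℝ (Fin m)))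
        (v σ)).prod (MeasurePreserving.id (volume : Measure (EuclideanSpace ℝ (Fin n))))
      have h4 := lintegral_shift_snd_le (γ := γ) hu t w.2
      rw [Measure.volume_eq_prod, ← h3.lintegral_comp] at h4
      · refine h4.trans (mul_le_mul_left ?_ _)
        rw [← ofReal_norm, ← ofReal_norm, ← ENNReal.ofReal_mul (norm_nonneg _),
          ← ENNReal.ofReal_pow (by positivity)]
        refine ENNReal.ofReal_le_ofReal ?_
        rw [Real.norm_of_nonneg ht.le]
        have : ‖w.2‖ ≤ 1 := (norm_snd_le w).trans hw
        gcongr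
        nlinarith
      · exact (((hc.comp (by fun_prop)).sub hc).enorm.measurable.pow_const 2)
    have h3 : ∫⁻ z : Space m n, ‖u (z.1 + v σ, z.2) - u z‖ₑ ^ 2 ≤
        ENNReal.ofReal (9 * t ^ 2) * E := by
      refine (lintegral_shift_fst_le (γ := γ) hu (v σ)).trans ?_
      gcongr
      rw [← ofReal_norm, ← ENNReal.ofReal_pow (by positivity)]
      refine ENNReal.ofReal_le_ofReal ?_
      calc ‖v σ‖ ^ 2 ≤ (3 * t) ^ 2 := by gcongr; exact hnv σ hσ
        _ = _ := by ring
    calc _ ≤ 2 * (ENNReal.ofReal (t ^ 2) * E) + 2 * (ENNReal.ofReal (9 * t ^ 2) * E) := by gcongr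
      _ = _ := by
        rw [← mul_assoc, ← mul_assoc, ← add_mul, ← mul_add, ← ENNReal.ofReal_add (by positivity)
          (by positivity), show (2 : ℝ≥0∞) = ENNReal.ofReal 2 by simp,
          ← ENNReal.ofReal_mul (by norm_num)]
        congr 2
        ring
  calc ∫⁻ z, ‖u (slide γ e t z w) - u z‖ₑ ^ 2 ≤ ∫⁻ z, (F 1 z + F (-1) z) := by
        refine lintegral_mono fun z => ?_
        have h2 : ∀ σ, side e z.1 = σ → ‖u (slide γ e t z w) - u z‖ₑ ^ 2 ≤ F σ z := by
          intro σ hσ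
          rw [hF]
          simp only [slide, hσ, hv]
          convert enorm_add_sq_le _ _ using 3
          ring
        rcases side_eq e z.1 with h | h
        · exact (h2 _ h).trans le_self_add
        · exact (h2 _ h).trans le_add_self
    _ = (∫⁻ z, F 1 z) + ∫⁻ z, F (-1) z :=
        lintegral_add_left (f := F 1) (((hm2 1).const_mul 2).add ((hm1 1).const_mul 2)) _
    _ ≤ ENNReal.ofReal (20 * t ^ 2) * E + ENNReal.ofReal (20 * t ^ 2) * E := by
        exact add_le_add (hFb 1 (by simp)) (hFb (-1) (by simp))
    _ = _ := by
        rw [← add_mul, ← ENNReal.ofReal_add (by positivity) (by positivity)]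
        congr 2
        ring

end Slide

/-! ### The Sobolev inequality by truncation. -/

section Sobolev

variable {m n : ℕ} {γ : ℝ≥0}

instance : (volume : Measure (Space m n)).IsAddHaarMeasure :=
  inferInstanceAs ((volume : Measure (EuclideanSpace ℝ (Fin m))).prod
    (volume : Measure (EuclideanSpace ℝ (Fin n)))).IsAddHaarMeasure

/-- The exponent `2^*_γ = 2 N_γ / (N_γ - 2)` of the Sobolev inequality. -/
def sobExp (m n : ℕ) (γ : ℝ≥0) : ℝ := 2 * homDim m n γ / (homDim m n γ - 2)

theorem three_le_homDim (hN : 3 ≤ m + n) : 3 ≤ homDim m n γ := by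
  have h1 : (3 : ℝ) ≤ m + n := by exact_mod_cast hN
  have h2 : 0 ≤ (γ : ℝ) * n := by positivity
  rw [homDim]
  linarith

theorem exists_direction (hm : 0 < m ∨ γ = 0) :
    ∃ e : EuclideanSpace ℝ (Fin m), ‖e‖ ≤ 1 ∧ (γ ≠ 0 → ‖e‖ = 1) := by
  rcases hm with hm | hγ
  · exact ⟨EuclideanSpace.single ⟨0, hm⟩ 1, by simp, by simp⟩
  · exact ⟨0, by simp, fun h => absurd hγ h⟩

/-- A weak form of the Nash inequality for a function with a plateau. -/
theorem volume_plateau_le (hm : 0 < m ∨ γ = 0) (hQ : 0 < homDim m n γ) :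
    ∃ C : ℝ≥0, ∀ (g : Space m n → ℝ) (_ : ContDiff ℝ 1 g) (M : ℝ) (_ : 0 < M)
      (_ : ∀ z, |g z| ≤ M) (_ : volume {z | g z ≠ 0} ≠ ∞),
      volume {z | g z = M} * ENNReal.ofReal (M ^ 2) ≤
        C * volume {z | g z ≠ 0} ^ (2 / homDim m n γ) * ∫⁻ z, ‖grad γ g z‖ₑ ^ 2 := by
  obtain ⟨e, he1, he⟩ := exists_direction (γ := γ) hm
  set Q := homDim m n γ
  set P : Set (Space m n) := Metric.ball 0 1
  have hP : MeasurableSet P := Metric.isOpen_ball.measurableSet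
  have hPtop : volume P ≠ ∞ := measure_ball_lt_top.ne
  set κ : ℝ := (volume P).toReal with hκ
  have hκ0 : 0 < κ := ENNReal.toReal_pos (Metric.measure_ball_pos _ _ one_pos).ne' hPtop
  have hκP : volume P = ENNReal.ofReal κ := (ENNReal.ofReal_toReal hPtop).symm
  refine ⟨Real.toNNReal (160 * (2 / κ) ^ (2 / Q)), fun g hg M hM hgM hV => ?_⟩
  set E := ∫⁻ z, ‖grad γ g z‖ₑ ^ 2
  have hmg : Measurable g := hg.continuous.measurable
  have hsub : volume {z | g z = M} ≤ volume {z | g z ≠ 0} :=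
    measure_mono fun z (hz : g z = M) => by simp [hz, hM.ne']
  rcases eq_or_ne (volume {z | g z ≠ 0}) 0 with h0 | h0
  · rw [h0] at hsub
    simp [le_zero_iff.1 hsub]
  set v : ℝ := (volume {z | g z ≠ 0}).toReal with hv
  have hv0 : 0 < v := ENNReal.toReal_pos h0 hV
  have hvV : volume {z | g z ≠ 0} = ENNReal.ofReal v := (ENNReal.ofReal_toReal hV).symm
  -- With this size of slide, the integral of |g| over the slides of a point is at most t^(-Q) M v =
  -- κM/2, half of what the plateau value M would give.
  set t : ℝ := (2 * v / κ) ^ (1 / Q) with ht_def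
  have ht : 0 < t := by positivity
  have htQ : t ^ Q = 2 * v / κ := by
    rw [ht_def, ← Real.rpow_mul (by positivity), one_div_mul_cancel hQ.ne', Real.rpow_one]
  have ht2 : t ^ 2 = (2 / κ) ^ (2 / Q) * v ^ (2 / Q) := by
    rw [ht_def, ← Real.rpow_natCast, ← Real.rpow_mul (by positivity),
      ← Real.mul_rpow (by positivity) (by positivity)]
    congr 1
    · ring
    · push_cast; ring
  have hL1 : ∫⁻ z, ‖g z‖ₑ ≤ ENNReal.ofReal (M * v) := by
    calc ∫⁻ z, ‖g z‖ₑ ≤ ∫⁻ z in {z | g z ≠ 0}, ENNReal.ofReal M := by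
          rw [← lintegral_indicator (s := {z | g z ≠ 0})
            (hmg (measurableSet_singleton 0).compl)]
          refine lintegral_mono fun z => ?_
          by_cases hz : g z = 0
          · simp [hz]
          · rw [Set.indicator_of_mem (by exact hz), ← ofReal_norm]
            exact ENNReal.ofReal_le_ofReal (hgM z)
      _ = _ := by rw [setLIntegral_const, hvV, ← ENNReal.ofReal_mul hM.le]
  have hslide : ∀ z, Measurable fun w => g (slide γ e t z w) := fun z =>
    hmg.comp ((measurable_slide γ e t).comp (measurable_const.prodMk measurable_id))
  -- At a plateau point the oscillation over the slides is therefore at least κM/2 in L¹ of the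
  -- ball, and Cauchy–Schwarz turns this into an L² bound.
  have hpt : ∀ z, g z = M → ENNReal.ofReal (κ * M ^ 2 / 4) ≤
      ∫⁻ w in P, ‖g (slide γ e t z w) - g z‖ₑ ^ 2 := by
    intro z hz
    have hdm : Measurable fun w => ‖g (slide γ e t z w) - g z‖ₑ :=
      ((hslide z).sub measurable_const).enorm
    have h1 : ∫⁻ w in P, ‖g (slide γ e t z w)‖ₑ ≤ ENNReal.ofReal (κ * M / 2) := by
      refine (lintegral_slide_le e he ht hmg.enorm z).trans ?_
      refine (mul_le_mul_right hL1 _).trans ?_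
      rw [← ENNReal.ofReal_mul (by positivity)]
      refine ENNReal.ofReal_le_ofReal (le_of_eq ?_)
      change (t ^ Q)⁻¹ * _ = _
      rw [htQ]
      field_simp
    have h2 : ENNReal.ofReal (κ * M / 2) ≤ ∫⁻ w in P, ‖g (slide γ e t z w) - g z‖ₑ := by
      have h3 : ENNReal.ofReal (κ * M) ≤ (∫⁻ w in P, ‖g (slide γ e t z w) - g z‖ₑ) +
          ENNReal.ofReal (κ * M / 2) := by
        calc ENNReal.ofReal (κ * M) = ∫⁻ w in P, ENNReal.ofReal M := by
              rw [setLIntegral_const, hκP, mul_comm, ENNReal.ofReal_mul hM.le]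
          _ ≤ ∫⁻ w in P, (‖g (slide γ e t z w) - g z‖ₑ + ‖g (slide γ e t z w)‖ₑ) := by
              refine lintegral_mono fun w => ?_
              rw [← ofReal_norm, ← ofReal_norm, ← ENNReal.ofReal_add (by positivity)
                (by positivity)]
              refine ENNReal.ofReal_le_ofReal ?_
              have := norm_sub_norm_le (g z) (g (slide γ e t z w))
              rw [norm_sub_rev] at this
              rw [hz, Real.norm_of_nonneg hM.le] at this
              rw [hz]
              linarith
          _ = _ := lintegral_add_left hdm _
          _ ≤ _ := by gcongr
      have h4 : ENNReal.ofReal (κ * M) = ENNReal.ofReal (κ * M / 2) + ENNReal.ofReal (κ * M / 2) := by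
        rw [← ENNReal.ofReal_add (by positivity) (by positivity)]
        congr 1; ring
      rw [h4] at h3
      exact (ENNReal.add_le_add_iff_right ENNReal.ofReal_ne_top).1 h3
    have h5 := lintegral_sq_le (volume.restrict P) hdm.aemeasurable
    rw [Measure.restrict_apply_univ, hκP] at h5
    have h6 : ENNReal.ofReal κ * ENNReal.ofReal (κ * M ^ 2 / 4) ≤
        ENNReal.ofReal κ * ∫⁻ w in P, ‖g (slide γ e t z w) - g z‖ₑ ^ 2 := by
      refine le_trans (le_trans (le_of_eq ?_) (pow_le_pow_left' h2 2)) h5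
      rw [← ENNReal.ofReal_mul hκ0.le, ← ENNReal.ofReal_pow (by positivity)]
      congr 1; ring
    exact (ENNReal.mul_le_mul_iff_right (by simpa using hκ0) ENNReal.ofReal_ne_top).1 h6
  have hmm : Measurable fun a : Space m n × Space m n => ‖g (slide γ e t a.1 a.2) - g a.1‖ₑ ^ 2 :=
    ((hmg.comp (measurable_slide γ e t)).sub (hmg.comp measurable_fst)).enorm.pow_const 2
  -- Integrate over the plateau and exchange the integrals: each single slide moves g by at most 40
  -- t² E in squared L² norm. Clearing the 4 produces 160.
  have hint : ENNReal.ofReal (κ * M ^ 2 / 4) * volume {z | g z = M} ≤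
      ENNReal.ofReal κ * (ENNReal.ofReal (40 * t ^ 2) * E) := by
    calc ENNReal.ofReal (κ * M ^ 2 / 4) * volume {z | g z = M}
        = ∫⁻ z in {z | g z = M}, ENNReal.ofReal (κ * M ^ 2 / 4) := (setLIntegral_const _ _).symm
      _ ≤ ∫⁻ z in {z | g z = M}, ∫⁻ w in P, ‖g (slide γ e t z w) - g z‖ₑ ^ 2 :=
          setLIntegral_mono' (hmg (measurableSet_singleton M)) hpt
      _ ≤ ∫⁻ z, ∫⁻ w in P, ‖g (slide γ e t z w) - g z‖ₑ ^ 2 := setLIntegral_le_lintegral _ _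
      _ = ∫⁻ w in P, ∫⁻ z, ‖g (slide γ e t z w) - g z‖ₑ ^ 2 := by
          rw [lintegral_lintegral_swap
            (f := fun z w => ‖g (slide γ e t z w) - g z‖ₑ ^ 2) hmm.aemeasurable]
      _ ≤ ∫⁻ w in P, ENNReal.ofReal (40 * t ^ 2) * E :=
          setLIntegral_mono' hP fun w hw =>
            lintegral_slide_sub_sq_le γ e he1 ht hg (mem_ball_zero_iff.1 hw).le
      _ = _ := by rw [setLIntegral_const, hκP, mul_comm]
  have hfin : ENNReal.ofReal (κ / 4) * (volume {z | g z = M} * ENNReal.ofReal (M ^ 2)) ≤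
      ENNReal.ofReal (κ / 4) * (ENNReal.ofReal (160 * t ^ 2) * E) := by
    refine (le_of_eq ?_).trans (hint.trans (le_of_eq ?_))
    · rw [show κ * M ^ 2 / 4 = κ / 4 * M ^ 2 by ring, ENNReal.ofReal_mul (by positivity)]
      ring
    · rw [← mul_assoc, ← mul_assoc, ← ENNReal.ofReal_mul (by positivity),
        ← ENNReal.ofReal_mul (by positivity)]
      congr 2; ring
  refine ((ENNReal.mul_le_mul_iff_right (by simpa using hκ0) ENNReal.ofReal_ne_top).1
    hfin).trans (le_of_eq ?_)
  rw [ht2, ← mul_assoc, ENNReal.ofReal_mul (by positivity), hvV,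
    ENNReal.ofReal_rpow_of_pos hv0]
  rfl

/-- A smooth cutoff that vanishes on `[-1, 1]` and is `1` off `(-2, 2)`. -/
def cutoff (s : ℝ) : ℝ := Real.smoothTransition ((s ^ 2 - 1) / 3)

theorem contDiff_cutoff : ContDiff ℝ 1 cutoff :=
  Real.smoothTransition.contDiff.comp (by fun_prop)

theorem cutoff_nonneg (s : ℝ) : 0 ≤ cutoff s := Real.smoothTransition.nonneg _

theorem cutoff_le_one (s : ℝ) : cutoff s ≤ 1 := Real.smoothTransition.le_one _

theorem cutoff_eq_zero {s : ℝ} (hs : |s| ≤ 1) : cutoff s = 0 :=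
  Real.smoothTransition.zero_of_nonpos (by
    have := (sq_le_one_iff_abs_le_one s).2 hs
    linarith)

theorem cutoff_eq_one {s : ℝ} (hs : 2 ≤ |s|) : cutoff s = 1 :=
  Real.smoothTransition.one_of_one_le (by
    have : 2 ^ 2 ≤ |s| ^ 2 := by gcongr
    rw [sq_abs] at this
    linarith)

/-- Such points are global minima or maxima of the cutoff, which also covers the boundary values |s|
= 1 and |s| = 2. -/
theorem deriv_cutoff_eq_zero {s : ℝ} (hs : |s| ≤ 1 ∨ 2 ≤ |s|) : deriv cutoff s = 0 := by
  rcases hs with hs | hs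
  · exact IsLocalMin.deriv_eq_zero (Eventually.of_forall fun x => by
      rw [cutoff_eq_zero hs]; exact cutoff_nonneg x)
  · exact IsLocalMax.deriv_eq_zero (Eventually.of_forall fun x => by
      rw [cutoff_eq_one hs]; exact cutoff_le_one x)

theorem exists_deriv_cutoff_bound : ∃ A : ℝ≥0, ∀ s, |deriv cutoff s| ≤ A := by
  have hc : HasCompactSupport (deriv cutoff) := by
    refine HasCompactSupport.intro (isCompact_Icc (a := (-2 : ℝ)) (b := 2)) fun s hs => ?_
    refine deriv_cutoff_eq_zero (Or.inr ?_)
    by_contra! h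
    exact hs ⟨(abs_lt.1 h).1.le, (abs_lt.1 h).2.le⟩
  obtain ⟨A, hA⟩ := hc.exists_bound_of_continuous
    (contDiff_cutoff.continuous_deriv (by simp))
  exact ⟨A.toNNReal, fun s => (hA s).trans (Real.le_coe_toNNReal A)⟩

theorem grad_comp {f : ℝ → ℝ} (hf : Differentiable ℝ f) {u : Space m n → ℝ}
    (hu : Differentiable ℝ u) (z : Space m n) :
    grad γ (fun z => f (u z)) z = deriv f (u z) • grad γ u z := by
  have h : fderiv ℝ (fun z => f (u z)) z = deriv f (u z) • fderiv ℝ u z :=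
    ((hf (u z)).hasDerivAt.comp_hasFDerivAt z (hu z).hasFDerivAt).fderiv
  rw [grad_eq (u := fun z => f (u z)) (hf.comp hu), grad_eq hu]
  beta_reduce
  rw [h]
  simp [← WithLp.toLp_smul, ContinuousLinearMap.smul_comp, smul_comm (deriv f (u z))]

theorem two_lt_sobExp (hQ : 2 < homDim m n γ) : 2 < sobExp m n γ := by
  rw [sobExp, lt_div_iff₀ (by linarith)]
  linarith

/-- In the chain rule the outer factor b cancels the inner b⁻¹, so the constant does not depend on
the level, and the gradient of the truncation lives on one layer of |u|. -/
theorem lintegral_grad_truncation_le {A : ℝ≥0} (hA : ∀ s, |deriv cutoff s| ≤ A)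
    {u : Space m n → ℝ} (hu : ContDiff ℝ 1 u) {b : ℝ} (hb : 0 < b) :
    ∫⁻ z, ‖grad γ (fun z => b * cutoff (b⁻¹ * u z)) z‖ₑ ^ 2 ≤
      (A : ℝ≥0∞) ^ 2 * ∫⁻ z in {z | b < |u z| ∧ |u z| < 2 * b}, ‖grad γ u z‖ₑ ^ 2 := by
  have hm : Measurable u := hu.continuous.measurable
  have hS : MeasurableSet {z | b < |u z| ∧ |u z| < 2 * b} := by
    rw [Set.ofPred_and]
    exact (measurableSet_lt measurable_const hm.abs).inter
      (measurableSet_lt hm.abs measurable_const)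
  have hcd : Differentiable ℝ cutoff := contDiff_cutoff.differentiable (by simp)
  have hd : ∀ s, HasDerivAt (fun s => b * cutoff (b⁻¹ * s)) (deriv cutoff (b⁻¹ * s)) s := by
    intro s
    have h1 : HasDerivAt (fun s => b⁻¹ * s) b⁻¹ s := by
      simpa using (hasDerivAt_id s).const_mul b⁻¹
    have h2 := ((hcd (b⁻¹ * s)).hasDerivAt.comp s h1).const_mul b
    rwa [show b * (deriv cutoff (b⁻¹ * s) * b⁻¹) = deriv cutoff (b⁻¹ * s) by field_simp] at h2
  rw [← lintegral_indicator hS, ← lintegral_const_mul _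
    (((continuous_grad hu).enorm.measurable.pow_const 2).indicator hS)]
  refine lintegral_mono fun z => ?_
  have h := grad_comp (γ := γ) (f := fun s => b * cutoff (b⁻¹ * s))
    (fun s => (hd s).differentiableAt) (hu.differentiable (by simp)) z
  simp only at h ⊢
  rw [h, (hd (u z)).deriv, enorm_smul, mul_pow]
  by_cases hz : z ∈ {z | b < |u z| ∧ |u z| < 2 * b}
  · rw [Set.indicator_of_mem hz]
    gcongr
    rw [← ofReal_norm, Real.norm_eq_abs]
    exact ENNReal.ofReal_le_of_le_toReal (hA _)
  · have h0 : deriv cutoff (b⁻¹ * u z) = 0 := by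
      refine deriv_cutoff_eq_zero ?_
      rw [abs_mul, abs_inv, abs_of_pos hb, inv_mul_le_iff₀ hb, le_inv_mul_iff₀ hb]
      by_contra! h3
      exact hz ⟨by linarith [h3.1], by linarith [h3.2]⟩
    simp [h0]

theorem tsum_setLIntegral_dyadic_le {u : Space m n → ℝ} (hu : Measurable u)
    (f : Space m n → ℝ≥0∞) :
    ∑' k : ℤ, ∫⁻ z in {z | (2 : ℝ) ^ k < |u z| ∧ |u z| < 2 * 2 ^ k}, f z ≤ ∫⁻ z, f z := by
  rw [← lintegral_iUnion]
  · exact setLIntegral_le_lintegral _ _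
  · intro k
    rw [Set.ofPred_and]
    exact (measurableSet_lt measurable_const hu.abs).inter
      (measurableSet_lt hu.abs measurable_const)
  · have key : ∀ i j : ℤ, i < j →
        Disjoint {z | (2 : ℝ) ^ i < |u z| ∧ |u z| < 2 * 2 ^ i}
          {z | (2 : ℝ) ^ j < |u z| ∧ |u z| < 2 * 2 ^ j} := by
      intro i j hij
      rw [Set.disjoint_left]
      rintro z ⟨-, h1⟩ ⟨h2, -⟩
      have h3 : (2 : ℝ) ^ (i + 1) ≤ 2 ^ j := zpow_le_zpow_right₀ (by norm_num) (by lia)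
      rw [zpow_add_one₀ (by norm_num)] at h3
      linarith
    intro i j hij
    rcases lt_or_gt_of_ne hij with h | h
    · exact key i j h
    · exact (key j i h).symm

/-- The Sobolev inequality for the Grushin gradient. -/
theorem sobolev (hm : 0 < m ∨ γ = 0) (hQ : 2 < homDim m n γ) :
    ∃ C : ℝ≥0, ∀ u : Space m n → ℝ, ContDiff ℝ 1 u → HasCompactSupport u →
      (∫⁻ z, ‖u z‖ₑ ^ sobExp m n γ) ^ (2 / sobExp m n γ) ≤ C * ∫⁻ z, ‖grad γ u z‖ₑ ^ 2 := by
  obtain ⟨C₁, hC₁⟩ := volume_plateau_le (n := n) hm (by linarith : 0 < homDim m n γ)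
  obtain ⟨A, hA⟩ := exists_deriv_cutoff_bound
  have hq2 := two_lt_sobExp hQ
  set Q := homDim m n γ with hQdef
  set q := sobExp m n γ with hq
  have hQ2 : Q - 2 ≠ 0 := by linarith
  have hQ0 : Q ≠ 0 := by linarith
  have e1 : 2 / q = 1 - 2 / Q := by
    rw [hq, sobExp, ← hQdef]
    field_simp
  -- This relation singles out the Sobolev exponent: the powers of the level β that come from the
  -- plateau inequality and from Chebyshev then combine to exactly β^q.
  have e2 : 2 + q * (2 / Q) = q := by
    rw [hq, sobExp, ← hQdef]
    field_simp
    ring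
  refine ⟨Real.toNNReal (4 ^ q) * C₁ * A ^ 2, fun u hu hcs => ?_⟩
  have hmu : Measurable u := hu.continuous.measurable
  set I := ∫⁻ z, ‖u z‖ₑ ^ q with hI
  set E := ∫⁻ z, ‖grad γ u z‖ₑ ^ 2
  have hItop : I ≠ ∞ := by
    have h1 : MemLp u (ENNReal.ofReal q) volume :=
      hu.continuous.memLp_of_hasCompactSupport hcs
    have h2 := lintegral_rpow_enorm_lt_top_of_eLpNorm_lt_top
      (by simpa using by linarith) ENNReal.ofReal_ne_top h1.2
    rw [ENNReal.toReal_ofReal (by linarith)] at h2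
    exact h2.ne
  rcases eq_or_ne I 0 with hI0 | hI0
  · rw [hI0, ENNReal.zero_rpow_of_pos (by positivity)]
    exact zero_le
  -- The truncation of u at height 2^k has its plateau on {|u| ≥ 2·2^k}, and Chebyshev bounds the
  -- volume of its support by β^(-q) I. The gradient terms for different k live on disjoint layers,
  -- so they can be summed.
  have hstep : ∀ k : ℤ, volume {z | 2 * (2 : ℝ) ^ k ≤ |u z|} * ENNReal.ofReal (2 ^ k) ^ q ≤
      C₁ * A ^ 2 * I ^ (2 / Q) *
        ∫⁻ z in {z | (2 : ℝ) ^ k < |u z| ∧ |u z| < 2 * 2 ^ k}, ‖grad γ u z‖ₑ ^ 2 := by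
    intro k
    have hb : (0 : ℝ) < 2 ^ k := by positivity
    set b : ℝ := 2 ^ k
    set β : ℝ≥0∞ := ENNReal.ofReal b with hβ
    have hβ0 : β ≠ 0 := by simpa [hβ] using hb
    have hβt : β ≠ ∞ := ENNReal.ofReal_ne_top
    set g : Space m n → ℝ := fun z => b * cutoff (b⁻¹ * u z) with hg
    have hsub : {z | g z ≠ 0} ⊆ {z | β ^ q ≤ ‖u z‖ₑ ^ q} := by
      intro z hz
      have h1 : b ≤ |u z| := by
        by_contra! h
        refine hz ?_
        rw [hg]
        simp only
        rw [cutoff_eq_zero, mul_zero]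
        rw [abs_mul, abs_inv, abs_of_pos hb, inv_mul_le_iff₀ hb]
        linarith
      refine ENNReal.rpow_le_rpow ?_ (by linarith)
      rw [← ofReal_norm]
      exact ENNReal.ofReal_le_ofReal h1
    have hcheb : β ^ q * volume {z | g z ≠ 0} ≤ I :=
      (mul_le_mul_right (measure_mono hsub) _).trans
        (mul_meas_ge_le_lintegral (hmu.enorm.pow_const q) _)
    have hβq0 : β ^ q ≠ 0 := by simp [hβ0, hβt]
    have hβqt : β ^ q ≠ ∞ := by simp [hβ0, hβt]
    have hcheb' : volume {z | g z ≠ 0} ≤ (β ^ q)⁻¹ * I := by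
      rw [← ENNReal.mul_le_iff_le_inv hβq0 hβqt]
      exact hcheb
    have hgC : ContDiff ℝ 1 g :=
      contDiff_const.mul (contDiff_cutoff.comp (contDiff_const.mul hu))
    have hgb : ∀ z, |g z| ≤ b := by
      intro z
      rw [hg]
      simp only
      rw [abs_of_nonneg (mul_nonneg hb.le (cutoff_nonneg _))]
      exact mul_le_of_le_one_right hb.le (cutoff_le_one _)
    have hfin : volume {z | g z ≠ 0} ≠ ∞ :=
      (hcheb'.trans_lt
        (ENNReal.mul_lt_top (ENNReal.inv_lt_top.2 hβq0.bot_lt) hItop.lt_top)).ne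
    have hpl := hC₁ g hgC b hb hgb hfin
    have hW : volume {z | 2 * b ≤ |u z|} ≤ volume {z | g z = b} := by
      refine measure_mono fun z (hz : 2 * b ≤ |u z|) => ?_
      change b * cutoff (b⁻¹ * u z) = b
      rw [cutoff_eq_one, mul_one]
      rw [abs_mul, abs_inv, abs_of_pos hb, le_inv_mul_iff₀ hb]
      linarith
    have hb2 : ENNReal.ofReal (b ^ 2) = β ^ (2 : ℝ) := by
      rw [ENNReal.ofReal_pow hb.le]
      exact (ENNReal.rpow_ofNat _ _).symm
    have hsplit : β ^ q = β ^ (2 : ℝ) * (β ^ q) ^ (2 / Q) := by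
      rw [← ENNReal.rpow_mul, ← ENNReal.rpow_add _ _ hβ0 hβt, e2]
    calc volume {z | 2 * b ≤ |u z|} * β ^ q
        = (volume {z | 2 * b ≤ |u z|} * β ^ (2 : ℝ)) * (β ^ q) ^ (2 / Q) := by
          conv_lhs => rw [hsplit]
          ring
      _ ≤ (volume {z | g z = b} * β ^ (2 : ℝ)) * (β ^ q) ^ (2 / Q) := by gcongr
      _ ≤ (C₁ * ((β ^ q)⁻¹ * I) ^ (2 / Q) * ∫⁻ z, ‖grad γ g z‖ₑ ^ 2) * (β ^ q) ^ (2 / Q) := by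
          rw [← hb2]
          refine mul_le_mul_left (hpl.trans ?_) _
          gcongr
      _ = C₁ * I ^ (2 / Q) * ∫⁻ z, ‖grad γ g z‖ₑ ^ 2 := by
          rw [ENNReal.mul_rpow_of_nonneg _ _ (by positivity), ENNReal.inv_rpow]
          have h1 : (β ^ q) ^ (2 / Q) ≠ 0 := by simp [hβq0, hβqt]
          have h2 : (β ^ q) ^ (2 / Q) ≠ ∞ := by simp [hβq0, hβqt]
          calc _ = C₁ * I ^ (2 / Q) * (∫⁻ z, ‖grad γ g z‖ₑ ^ 2) *
                (((β ^ q) ^ (2 / Q))⁻¹ * (β ^ q) ^ (2 / Q)) := by ring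
            _ = _ := by rw [ENNReal.inv_mul_cancel h1 h2, mul_one]
      _ ≤ C₁ * I ^ (2 / Q) * ((A : ℝ≥0∞) ^ 2 *
            ∫⁻ z in {z | b < |u z| ∧ |u z| < 2 * b}, ‖grad γ u z‖ₑ ^ 2) := by
          gcongr
          exact lintegral_grad_truncation_le hA hu hb
      _ = _ := by ring
  have hsum : I ≤ ∑' k : ℤ, ENNReal.ofReal (4 ^ q) *
      (volume {z | 2 * (2 : ℝ) ^ k ≤ |u z|} * ENNReal.ofReal (2 ^ k) ^ q) := by
    have hmS : ∀ k : ℤ, MeasurableSet {z | 2 * (2 : ℝ) ^ k ≤ |u z|} := fun k =>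
      measurableSet_le measurable_const hmu.abs
    have hpt : ∀ z, ‖u z‖ₑ ^ q ≤ ∑' k : ℤ, {z | 2 * (2 : ℝ) ^ k ≤ |u z|}.indicator
        (fun _ => ENNReal.ofReal (4 ^ q) * ENNReal.ofReal (2 ^ k) ^ q) z := by
      intro z
      rcases eq_or_ne (u z) 0 with h0 | h0
      · rw [h0, enorm_zero, ENNReal.zero_rpow_of_pos (by linarith)]
        exact zero_le
      obtain ⟨k, hk1, hk2⟩ := exists_mem_Ico_zpow (abs_pos.2 h0) (one_lt_two (α := ℝ))
      -- The index is lowered by one because the level sets start at 2·2^k: here 2·2^(k-1) ≤ |u z| <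
      -- 4·2^(k-1), which is where 4^q comes from.
      refine le_trans ?_ (ENNReal.le_tsum (k - 1))
      have h2 : (2 : ℝ) ^ k = 2 * 2 ^ (k - 1) := by
        rw [← zpow_one_add₀ (by norm_num)]
        congr 1
        ring
      rw [zpow_add_one₀ (by norm_num), h2] at hk2
      rw [h2] at hk1
      rw [Set.indicator_of_mem (by exact hk1), ← ENNReal.ofReal_rpow_of_pos (by norm_num),
        ← ENNReal.mul_rpow_of_nonneg _ _ (by linarith), ← ENNReal.ofReal_mul (by norm_num)]
      refine ENNReal.rpow_le_rpow ?_ (by linarith)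
      rw [← ofReal_norm, Real.norm_eq_abs]
      exact ENNReal.ofReal_le_ofReal (by linarith)
    calc I ≤ ∫⁻ z, ∑' k : ℤ, {z | 2 * (2 : ℝ) ^ k ≤ |u z|}.indicator
          (fun _ => ENNReal.ofReal (4 ^ q) * ENNReal.ofReal (2 ^ k) ^ q) z := lintegral_mono hpt
      _ = _ := by
        rw [lintegral_tsum fun k => (measurable_const.indicator (hmS k)).aemeasurable]
        congr 1
        funext k
        rw [lintegral_indicator (hmS k), setLIntegral_const]
        ring
  have hmain : I ≤ (Real.toNNReal (4 ^ q) * C₁ * A ^ 2 : ℝ≥0) * E * I ^ (2 / Q) := by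
    calc I ≤ _ := hsum
      _ ≤ ∑' k : ℤ, ENNReal.ofReal (4 ^ q) * (C₁ * A ^ 2 * I ^ (2 / Q) *
        ∫⁻ z in {z | (2 : ℝ) ^ k < |u z| ∧ |u z| < 2 * 2 ^ k}, ‖grad γ u z‖ₑ ^ 2) :=
          ENNReal.tsum_le_tsum fun k => mul_le_mul_right (hstep k) _
      _ ≤ ENNReal.ofReal (4 ^ q) * (C₁ * A ^ 2 * I ^ (2 / Q) * E) := by
          rw [ENNReal.tsum_mul_left, ENNReal.tsum_mul_left]
          gcongr
          exact tsum_setLIntegral_dyadic_le hmu _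
      _ = _ := by
          rw [ENNReal.ofReal]
          push_cast
          ring
  -- I is finite and nonzero, so I^(2/Q) can be divided out of I ≤ C E I^(2/Q); what remains is I^(1
  -- - 2/Q) = I^(2/q).
  have h0 : I ^ (2 / Q) ≠ 0 := by simp [hI0, hItop]
  have ht : I ^ (2 / Q) ≠ ∞ := by simp [hI0, hItop]
  refine (ENNReal.mul_le_mul_iff_left h0 ht).1 (le_trans (le_of_eq ?_) hmain)
  rw [e1, ← ENNReal.rpow_add _ _ hI0 hItop, sub_add_cancel, ENNReal.rpow_one]

end Sobolev

/-! ### The Hardy–Littlewood–Sobolev inequality on the diagonal. -/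

section HardyLittlewoodSobolev

variable {m n : ℕ} {γ : ℝ≥0} {μ : ℝ}

theorem homNorm_nonneg (z : Space m n) : 0 ≤ homNorm γ z := by
  rw [homNorm]
  positivity

theorem homNorm_neg (z : Space m n) : homNorm γ (-z) = homNorm γ z := by
  simp [homNorm]

theorem continuous_homNorm : Continuous (homNorm (m := m) (n := n) γ) := by
  have h1 : Continuous fun z : Space m n => ‖z.1‖ ^ (2 * ((γ : ℝ) + 1)) :=
    continuous_fst.norm.rpow_const fun _ => Or.inr (by positivity)
  have h2 : Continuous fun z : Space m n => ‖z.2‖ ^ (2 : ℝ) :=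
    continuous_snd.norm.rpow_const fun _ => Or.inr (by positivity)
  exact (h1.add h2).rpow_const fun _ => Or.inr (by positivity)

theorem homNorm_rpow (z : Space m n) :
    homNorm γ z ^ (2 * ((γ : ℝ) + 1)) = ‖z.1‖ ^ (2 * ((γ : ℝ) + 1)) + ‖z.2‖ ^ (2 : ℝ) := by
  have h : 0 < 2 * ((γ : ℝ) + 1) := by positivity
  rw [homNorm, ← Real.rpow_mul (by positivity), one_div_mul_cancel h.ne', Real.rpow_one]

theorem norm_fst_le_homNorm (z : Space m n) : ‖z.1‖ ≤ homNorm γ z := by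
  have h : 0 < 2 * ((γ : ℝ) + 1) := by positivity
  refine (Real.rpow_le_rpow_iff (norm_nonneg _) (homNorm_nonneg z) h).1 ?_
  rw [homNorm_rpow]
  exact le_add_of_nonneg_right (by positivity)

theorem norm_snd_le_homNorm (z : Space m n) : ‖z.2‖ ≤ homNorm γ z ^ (1 + (γ : ℝ)) := by
  have h := homNorm_nonneg (γ := γ) z
  refine (Real.rpow_le_rpow_iff (norm_nonneg _) (by positivity) (by norm_num : (0 : ℝ) < 2)).1 ?_
  rw [← Real.rpow_mul h, show (1 + (γ : ℝ)) * 2 = 2 * ((γ : ℝ) + 1) by ring, homNorm_rpow]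
  exact le_add_of_nonneg_left (by positivity)

theorem homNorm_eq_zero {z : Space m n} (hz : homNorm γ z = 0) : z = 0 := by
  have h1 := norm_fst_le_homNorm (γ := γ) z
  have h2 := norm_snd_le_homNorm (γ := γ) z
  rw [hz] at h1 h2
  rw [Real.zero_rpow (by positivity)] at h2
  exact Prod.ext (norm_le_zero_iff.1 h1) (norm_le_zero_iff.1 h2)

theorem volume_homNorm_le : ∃ C : ℝ, 0 ≤ C ∧ ∀ R : ℝ, 0 < R →
    volume {z : Space m n | homNorm γ z ≤ R} ≤ ENNReal.ofReal (C * R ^ homDim m n γ) := by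
  set c₁ := volume (Metric.closedBall (0 : EuclideanSpace ℝ (Fin m)) 1)
  set c₂ := volume (Metric.closedBall (0 : EuclideanSpace ℝ (Fin n)) 1)
  have h₁ : c₁ ≠ ∞ := (isCompact_closedBall _ _).measure_lt_top.ne
  have h₂ : c₂ ≠ ∞ := (isCompact_closedBall _ _).measure_lt_top.ne
  refine ⟨(c₁ * c₂).toReal, ENNReal.toReal_nonneg, fun R hR => ?_⟩
  have hsub : {z : Space m n | homNorm γ z ≤ R} ⊆
      Metric.closedBall 0 R ×ˢ Metric.closedBall 0 (R ^ (1 + (γ : ℝ))) := by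
    intro z (hz : homNorm γ z ≤ R)
    refine ⟨mem_closedBall_zero_iff.2 ((norm_fst_le_homNorm z).trans hz),
      mem_closedBall_zero_iff.2 ((norm_snd_le_homNorm (γ := γ) z).trans ?_)⟩
    exact Real.rpow_le_rpow (homNorm_nonneg z) hz (by positivity)
  refine (measure_mono hsub).trans (le_of_eq ?_)
  rw [Measure.volume_eq_prod, Measure.prod_prod, Measure.addHaar_closedBall' _ _ hR.le,
    Measure.addHaar_closedBall' volume (0 : EuclideanSpace ℝ (Fin n))
      (by positivity : 0 ≤ R ^ (1 + (γ : ℝ))), ENNReal.ofReal_mul ENNReal.toReal_nonneg,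
    ENNReal.ofReal_toReal (ENNReal.mul_ne_top h₁ h₂), finrank_euclideanSpace_fin,
    finrank_euclideanSpace_fin, homDim, Real.rpow_add hR (m : ℝ), Real.rpow_natCast, Real.rpow_mul hR.le,
    Real.rpow_natCast, ENNReal.ofReal_mul (by positivity)]
  ring

/-- The kernel `d(z)^{-μ}`. -/
def kern (γ : ℝ≥0) (μ : ℝ) (z : Space m n) : ℝ := (homNorm γ z ^ μ)⁻¹

theorem kern_nonneg (z : Space m n) : 0 ≤ kern γ μ z :=
  inv_nonneg.2 (Real.rpow_nonneg (homNorm_nonneg z) _)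

theorem kern_neg (z : Space m n) : kern γ μ (-z) = kern γ μ z := by
  rw [kern, kern, homNorm_neg]

theorem measurable_kern : Measurable (kern (m := m) (n := n) γ μ) :=
  (continuous_homNorm.measurable.pow_const μ).inv

theorem tsum_ofReal_geometric_le {s A : ℝ} (hs : 0 < s) (hA : 0 ≤ A) :
    ∑' j : ℕ, ENNReal.ofReal (A * ((2 : ℝ) ^ (-s)) ^ j) =
      ENNReal.ofReal (A * (1 - (2 : ℝ) ^ (-s))⁻¹) := by
  have h1 : (2 : ℝ) ^ (-s) < 1 := Real.rpow_lt_one_of_one_lt_of_neg (by norm_num) (by linarith)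
  have h0 : (0 : ℝ) ≤ 2 ^ (-s) := by positivity
  rw [← ENNReal.ofReal_tsum_of_nonneg (fun j => by positivity)
    ((summable_geometric_of_lt_one h0 h1).mul_left A), tsum_mul_left, tsum_geometric_of_lt_one h0 h1]

theorem rpow_neg_le_of_le {a b s : ℝ} (ha : 0 < a) (hab : a ≤ b) (hs : 0 ≤ s) :
    (b ^ s)⁻¹ ≤ (a ^ s)⁻¹ :=
  inv_anti₀ (by positivity) (Real.rpow_le_rpow ha.le hab hs)

/-- On the dyadic shell d ~ 2^(-j)R the kernel is about (2^(-j)R)^(-μ) and the volume at most a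
constant times (2^(-j)R)^Q; the resulting series is geometric with ratio 2^(-(Q-μ)) < 1. -/
theorem lintegral_kern_near_le (hμ0 : 0 < μ) (hμ : μ < homDim m n γ) :
    ∃ C : ℝ, 0 ≤ C ∧ ∀ R : ℝ, 0 < R →
      ∫⁻ z : Space m n in {z | homNorm γ z < R}, ENNReal.ofReal (kern γ μ z) ≤
        ENNReal.ofReal (C * R ^ (homDim m n γ - μ)) := by
  obtain ⟨C, hC, hvol⟩ := volume_homNorm_le (m := m) (n := n) (γ := γ)
  set Q := homDim m n γ
  have h21 : (2 : ℝ) ^ (-(Q - μ)) < 1 :=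
    Real.rpow_lt_one_of_one_lt_of_neg (by norm_num) (by linarith)
  refine ⟨2 ^ μ * C * (1 - (2 : ℝ) ^ (-(Q - μ)))⁻¹, by
    have := inv_nonneg.2 (sub_nonneg.2 h21.le)
    positivity, fun R hR => ?_⟩
  have hmS : ∀ ρ : ℝ, MeasurableSet {z : Space m n | homNorm γ z ≤ ρ} := fun ρ =>
    measurableSet_le continuous_homNorm.measurable measurable_const
  have hmR : MeasurableSet {z : Space m n | homNorm γ z < R} :=
    measurableSet_lt continuous_homNorm.measurable measurable_const
  set F : ℕ → Space m n → ℝ≥0∞ := fun j =>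
    {z : Space m n | homNorm γ z ≤ R * (1 / 2) ^ j}.indicator
      fun _ => ENNReal.ofReal (((R * (1 / 2) ^ (j + 1)) ^ μ)⁻¹) with hF
  have hpt : ∀ z ∈ {z : Space m n | homNorm γ z < R},
      ENNReal.ofReal (kern γ μ z) ≤ ∑' j, F j z := by
    intro z (hz : homNorm γ z < R)
    rcases (homNorm_nonneg (γ := γ) z).eq_or_lt with h0 | h0
    -- At the origin the kernel takes the default value 0, so the singular point needs no shell.
    · rw [kern, ← h0, Real.zero_rpow hμ0.ne']
      simp
    obtain ⟨j, hj1, hj2⟩ := exists_nat_pow_near_of_lt_one (x := homNorm γ z / R) (y := 1 / 2)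
      (by positivity) ((div_le_one hR).2 hz.le) (by norm_num) (by norm_num)
    rw [lt_div_iff₀ hR] at hj1
    rw [div_le_iff₀ hR] at hj2
    refine le_trans ?_ (ENNReal.le_tsum j)
    rw [hF]
    simp only
    rw [Set.indicator_of_mem (Set.mem_ofPred_eq.mpr (by linarith) : z ∈ {z | homNorm γ z ≤ R * (1 / 2) ^ j})]
    exact ENNReal.ofReal_le_ofReal (rpow_neg_le_of_le (by positivity) (by linarith) hμ0.le)
  calc ∫⁻ z in {z | homNorm γ z < R}, ENNReal.ofReal (kern γ μ z)
      ≤ ∫⁻ z in {z | homNorm γ z < R}, ∑' j, F j z := setLIntegral_mono' hmR hpt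
    _ ≤ ∫⁻ z, ∑' j, F j z := setLIntegral_le_lintegral _ _
    _ = ∑' j, ENNReal.ofReal (((R * (1 / 2) ^ (j + 1)) ^ μ)⁻¹) *
          volume {z : Space m n | homNorm γ z ≤ R * (1 / 2) ^ j} := by
        rw [lintegral_tsum fun j => (measurable_const.indicator (hmS _)).aemeasurable]
        congr 1
        funext j
        rw [lintegral_indicator (hmS _), setLIntegral_const]
    _ ≤ ∑' j : ℕ, ENNReal.ofReal ((2 ^ μ * C * R ^ (Q - μ)) * ((2 : ℝ) ^ (-(Q - μ))) ^ j) := by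
        refine ENNReal.tsum_le_tsum fun j => ?_
        refine (mul_le_mul_right (hvol (R * (1 / 2) ^ j) (by positivity)) _).trans (le_of_eq ?_)
        rw [← ENNReal.ofReal_mul (by positivity)]
        congr 1
        have e1 : ((2 : ℝ) ^ (-(Q - μ))) ^ j = (((1 / 2 : ℝ) ^ j) ^ μ)⁻¹ * ((1 / 2 : ℝ) ^ j) ^ Q := by
          rw [← Real.rpow_natCast, ← Real.rpow_natCast, ← Real.rpow_mul (by norm_num),
            ← Real.rpow_mul (by norm_num), ← Real.rpow_mul (by norm_num), one_div,
            Real.inv_rpow (by norm_num), Real.inv_rpow (by norm_num), ← Real.rpow_neg (by norm_num),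
            ← Real.rpow_neg (by norm_num), ← Real.rpow_neg (by norm_num),
            ← Real.rpow_add (by norm_num)]
          congr 1
          ring
        rw [e1, Real.mul_rpow hR.le (by positivity), Real.mul_rpow hR.le (by positivity), pow_succ,
          Real.mul_rpow (by positivity) (by positivity), Real.rpow_sub hR, one_div,
          Real.inv_rpow (by norm_num)]
        have := Real.rpow_pos_of_pos hR μ
        have h2 : (0 : ℝ) < ((2 : ℝ)⁻¹ ^ j) ^ μ := by positivity
        field_simp
    _ = _ := by
        rw [tsum_ofReal_geometric_le (by linarith) (by positivity)]
        congr 1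
        ring

/-- Dyadic shells again, going outward. The exponent 2Q is μ r' for r' = 2Q/μ, the exponent
conjugate to r, so this is the L^(r') norm of the far kernel to the power r'. -/
theorem lintegral_homNorm_far_le (hQ : 0 < homDim m n γ) :
    ∃ C : ℝ, 0 ≤ C ∧ ∀ R : ℝ, 0 < R →
      ∫⁻ z : Space m n in {z | R ≤ homNorm γ z},
        ENNReal.ofReal ((homNorm γ z ^ (2 * homDim m n γ))⁻¹) ≤
        ENNReal.ofReal (C * (R ^ (homDim m n γ))⁻¹) := by
  obtain ⟨C, hC, hvol⟩ := volume_homNorm_le (m := m) (n := n) (γ := γ)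
  set Q := homDim m n γ
  have h21 : (2 : ℝ) ^ (-Q) < 1 :=
    Real.rpow_lt_one_of_one_lt_of_neg (by norm_num) (by linarith)
  refine ⟨2 ^ Q * C * (1 - (2 : ℝ) ^ (-Q))⁻¹, by
    have := inv_nonneg.2 (sub_nonneg.2 h21.le)
    positivity, fun R hR => ?_⟩
  have hmS : ∀ ρ : ℝ, MeasurableSet {z : Space m n | homNorm γ z ≤ ρ} := fun ρ =>
    measurableSet_le continuous_homNorm.measurable measurable_const
  have hmR : MeasurableSet {z : Space m n | R ≤ homNorm γ z} :=
    measurableSet_le measurable_const continuous_homNorm.measurable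
  set F : ℕ → Space m n → ℝ≥0∞ := fun j =>
    {z : Space m n | homNorm γ z ≤ R * 2 ^ (j + 1)}.indicator
      fun _ => ENNReal.ofReal (((R * 2 ^ j) ^ (2 * Q))⁻¹) with hF
  have hpt : ∀ z ∈ {z : Space m n | R ≤ homNorm γ z},
      ENNReal.ofReal ((homNorm γ z ^ (2 * Q))⁻¹) ≤ ∑' j, F j z := by
    intro z (hz : R ≤ homNorm γ z)
    obtain ⟨j, hj1, hj2⟩ := exists_nat_pow_near (x := homNorm γ z / R) (y := 2)
      ((one_le_div hR).2 hz) (by norm_num)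
    rw [le_div_iff₀ hR] at hj1
    rw [div_lt_iff₀ hR] at hj2
    refine le_trans ?_ (ENNReal.le_tsum j)
    rw [hF]
    simp only
    rw [Set.indicator_of_mem (Set.mem_ofPred_eq.mpr (by linarith) : z ∈ {z | homNorm γ z ≤ R * 2 ^ (j + 1)})]
    exact ENNReal.ofReal_le_ofReal (rpow_neg_le_of_le (by positivity) (by linarith) (by linarith))
  calc ∫⁻ z in {z | R ≤ homNorm γ z}, ENNReal.ofReal ((homNorm γ z ^ (2 * Q))⁻¹)
      ≤ ∫⁻ z in {z | R ≤ homNorm γ z}, ∑' j, F j z := setLIntegral_mono' hmR hpt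
    _ ≤ ∫⁻ z, ∑' j, F j z := setLIntegral_le_lintegral _ _
    _ = ∑' j, ENNReal.ofReal (((R * 2 ^ j) ^ (2 * Q))⁻¹) *
          volume {z : Space m n | homNorm γ z ≤ R * 2 ^ (j + 1)} := by
        rw [lintegral_tsum fun j => (measurable_const.indicator (hmS _)).aemeasurable]
        congr 1
        funext j
        rw [lintegral_indicator (hmS _), setLIntegral_const]
    _ ≤ ∑' j : ℕ, ENNReal.ofReal ((2 ^ Q * C * (R ^ Q)⁻¹) * ((2 : ℝ) ^ (-Q)) ^ j) := by
        refine ENNReal.tsum_le_tsum fun j => ?_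
        refine (mul_le_mul_right (hvol (R * 2 ^ (j + 1)) (by positivity)) _).trans (le_of_eq ?_)
        rw [← ENNReal.ofReal_mul (by positivity)]
        congr 1
        have e1 : ((2 : ℝ) ^ (-Q)) ^ j = (((2 : ℝ) ^ j) ^ Q)⁻¹ := by
          rw [← Real.rpow_natCast, ← Real.rpow_natCast, ← Real.rpow_mul (by norm_num),
            ← Real.rpow_mul (by norm_num), ← Real.rpow_neg (by norm_num)]
          congr 1
          ring
        rw [e1, mul_comm 2 Q, Real.rpow_mul (by positivity), Real.rpow_two,
          Real.mul_rpow hR.le (by positivity), Real.mul_rpow hR.le (by positivity), pow_succ 2 j,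
          Real.mul_rpow (by positivity) (by positivity)]
        have := Real.rpow_pos_of_pos hR Q
        have h2 : (0 : ℝ) < ((2 : ℝ) ^ j) ^ Q := by positivity
        field_simp
    _ = _ := by
        rw [tsum_ofReal_geometric_le hQ (by positivity)]
        congr 1
        ring

instance : (volume : Measure (Space m n)).IsNegInvariant :=
  Measure.IsAddHaarMeasure.isNegInvariant_of_regular _

/-- Split the kernel at radius R. Near z the truncation f ≤ a reduces the potential to a times the
integral of the kernel; away from z, Hölder uses the unit L^r bound on f. -/
theorem lintegral_truncated_potential_le (hμ0 : 0 < μ) (hμ : μ < homDim m n γ) :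
    ∃ C : ℝ, 0 ≤ C ∧ ∀ (ν : Measure (Space m n)) (_ : ν ≤ volume) (f : Space m n → ℝ≥0)
      (_ : Measurable f)
      (_ : ∫⁻ w, (f w : ℝ≥0∞) ^ (2 * homDim m n γ / (2 * homDim m n γ - μ)) ∂ν ≤ 1)
      (z : Space m n) (a : ℝ) (_ : 0 < a),
      ∫⁻ w, (if (f w : ℝ) ≤ a then f w * ENNReal.ofReal (kern γ μ (z - w)) else 0) ∂ν ≤
        ENNReal.ofReal (C * a ^ (2 * homDim m n γ / (2 * homDim m n γ - μ) - 1)) := by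
  obtain ⟨C₁, hC₁, hnear⟩ := lintegral_kern_near_le (m := m) (n := n) (γ := γ) hμ0 hμ
  obtain ⟨C₂, hC₂, hfar⟩ := lintegral_homNorm_far_le (m := m) (n := n) (γ := γ)
    (hμ0.trans hμ)
  set Q := homDim m n γ
  have hQ : 0 < Q := hμ0.trans hμ
  set r := 2 * Q / (2 * Q - μ) with hr
  have hden : 0 < 2 * Q - μ := by linarith
  have hr0 : 0 < r := by positivity
  set r' := 2 * Q / μ with hr'
  have hr'0 : 0 < r' := by positivity
  have hconj : r.HolderConjugate r' := by
    refine ⟨?_, hr0, hr'0⟩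
    rw [hr, hr']
    field_simp
    ring
  refine ⟨C₁ + C₂ ^ (1 / r'), by positivity, fun ν hν f hf hfr z a ha => ?_⟩
  -- This radius balances the near part a R^(Q-μ) against the far part R^(-Q/r'): both become
  -- a^(r-1).
  set R : ℝ := a ^ (-(r / Q)) with hR_def
  have hR : 0 < R := by positivity
  have hmK : Measurable fun w => ENNReal.ofReal (kern γ μ (z - w)) :=
    (measurable_kern.comp (measurable_const.sub measurable_id)).ennreal_ofReal
  have hmnear : MeasurableSet {w : Space m n | homNorm γ w < R} :=
    measurableSet_lt continuous_homNorm.measurable measurable_const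
  have hmfar : MeasurableSet {w : Space m n | R ≤ homNorm γ w} :=
    measurableSet_le measurable_const continuous_homNorm.measurable
  set N : Space m n → ℝ≥0∞ :=
    {w : Space m n | homNorm γ w < R}.indicator fun w => ENNReal.ofReal (kern γ μ w) with hN
  set L : Space m n → ℝ≥0∞ :=
    {w : Space m n | R ≤ homNorm γ w}.indicator fun w => ENNReal.ofReal (kern γ μ w) with hL
  have hNm : Measurable N := measurable_kern.ennreal_ofReal.indicator hmnear
  have hLm : Measurable L := measurable_kern.ennreal_ofReal.indicator hmfar
  have hsub : Measurable fun w : Space m n => z - w := measurable_const.sub measurable_id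
  have hpt : ∀ w, (if (f w : ℝ) ≤ a then f w * ENNReal.ofReal (kern γ μ (z - w)) else 0) ≤
      ENNReal.ofReal a * N (z - w) + f w * L (z - w) := by
    intro w
    split_ifs with h
    · rcases lt_or_ge (homNorm γ (z - w)) R with h1 | h1
      · refine le_trans ?_ le_self_add
        rw [hN, Set.indicator_of_mem (by exact h1)]
        gcongr
        rw [← ENNReal.ofReal_coe_nnreal]
        exact ENNReal.ofReal_le_ofReal h
      · refine le_trans (le_of_eq ?_) le_add_self
        rw [hL, Set.indicator_of_mem (by exact h1)]
    · exact zero_le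
  have h1 : ∫⁻ w, ENNReal.ofReal a * N (z - w) ∂ν ≤ ENNReal.ofReal (C₁ * a ^ (r - 1)) := by
    calc ∫⁻ w, ENNReal.ofReal a * N (z - w) ∂ν
        ≤ ∫⁻ w, ENNReal.ofReal a * N (z - w) := lintegral_mono' hν le_rfl
      _ = ENNReal.ofReal a * ∫⁻ w, N w := by
          rw [lintegral_const_mul (f := fun w => N (z - w)) _ (hNm.comp hsub),
            lintegral_sub_left_eq_self N z]
      _ ≤ ENNReal.ofReal a * ENNReal.ofReal (C₁ * R ^ (Q - μ)) := by
          gcongr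
          rw [hN, lintegral_indicator hmnear]
          exact hnear R hR
      _ = _ := by
          rw [← ENNReal.ofReal_mul ha.le, hR_def, ← Real.rpow_mul ha.le, mul_left_comm]
          congr 2
          nth_rw 1 [← Real.rpow_one a]
          rw [← Real.rpow_add ha]
          congr 1
          rw [hr]
          field_simp
          ring
  have h2 : ∫⁻ w, f w * L (z - w) ∂ν ≤ ENNReal.ofReal (C₂ ^ (1 / r') * a ^ (r - 1)) := by
    have hH := ENNReal.lintegral_mul_le_Lp_mul_Lq ν hconj hf.coe_nnreal_ennreal.aemeasurable
      (hLm.comp hsub).aemeasurable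
    refine hH.trans ?_
    have h3 : (∫⁻ w, (f w : ℝ≥0∞) ^ r ∂ν) ^ (1 / r) ≤ 1 := by
      calc _ ≤ (1 : ℝ≥0∞) ^ (1 / r) := ENNReal.rpow_le_rpow hfr (by positivity)
        _ = 1 := ENNReal.one_rpow _
    have h4 : ∫⁻ w, (L ∘ fun w => z - w) w ^ r' ∂ν ≤ ENNReal.ofReal (C₂ * (R ^ Q)⁻¹) := by
      calc ∫⁻ w, (L ∘ fun w => z - w) w ^ r' ∂ν ≤ ∫⁻ w, L (z - w) ^ r' := lintegral_mono' hν le_rfl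
        _ = ∫⁻ w, L w ^ r' := lintegral_sub_left_eq_self (fun w => L w ^ r') z
        _ = ∫⁻ w in {w | R ≤ homNorm γ w}, ENNReal.ofReal ((homNorm γ w ^ (2 * Q))⁻¹) := by
            rw [← lintegral_indicator hmfar]
            congr 1
            funext w
            by_cases hw : w ∈ {w : Space m n | R ≤ homNorm γ w}
            · rw [hL, Set.indicator_of_mem hw, Set.indicator_of_mem hw,
                ENNReal.ofReal_rpow_of_nonneg (kern_nonneg w) hr'0.le, kern,
                Real.inv_rpow (Real.rpow_nonneg (homNorm_nonneg w) _),
                ← Real.rpow_mul (homNorm_nonneg w), hr', mul_div_cancel₀ _ hμ0.ne']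
            · rw [hL, Set.indicator_of_notMem hw, Set.indicator_of_notMem hw,
                ENNReal.zero_rpow_of_pos hr'0]
        _ ≤ _ := hfar R hR
    calc _ ≤ 1 * (ENNReal.ofReal (C₂ * (R ^ Q)⁻¹)) ^ (1 / r') := by gcongr
      _ = _ := by
        rw [one_mul, ENNReal.ofReal_rpow_of_nonneg (by positivity) (by positivity),
          Real.mul_rpow hC₂ (by positivity), hR_def, ← Real.rpow_mul ha.le, ← Real.rpow_neg ha.le,
          ← Real.rpow_mul ha.le]
        congr 3
        rw [hr, hr']
        field_simp
        ring
  calc _ ≤ ∫⁻ w, (ENNReal.ofReal a * N (z - w) + f w * L (z - w)) ∂ν := lintegral_mono hpt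
    _ = (∫⁻ w, ENNReal.ofReal a * N (z - w) ∂ν) + ∫⁻ w, f w * L (z - w) ∂ν :=
        lintegral_add_left ((hNm.comp hsub).const_mul _) _
    _ ≤ _ := by
        rw [add_mul, ENNReal.ofReal_add (by positivity) (by positivity)]
        exact add_le_add h1 h2

/-- By symmetry of the kernel it suffices to integrate over f(w) ≤ f(z). There the potential
truncated at a = f(z) is at most C f(z)^(r-1), and the outer factor f(z) completes it to f(z)^r.
Neither interpolation nor a maximal function is needed. -/
theorem lintegral_kern_diagonal_le (hμ0 : 0 < μ) (hμ : μ < homDim m n γ) :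
    ∃ C : ℝ≥0, ∀ (ν : Measure (Space m n)) [SFinite ν] (_ : ν ≤ volume) (f : Space m n → ℝ≥0)
      (_ : Measurable f)
      (_ : ∫⁻ w, (f w : ℝ≥0∞) ^ (2 * homDim m n γ / (2 * homDim m n γ - μ)) ∂ν ≤ 1),
      ∫⁻ z, ∫⁻ w, f z * (f w * ENNReal.ofReal (kern γ μ (z - w))) ∂ν ∂ν ≤ C := by
  obtain ⟨C, hC, h⟩ := lintegral_truncated_potential_le (m := m) (n := n) (γ := γ) hμ0 hμ
  set Q := homDim m n γ
  set r := 2 * Q / (2 * Q - μ) with hr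
  have hden : 0 < 2 * Q - μ := by linarith
  have hr0 : 0 < r := by
    have : 0 < Q := by linarith
    positivity
  refine ⟨2 * C.toNNReal, fun ν _ hν f hf hfr => ?_⟩
  set G : Space m n → Space m n → ℝ≥0∞ := fun z w => f z *
    (if (f w : ℝ) ≤ f z then f w * ENNReal.ofReal (kern γ μ (z - w)) else 0) with hG
  have hmk : Measurable fun a : Space m n × Space m n => ENNReal.ofReal (kern γ μ (a.1 - a.2)) :=
    (measurable_kern.comp (measurable_fst.sub measurable_snd)).ennreal_ofReal
  have hf1 : Measurable fun a : Space m n × Space m n => f a.1 := hf.comp measurable_fst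
  have hf2 : Measurable fun a : Space m n × Space m n => f a.2 := hf.comp measurable_snd
  have hmG : Measurable (Function.uncurry G) := by
    refine hf1.coe_nnreal_ennreal.mul (Measurable.ite ?_ (hf2.coe_nnreal_ennreal.mul hmk)
      measurable_const)
    exact measurableSet_le hf2.coe_nnreal_real hf1.coe_nnreal_real
  have hpt : ∀ z w, f z * (f w * ENNReal.ofReal (kern γ μ (z - w))) ≤ G z w + G w z := by
    intro z w
    rcases le_total (f w : ℝ) (f z) with h1 | h1
    · refine le_trans (le_of_eq ?_) le_self_add
      rw [hG]
      simp only
      rw [if_pos h1]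
    · refine le_trans (le_of_eq ?_) le_add_self
      rw [hG]
      simp only
      rw [if_pos h1, ← neg_sub z w, kern_neg]
      ring
  have hGint : ∫⁻ z, ∫⁻ w, G z w ∂ν ∂ν ≤ ENNReal.ofReal C := by
    calc ∫⁻ z, ∫⁻ w, G z w ∂ν ∂ν ≤ ∫⁻ z, ENNReal.ofReal C * (f z : ℝ≥0∞) ^ r ∂ν := by
          refine lintegral_mono fun z => ?_
          rcases eq_or_ne (f z) 0 with h0 | h0
          · simp [hG, h0]
          have h0' : (0 : ℝ) < f z := NNReal.coe_pos.2 (pos_iff_ne_zero.2 h0)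
          rw [hG]
          simp only
          rw [lintegral_const_mul _]
          · refine (mul_le_mul_right (h ν hν f hf hfr z (f z) h0') _).trans (le_of_eq ?_)
            rw [← ENNReal.ofReal_coe_nnreal, ENNReal.ofReal_rpow_of_pos (p := r) h0',
              ← ENNReal.ofReal_mul hC, ← ENNReal.ofReal_mul h0'.le, mul_left_comm]
            congr 2
            nth_rw 1 [← Real.rpow_one (f z : ℝ)]
            rw [← Real.rpow_add h0']
            congr 1
            ring
          · refine Measurable.ite (measurableSet_le hf.coe_nnreal_real measurable_const)
              (hf.coe_nnreal_ennreal.mul ?_) measurable_const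
            exact (measurable_kern.comp (measurable_const.sub measurable_id)).ennreal_ofReal
      _ = ENNReal.ofReal C * ∫⁻ z, (f z : ℝ≥0∞) ^ r ∂ν :=
          lintegral_const_mul _ (hf.coe_nnreal_ennreal.pow_const r)
      _ ≤ ENNReal.ofReal C * 1 := by gcongr
      _ = _ := mul_one _
  calc ∫⁻ z, ∫⁻ w, f z * (f w * ENNReal.ofReal (kern γ μ (z - w))) ∂ν ∂ν
      ≤ ∫⁻ z, ∫⁻ w, (G z w + G w z) ∂ν ∂ν := lintegral_mono fun z => lintegral_mono fun w => hpt z w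
    _ = ∫⁻ z, ((∫⁻ w, G z w ∂ν) + ∫⁻ w, G w z ∂ν) ∂ν := by
        congr 1
        funext z
        exact lintegral_add_left (hmG.of_uncurry_left) _
    _ = (∫⁻ z, ∫⁻ w, G z w ∂ν ∂ν) + ∫⁻ z, ∫⁻ w, G w z ∂ν ∂ν :=
        lintegral_add_left hmG.lintegral_prod_right' _
    _ = (∫⁻ z, ∫⁻ w, G z w ∂ν ∂ν) + ∫⁻ z, ∫⁻ w, G z w ∂ν ∂ν := by
        rw [lintegral_lintegral_swap (f := fun z w => G w z)]
        exact (hmG.comp measurable_swap).aemeasurable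
    _ ≤ ENNReal.ofReal C + ENNReal.ofReal C := add_le_add hGint hGint
    _ = _ := by
        rw [ENNReal.coe_mul, ENNReal.ofReal, ENNReal.coe_ofNat, two_mul]

end HardyLittlewoodSobolev

/-! ### Kernels that define bounded bilinear forms on L^r. -/

section BoundedKernel

variable {X : Type*} [MeasurableSpace X] {ν : Measure X} {r : ℝ≥0∞} {k : X → X → ℝ}

/-- The kernel `k` defines a bounded bilinear form on `L^r(ν)`. -/
structure IsBoundedKernel (k : X → X → ℝ) (r : ℝ≥0∞) (ν : Measure X) : Prop where
  measurable : Measurable (Function.uncurry k)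
  bound : ∃ C : ℝ≥0, ∀ f g : X → ℝ, MemLp f r ν → MemLp g r ν →
    ∫⁻ z, ∫⁻ w, ‖f z‖ₑ * (‖g w‖ₑ * ‖k z w‖ₑ) ∂ν ∂ν ≤ C * eLpNorm f r ν * eLpNorm g r ν

/-- For f and g in the unit ball, s = (|f| + |g|)/2 is again in the unit ball and both functions are
at most 2s, so the diagonal bound for s gives the bilinear one with the constant 4C. Homogeneity
removes the normalisation. -/
theorem isBoundedKernel_of_unit [SFinite ν] [Fact (1 ≤ r)] (hr : r ≠ ∞)
    (hk : Measurable (Function.uncurry k)) {C : ℝ≥0}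
    (h : ∀ f : X → ℝ≥0, Measurable f → ∫⁻ w, (f w : ℝ≥0∞) ^ r.toReal ∂ν ≤ 1 →
      ∫⁻ z, ∫⁻ w, f z * (f w * ‖k z w‖ₑ) ∂ν ∂ν ≤ C) :
    IsBoundedKernel k r ν := by
  have hr1 : 1 ≤ r := Fact.out
  have hr0 : r ≠ 0 := (zero_lt_one.trans_le hr1).ne'
  have hunit : ∀ f g : X → ℝ, Measurable f → Measurable g → eLpNorm f r ν ≤ 1 →
      eLpNorm g r ν ≤ 1 → ∫⁻ z, ∫⁻ w, ‖f z‖ₑ * (‖g w‖ₑ * ‖k z w‖ₑ) ∂ν ∂ν ≤ 4 * C := by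
    intro f g hf hg hf1 hg1
    set s : X → ℝ≥0 := fun x => 2⁻¹ * (‖f x‖₊ + ‖g x‖₊) with hs
    have hsm : Measurable s := (hf.nnnorm.add hg.nnnorm).const_mul _
    have hse : ∀ x, (s x : ℝ≥0∞) = ‖(2⁻¹ : ℝ) • (‖f x‖ + ‖g x‖)‖ₑ := by
      intro x
      rw [enorm_eq_nnnorm]
      congr 1
      ext
      simp only [hs, NNReal.coe_mul, NNReal.coe_inv, NNReal.coe_ofNat, NNReal.coe_add, coe_nnnorm,
        smul_eq_mul, norm_mul]
      rw [Real.norm_of_nonneg (by positivity : (0 : ℝ) ≤ 2⁻¹),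
        Real.norm_of_nonneg (by positivity : (0 : ℝ) ≤ ‖f x‖ + ‖g x‖)]
    have h1 : eLpNorm (fun x => (2⁻¹ : ℝ) • (‖f x‖ + ‖g x‖)) r ν ≤ 1 := by
      have e1 : (fun x => (2⁻¹ : ℝ) • (‖f x‖ + ‖g x‖)) =
        (2⁻¹ : ℝ) • ((fun x => ‖f x‖) + fun x => ‖g x‖) := rfl
      rw [e1, eLpNorm_const_smul]
      have h2 := eLpNorm_add_le (p := r) (μ := ν) hf.norm.aestronglyMeasurable
        hg.norm.aestronglyMeasurable hr1
      rw [eLpNorm_norm, eLpNorm_norm] at h2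
      calc _ ≤ ‖(2⁻¹ : ℝ)‖ₑ * (1 + 1) := by gcongr; exact h2.trans (add_le_add hf1 hg1)
        _ = 1 := by
          rw [enorm_inv (by norm_num), show ‖(2 : ℝ)‖ₑ = 2 by simp [enorm_eq_nnnorm],
            one_add_one_eq_two]
          exact ENNReal.inv_mul_cancel (by simp) (by simp)
    have h2 : ∫⁻ w, (s w : ℝ≥0∞) ^ r.toReal ∂ν ≤ 1 := by
      have h3 := lintegral_rpow_enorm_eq_rpow_eLpNorm' (μ := ν) (f := fun x => (2⁻¹ : ℝ) • (‖f x‖ + ‖g x‖))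
        (ENNReal.toReal_pos hr0 hr)
      rw [← eLpNorm_eq_eLpNorm' hr0 hr] at h3
      simp_rw [hse]
      rw [h3]
      exact ENNReal.rpow_le_one h1 ENNReal.toReal_nonneg
    have h3 := h s hsm h2
    have hf_le : ∀ x, ‖f x‖ₑ ≤ 2 * s x := by
      intro x
      rw [hs]
      push_cast
      rw [← mul_assoc, ENNReal.mul_inv_cancel (by simp) (by simp), one_mul]
      exact le_self_add
    have hg_le : ∀ x, ‖g x‖ₑ ≤ 2 * s x := by
      intro x
      rw [hs]
      push_cast
      rw [← mul_assoc, ENNReal.mul_inv_cancel (by simp) (by simp), one_mul]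
      exact le_add_self
    have hm : Measurable fun a : X × X => (s a.1 : ℝ≥0∞) * (s a.2 * ‖k a.1 a.2‖ₑ) :=
      (hsm.comp measurable_fst).coe_nnreal_ennreal.mul
        ((hsm.comp measurable_snd).coe_nnreal_ennreal.mul hk.enorm)
    calc ∫⁻ z, ∫⁻ w, ‖f z‖ₑ * (‖g w‖ₑ * ‖k z w‖ₑ) ∂ν ∂ν
        ≤ ∫⁻ z, ∫⁻ w, 4 * (s z * (s w * ‖k z w‖ₑ)) ∂ν ∂ν := by
          refine lintegral_mono fun z => lintegral_mono fun w => ?_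
          calc ‖f z‖ₑ * (‖g w‖ₑ * ‖k z w‖ₑ) ≤ 2 * s z * (2 * s w * ‖k z w‖ₑ) := by
                gcongr
                · exact hf_le z
                · exact hg_le w
            _ = _ := by ring
      _ = 4 * ∫⁻ z, ∫⁻ w, s z * (s w * ‖k z w‖ₑ) ∂ν ∂ν := by
          rw [← lintegral_const_mul _ hm.lintegral_prod_right']
          congr 1
          funext z
          exact lintegral_const_mul _
            (hm.of_uncurry_left (f := fun z w => (s z : ℝ≥0∞) * (s w * ‖k z w‖ₑ)))
      _ ≤ _ := by gcongr
  have hmeas : ∀ f g : X → ℝ, Measurable f → Measurable g → MemLp f r ν → MemLp g r ν →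
      ∫⁻ z, ∫⁻ w, ‖f z‖ₑ * (‖g w‖ₑ * ‖k z w‖ₑ) ∂ν ∂ν ≤
        (4 * C) * eLpNorm f r ν * eLpNorm g r ν := by
    intro f g hfm hgm hf hg
    have hm : Measurable fun a : X × X => ‖f a.1‖ₑ * (‖g a.2‖ₑ * ‖k a.1 a.2‖ₑ) :=
      (hfm.comp measurable_fst).enorm.mul ((hgm.comp measurable_snd).enorm.mul hk.enorm)
    rcases eq_or_ne (eLpNorm f r ν) 0 with hf0 | hf0
    · rw [eLpNorm_eq_zero_iff hf.1 hr0] at hf0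
      refine le_trans (le_of_eq ?_) zero_le
      rw [lintegral_eq_zero_iff hm.lintegral_prod_right']
      filter_upwards [hf0] with z hz
      simp [hz]
    rcases eq_or_ne (eLpNorm g r ν) 0 with hg0 | hg0
    · rw [eLpNorm_eq_zero_iff hg.1 hr0] at hg0
      refine le_trans (le_of_eq ?_) zero_le
      rw [lintegral_eq_zero_iff hm.lintegral_prod_right']
      refine Eventually.of_forall fun z => ?_
      change ∫⁻ w, ‖f z‖ₑ * (‖g w‖ₑ * ‖k z w‖ₑ) ∂ν = 0
      rw [lintegral_eq_zero_iff
        (hm.of_uncurry_left (f := fun z w => ‖f z‖ₑ * (‖g w‖ₑ * ‖k z w‖ₑ)))]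
      filter_upwards [hg0] with w hw
      simp [hw]
    set a := (eLpNorm f r ν).toReal
    set b := (eLpNorm g r ν).toReal
    have ha : 0 < a := ENNReal.toReal_pos hf0 hf.2.ne
    have hb : 0 < b := ENNReal.toReal_pos hg0 hg.2.ne
    have hae : ‖a‖ₑ = eLpNorm f r ν := by
      rw [Real.enorm_of_nonneg ha.le]
      exact ENNReal.ofReal_toReal hf.2.ne
    have hbe : ‖b‖ₑ = eLpNorm g r ν := by
      rw [Real.enorm_of_nonneg hb.le]
      exact ENNReal.ofReal_toReal hg.2.ne
    have h1 : eLpNorm (a⁻¹ • f) r ν ≤ 1 := by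
      rw [eLpNorm_const_smul, enorm_inv ha.ne', hae]
      exact (ENNReal.inv_mul_cancel hf0 hf.2.ne).le
    have h2 : eLpNorm (b⁻¹ • g) r ν ≤ 1 := by
      rw [eLpNorm_const_smul, enorm_inv hb.ne', hbe]
      exact (ENNReal.inv_mul_cancel hg0 hg.2.ne).le
    have h3 := hunit _ _ (hfm.const_smul a⁻¹) (hgm.const_smul b⁻¹) h1 h2
    have hm' : Measurable fun p : X × X =>
        ‖(a⁻¹ • f) p.1‖ₑ * (‖(b⁻¹ • g) p.2‖ₑ * ‖k p.1 p.2‖ₑ) :=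
      ((hfm.const_smul a⁻¹).comp measurable_fst).enorm.mul
        (((hgm.const_smul b⁻¹).comp measurable_snd).enorm.mul hk.enorm)
    calc ∫⁻ z, ∫⁻ w, ‖f z‖ₑ * (‖g w‖ₑ * ‖k z w‖ₑ) ∂ν ∂ν
        = ∫⁻ z, ∫⁻ w, (‖a‖ₑ * ‖b‖ₑ) *
            (‖(a⁻¹ • f) z‖ₑ * (‖(b⁻¹ • g) w‖ₑ * ‖k z w‖ₑ)) ∂ν ∂ν := by
          refine lintegral_congr fun z => lintegral_congr fun w => ?_
          have e1 : ‖f z‖ₑ = ‖a‖ₑ * ‖(a⁻¹ • f) z‖ₑ := by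
            rw [← enorm_mul]
            congr 1
            simp [ha.ne']
          have e2 : ‖g w‖ₑ = ‖b‖ₑ * ‖(b⁻¹ • g) w‖ₑ := by
            rw [← enorm_mul]
            congr 1
            simp [hb.ne']
          rw [e1, e2]
          ring
      _ = (‖a‖ₑ * ‖b‖ₑ) * ∫⁻ z, ∫⁻ w,
            (‖(a⁻¹ • f) z‖ₑ * (‖(b⁻¹ • g) w‖ₑ * ‖k z w‖ₑ)) ∂ν ∂ν := by
          rw [← lintegral_const_mul _ hm'.lintegral_prod_right']
          congr 1
          funext z
          exact lintegral_const_mul _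
            (hm'.of_uncurry_left (f := fun z w => ‖(a⁻¹ • f) z‖ₑ * (‖(b⁻¹ • g) w‖ₑ * ‖k z w‖ₑ)))
      _ ≤ (‖a‖ₑ * ‖b‖ₑ) * (4 * C) := by gcongr
      _ = _ := by rw [hae, hbe]; ring
  refine ⟨hk, 4 * C, fun f g hf hg => ?_⟩
  have h1 := hmeas (hf.1.mk f) (hg.1.mk g) hf.1.stronglyMeasurable_mk.measurable
    hg.1.stronglyMeasurable_mk.measurable ((memLp_congr_ae hf.1.ae_eq_mk).1 hf)
    ((memLp_congr_ae hg.1.ae_eq_mk).1 hg)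
  rw [← eLpNorm_congr_ae hf.1.ae_eq_mk, ← eLpNorm_congr_ae hg.1.ae_eq_mk] at h1
  push_cast
  refine (le_of_eq ?_).trans h1
  refine lintegral_congr_ae ?_
  filter_upwards [hf.1.ae_eq_mk] with z hz
  refine lintegral_congr_ae ?_
  filter_upwards [hg.1.ae_eq_mk] with w hw
  rw [hz, hw]

variable [SFinite ν]

theorem IsBoundedKernel.lintegral_prod_le (h : IsBoundedKernel k r ν) :
    ∃ C : ℝ≥0, ∀ f g : Lp ℝ r ν,
      ∫⁻ a, ‖f a.1 * g a.2 * k a.1 a.2‖ₑ ∂(ν.prod ν) ≤ C * ‖f‖ₑ * ‖g‖ₑ := by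
  obtain ⟨C, hC⟩ := h.bound
  refine ⟨C, fun f g => ?_⟩
  have h1 := hC f g (Lp.memLp f) (Lp.memLp g)
  rw [lintegral_prod]
  · rw [Lp.enorm_def, Lp.enorm_def]
    refine (le_of_eq ?_).trans h1
    simp_rw [enorm_mul, mul_assoc]
  · exact (((Lp.aestronglyMeasurable f).comp_fst.mul
      (Lp.aestronglyMeasurable g).comp_snd).mul h.measurable.aestronglyMeasurable).enorm

theorem IsBoundedKernel.integrable (h : IsBoundedKernel k r ν) (f g : Lp ℝ r ν) :
    Integrable (fun a : X × X => f a.1 * g a.2 * k a.1 a.2) (ν.prod ν) := by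
  obtain ⟨C, hC⟩ := h.lintegral_prod_le
  refine ⟨((Lp.aestronglyMeasurable f).comp_fst.mul
      (Lp.aestronglyMeasurable g).comp_snd).mul h.measurable.aestronglyMeasurable, ?_⟩
  refine (hC f g).trans_lt ?_
  exact ENNReal.mul_lt_top (ENNReal.mul_lt_top ENNReal.coe_lt_top enorm_lt_top) enorm_lt_top

theorem IsBoundedKernel.exists_integral_bound (h : IsBoundedKernel k r ν) :
    ∃ C : ℝ, ∀ f g : Lp ℝ r ν,
      ‖∫ a, f a.1 * g a.2 * k a.1 a.2 ∂(ν.prod ν)‖ ≤ C * ‖f‖ * ‖g‖ := by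
  obtain ⟨C, hC⟩ := h.lintegral_prod_le
  refine ⟨C, fun f g => ?_⟩
  have h1 := (enorm_integral_le_lintegral_enorm _).trans (hC f g)
  have e1 : ∀ f : Lp ℝ r ν, ‖f‖ₑ = ENNReal.ofReal ‖f‖ := fun f => by
    rw [Lp.enorm_def, Lp.norm_def, ENNReal.ofReal_toReal (Lp.eLpNorm_ne_top f)]
  have e2 : ∀ f : Lp ℝ r ν, 0 ≤ ‖f‖ := fun f => by
    rw [Lp.norm_def]
    exact ENNReal.toReal_nonneg
  have hf := e2 f
  have hg := e2 g
  rw [← ofReal_norm, e1, e1, ← ENNReal.ofReal_coe_nnreal,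
    ← ENNReal.ofReal_mul (by positivity), ← ENNReal.ofReal_mul (by positivity)] at h1
  exact (ENNReal.ofReal_le_ofReal_iff (by positivity)).1 h1

variable [Fact (1 ≤ r)]

/-- The bilinear form `(f, g) ↦ ∫∫ f(z) g(w) k(z, w)` on `L^r(ν)`. -/
def IsBoundedKernel.form (h : IsBoundedKernel k r ν) : Lp ℝ r ν →L[ℝ] Lp ℝ r ν →L[ℝ] ℝ :=
  LinearMap.mkContinuous₂
    (LinearMap.mk₂ ℝ (fun f g : Lp ℝ r ν => ∫ a, f a.1 * g a.2 * k a.1 a.2 ∂(ν.prod ν))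
      (fun f₁ f₂ g => by
        rw [← integral_add (h.integrable f₁ g) (h.integrable f₂ g)]
        refine integral_congr_ae ?_
        have h1 := Measure.quasiMeasurePreserving_fst (μ := ν) (ν := ν) |>.ae (Lp.coeFn_add f₁ f₂)
        filter_upwards [h1] with a ha
        rw [ha, Pi.add_apply]
        ring)
      (fun c f g => by
        rw [smul_eq_mul, ← integral_const_mul]
        refine integral_congr_ae ?_
        have h1 := Measure.quasiMeasurePreserving_fst (μ := ν) (ν := ν) |>.ae (Lp.coeFn_smul c f)
        filter_upwards [h1] with a ha
        rw [ha, Pi.smul_apply, smul_eq_mul]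
        ring)
      (fun f g₁ g₂ => by
        rw [← integral_add (h.integrable f g₁) (h.integrable f g₂)]
        refine integral_congr_ae ?_
        have h1 := Measure.quasiMeasurePreserving_snd (μ := ν) (ν := ν) |>.ae (Lp.coeFn_add g₁ g₂)
        filter_upwards [h1] with a ha
        rw [ha, Pi.add_apply]
        ring)
      (fun c f g => by
        rw [smul_eq_mul, ← integral_const_mul]
        refine integral_congr_ae ?_
        have h1 := Measure.quasiMeasurePreserving_snd (μ := ν) (ν := ν) |>.ae (Lp.coeFn_smul c g)
        filter_upwards [h1] with a ha
        rw [ha, Pi.smul_apply, smul_eq_mul]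
        ring))
    h.exists_integral_bound.choose h.exists_integral_bound.choose_spec

theorem IsBoundedKernel.form_apply (h : IsBoundedKernel k r ν) (f g : Lp ℝ r ν) :
    h.form f g = ∫ a, f a.1 * g a.2 * k a.1 a.2 ∂(ν.prod ν) := rfl

theorem IsBoundedKernel.form_comm (h : IsBoundedKernel k r ν) (hs : ∀ z w, k z w = k w z)
    (f g : Lp ℝ r ν) : h.form f g = h.form g f := by
  rw [h.form_apply, h.form_apply, ← integral_prod_swap]
  congr 1
  funext a
  rw [Prod.fst_swap, Prod.snd_swap, hs a.2 a.1]
  ring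

end BoundedKernel

section

variable {m n : ℕ} {γ : ℝ≥0} {μ : ℝ}

/-- The Hardy–Littlewood–Sobolev inequality for the kernel `d(z - w)^{-μ}`. -/
theorem isBoundedKernel_kern (hμ0 : 0 < μ) (hμ : μ < homDim m n γ) {ν : Measure (Space m n)}
    [SFinite ν] (hν : ν ≤ volume) {r : ℝ≥0∞} [Fact (1 ≤ r)]
    (hr : r = ENNReal.ofReal (2 * homDim m n γ / (2 * homDim m n γ - μ))) :
    IsBoundedKernel (fun z w : Space m n => kern γ μ (z - w)) r ν := by
  obtain ⟨C, hC⟩ := lintegral_kern_diagonal_le (m := m) (n := n) (γ := γ) hμ0 hμ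
  refine isBoundedKernel_of_unit (C := C) (hr ▸ ENNReal.ofReal_ne_top)
    (measurable_kern.comp (measurable_fst.sub measurable_snd)) fun f hf hf1 => ?_
  have hQ : 0 < homDim m n γ := hμ0.trans hμ
  have h2 : 0 < 2 * homDim m n γ - μ := by linarith
  rw [hr, ENNReal.toReal_ofReal (by positivity)] at hf1
  have h3 := hC ν hν f hf hf1
  simp_rw [Real.enorm_of_nonneg (kern_nonneg _)]
  exact h3

end

/-! ### Scalar inequalities for |a + b|^p. -/

section Scalar

variable {p : ℝ}

/-- By homogeneity a = 1. For small s the estimate is differentiability of |·|^p at 1; for |s| ≥ δ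
each of the three terms is bounded by a multiple of |s|^p. -/
theorem abs_add_rpow_sub_le (hp : 1 < p) {ε : ℝ} (hε : 0 < ε) :
    ∃ C : ℝ, 0 ≤ C ∧ ∀ a b : ℝ, |(|a + b| ^ p - |a| ^ p - p * |a| ^ (p - 2) * a * b)| ≤
      ε * (|a| ^ (p - 1) * |b|) + C * |b| ^ p := by
  have hd := hasDerivAt_abs_rpow 1 hp
  rw [hasDerivAt_iff_isLittleO] at hd
  obtain ⟨δ, hδ, hδs⟩ := Metric.eventually_nhds_iff.1 (Asymptotics.isLittleO_iff.1 hd hε)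
  have hunit : ∀ s : ℝ, |(|1 + s| ^ p - 1 - p * s)| ≤
      ε * |s| + ((1 / δ + 1) ^ p + (1 / δ) ^ p + p * (1 / δ) ^ (p - 1)) * |s| ^ p := by
    intro s
    rcases lt_or_ge |s| δ with hs | hs
    · have h := hδs (y := 1 + s) (by simpa [Real.dist_eq] using hs)
      simp only [abs_one, Real.one_rpow, mul_one, add_sub_cancel_left, smul_eq_mul,
        Real.norm_eq_abs] at h
      rw [mul_comm s p] at h
      exact h.trans (le_add_of_nonneg_right (by positivity))
    · have hs0 : 0 < |s| := hδ.trans_le hs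
      have h1 : 1 ≤ 1 / δ * |s| := by
        rw [one_div, ← div_eq_inv_mul, one_le_div hδ]
        exact hs
      have h2 : |1 + s| ^ p ≤ (1 / δ + 1) ^ p * |s| ^ p := by
        rw [← Real.mul_rpow (by positivity) (by positivity)]
        refine Real.rpow_le_rpow (abs_nonneg _) ?_ (by linarith)
        refine (abs_add_le _ _).trans ?_
        rw [abs_one]
        linarith
      have h3 : 1 ≤ (1 / δ) ^ p * |s| ^ p := by
        rw [← Real.mul_rpow (by positivity) (by positivity)]
        exact Real.one_le_rpow h1 (by linarith)
      have h4 : p * |s| ≤ p * (1 / δ) ^ (p - 1) * |s| ^ p := by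
        rw [mul_assoc]
        refine mul_le_mul_of_nonneg_left ?_ (by linarith)
        have h5 : 1 ≤ (1 / δ) ^ (p - 1) * |s| ^ (p - 1) := by
          rw [← Real.mul_rpow (by positivity) (by positivity)]
          exact Real.one_le_rpow h1 (by linarith)
        have h6 : |s| ^ p = |s| ^ (p - 1) * |s| := by
          rw [← Real.rpow_add_one hs0.ne', sub_add_cancel]
        rw [h6, ← mul_assoc]
        exact le_mul_of_one_le_left hs0.le h5
      have h7 : |(|1 + s| ^ p - 1 - p * s)| ≤ |1 + s| ^ p + 1 + p * |s| := by
        have := abs_sub (|1 + s| ^ p - 1) (p * s)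
        have h8 := abs_sub (|1 + s| ^ p) 1
        rw [abs_of_nonneg (by positivity : 0 ≤ |1 + s| ^ p), abs_one] at h8
        rw [abs_mul p, abs_of_pos (by linarith : 0 < p)] at this
        linarith
      have h9 : 0 ≤ ε * |s| := by positivity
      rw [add_mul, add_mul]
      linarith
  have hC : 0 ≤ (1 / δ + 1) ^ p + (1 / δ) ^ p + p * (1 / δ) ^ (p - 1) := by
    have : 0 < p := by linarith
    positivity
  refine ⟨(1 / δ + 1) ^ p + (1 / δ) ^ p + p * (1 / δ) ^ (p - 1), hC, fun a b => ?_⟩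
  rcases eq_or_ne a 0 with ha | ha
  · have h1 : 1 ≤ (1 / δ + 1) ^ p :=
      Real.one_le_rpow (le_add_of_nonneg_left (by positivity)) (by linarith)
    rw [ha, abs_zero, Real.zero_rpow (by linarith : p ≠ 0), Real.zero_rpow (by linarith : p - 1 ≠ 0),
      zero_add, zero_mul, mul_zero, mul_zero, zero_mul, zero_add, sub_zero, sub_zero,
      abs_of_nonneg (by positivity)]
    refine le_mul_of_one_le_left (by positivity) (h1.trans ?_)
    have : 0 < p := by linarith
    have : 0 ≤ p * (1 / δ) ^ (p - 1) := by positivity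
    have : 0 ≤ (1 / δ) ^ p := by positivity
    linarith
  · have ha' : 0 < |a| := abs_pos.2 ha
    obtain ⟨s, rfl⟩ : ∃ s, b = a * s := ⟨b / a, by field_simp⟩
    have e1 : |a + a * s| ^ p = |a| ^ p * |1 + s| ^ p := by
      rw [← Real.mul_rpow (abs_nonneg _) (abs_nonneg _), ← abs_mul]
      congr 2
      ring
    have e2 : |a| ^ (p - 2) * a * a = |a| ^ p := by
      rw [mul_assoc, ← abs_mul_abs_self a, ← mul_assoc, ← Real.rpow_add_one ha'.ne',
        ← Real.rpow_add_one ha'.ne']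
      congr 1
      ring
    have e3 : |a| ^ (p - 1) * |a| = |a| ^ p := by
      rw [← Real.rpow_add_one ha'.ne', sub_add_cancel]
    have e4 : |a + a * s| ^ p - |a| ^ p - p * |a| ^ (p - 2) * a * (a * s) =
        |a| ^ p * (|1 + s| ^ p - 1 - p * s) := by
      rw [e1, show p * |a| ^ (p - 2) * a * (a * s) = p * s * (|a| ^ (p - 2) * a * a) by ring, e2]
      ring
    rw [e4, abs_mul, abs_of_nonneg (by positivity : 0 ≤ |a| ^ p)]
    refine (mul_le_mul_of_nonneg_left (hunit s) (by positivity)).trans (le_of_eq ?_)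
    rw [abs_mul a s, Real.mul_rpow (abs_nonneg _) (abs_nonneg _), ← mul_assoc (|a| ^ (p - 1)), e3]
    ring

/-- Compare |b| with ε|a|: in either case one of the two terms on the right is enough. -/
theorem rpow_sub_one_mul_le (hp : 1 < p) {ε : ℝ} (hε : 0 < ε) :
    ∃ C : ℝ, 0 ≤ C ∧ ∀ a b : ℝ, |a| ^ (p - 1) * |b| ≤ ε * |a| ^ p + C * |b| ^ p := by
  refine ⟨(1 / ε) ^ (p - 1), by positivity, fun a b => ?_⟩
  have hpow : ∀ x : ℝ, |x| ^ p = |x| ^ (p - 1) * |x| := by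
    intro x
    rcases eq_or_ne x 0 with hx | hx
    · rw [hx, abs_zero, Real.zero_rpow (by linarith), mul_zero]
    · rw [← Real.rpow_add_one (abs_pos.2 hx).ne', sub_add_cancel]
  rcases le_total |b| (ε * |a|) with h | h
  · have h1 : |a| ^ (p - 1) * |b| ≤ ε * |a| ^ p := by
      rw [hpow, mul_left_comm]
      exact mul_le_mul_of_nonneg_left h (by positivity)
    exact h1.trans (le_add_of_nonneg_right (by positivity))
  · have h1 : |a| ≤ 1 / ε * |b| := by
      rw [one_div, ← div_eq_inv_mul, le_div_iff₀ hε]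
      linarith
    have h2 : |a| ^ (p - 1) * |b| ≤ (1 / ε) ^ (p - 1) * |b| ^ p := by
      rw [hpow b, ← mul_assoc, ← Real.mul_rpow (by positivity) (abs_nonneg _)]
      exact mul_le_mul_of_nonneg_right (Real.rpow_le_rpow (abs_nonneg _) h1 (by linarith))
        (abs_nonneg _)
    exact h2.trans (le_add_of_nonneg_left (by positivity))

theorem abs_rpow_sub_two_mul (hp : 1 < p) (a : ℝ) : |(|a| ^ (p - 2) * a)| = |a| ^ (p - 1) := by
  rcases eq_or_ne a 0 with ha | ha
  · rw [ha, mul_zero, abs_zero, Real.zero_rpow (by linarith)]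
  · rw [abs_mul, abs_of_nonneg (by positivity : 0 ≤ |a| ^ (p - 2)),
      ← Real.rpow_add_one (abs_pos.2 ha).ne']
    congr 1
    ring

theorem brezis_lieb_defect_le (hp : 1 < p) {ε : ℝ} (hε : 0 < ε) :
    ∃ C : ℝ, ∀ a b : ℝ, |(|a + b| ^ p - |a| ^ p - |b| ^ p)| ≤ ε * |a| ^ p + C * |b| ^ p := by
  obtain ⟨C₁, hC₁, h₁⟩ := abs_add_rpow_sub_le hp one_pos
  -- The mixed term |a|^(p-1)|b| occurs p times from the linear part and once from its error, hence
  -- the division by p + 1.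
  obtain ⟨C₂, hC₂, h₂⟩ := rpow_sub_one_mul_le hp (ε := ε / (p + 1)) (div_pos hε (by linarith))
  refine ⟨C₁ + (p + 1) * C₂ + 1, fun a b => ?_⟩
  have h3 := h₁ a b
  have h4 := h₂ a b
  have h5 : |p * |a| ^ (p - 2) * a * b| = p * (|a| ^ (p - 1) * |b|) := by
    rw [show p * |a| ^ (p - 2) * a * b = p * ((|a| ^ (p - 2) * a) * b) by ring, abs_mul, abs_mul,
      abs_rpow_sub_two_mul hp, abs_of_pos (by linarith : 0 < p)]
  have h6 : |(|a + b| ^ p - |a| ^ p - |b| ^ p)| ≤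
      |(|a + b| ^ p - |a| ^ p - p * |a| ^ (p - 2) * a * b)| + |p * |a| ^ (p - 2) * a * b| +
        |b| ^ p := by
    have e1 : |a + b| ^ p - |a| ^ p - |b| ^ p =
      (|a + b| ^ p - |a| ^ p - p * |a| ^ (p - 2) * a * b) + p * |a| ^ (p - 2) * a * b - |b| ^ p := by
      ring
    rw [e1]
    refine (abs_sub _ _).trans ?_
    rw [abs_of_nonneg (by positivity : 0 ≤ |b| ^ p)]
    gcongr
    exact abs_add_le _ _
  have h7 : (p + 1) * (|a| ^ (p - 1) * |b|) ≤ ε * |a| ^ p + (p + 1) * C₂ * |b| ^ p := by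
    refine (mul_le_mul_of_nonneg_left h4 (by linarith)).trans (le_of_eq ?_)
    have : p + 1 ≠ 0 := by linarith
    field_simp
  linarith

theorem abs_add_rpow_le (hp : 0 ≤ p) (a b : ℝ) : |a + b| ^ p ≤ 2 ^ p * (|a| ^ p + |b| ^ p) := by
  have h1 : |a + b| ≤ 2 * max |a| |b| := by
    refine (abs_add_le a b).trans ?_
    linarith [le_max_left |a| |b|, le_max_right |a| |b|]
  refine (Real.rpow_le_rpow (abs_nonneg _) h1 hp).trans ?_
  rw [Real.mul_rpow (by norm_num) (le_max_of_le_left (abs_nonneg a))]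
  gcongr
  rcases le_total |a| |b| with h | h
  · rw [max_eq_right h]
    exact le_add_of_nonneg_left (by positivity)
  · rw [max_eq_left h]
    exact le_add_of_nonneg_right (by positivity)

theorem rpow_sub_two_mul_defect_le (hp : 1 < p) {ε : ℝ} (hε : 0 < ε) :
    ∃ C : ℝ, ∀ a b : ℝ, |(|a + b| ^ (p - 2) * (a + b) * b - |b| ^ p)| ≤
      ε * |a| ^ p + C * |b| ^ p := by
  obtain ⟨C₂, hC₂, h₂⟩ := rpow_sub_one_mul_le hp (ε := ε / 2 ^ p) (by positivity)
  refine ⟨ε + C₂ + 1, fun a b => ?_⟩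
  refine (abs_sub _ _).trans ?_
  rw [abs_mul, abs_rpow_sub_two_mul hp, abs_of_nonneg (by positivity : 0 ≤ |b| ^ p)]
  have h3 := h₂ (a + b) b
  have h4 : ε / 2 ^ p * |a + b| ^ p ≤ ε * (|a| ^ p + |b| ^ p) := by
    refine (mul_le_mul_of_nonneg_left (abs_add_rpow_le (by linarith) a b)
      (by positivity)).trans (le_of_eq ?_)
    have : (2 : ℝ) ^ p ≠ 0 := by positivity
    field_simp
  linarith

end Scalar

/-! ### Differentiability of u ↦ |u|^p from L^(rp) to L^r. -/

section Nemytskii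

variable {X : Type*} [MeasurableSpace X] {ν : Measure X} {p r : ℝ}

theorem memLp_abs_rpow (hp : 0 < p) (hr : 0 ≤ r) {u : X → ℝ}
    (hu : MemLp u (ENNReal.ofReal (r * p)) ν) :
    MemLp (fun x => |u x| ^ p) (ENNReal.ofReal r) ν := by
  refine ⟨(hu.1.norm.aemeasurable.pow_const p).aestronglyMeasurable, ?_⟩
  have h := eLpNorm_norm_rpow (p := ENNReal.ofReal r) (μ := ν) u hp
  simp only [Real.norm_eq_abs] at h
  rw [h, ← ENNReal.ofReal_mul hr]
  exact ENNReal.rpow_lt_top_of_nonneg hp.le hu.2.ne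

theorem eLpNorm_abs_rpow (hp : 0 < p) (hr : 0 ≤ r) (u : X → ℝ) :
    eLpNorm (fun x => |u x| ^ p) (ENNReal.ofReal r) ν =
      eLpNorm u (ENNReal.ofReal (r * p)) ν ^ p := by
  have h := eLpNorm_norm_rpow (p := ENNReal.ofReal r) (μ := ν) u hp
  simp only [Real.norm_eq_abs] at h
  rw [h, ← ENNReal.ofReal_mul hr]

/-- Hölder with 1/r = (p-1)/(rp) + 1/(rp). -/
theorem eLpNorm_rpow_sub_one_mul_le (hp : 1 < p) (hr : 0 < r) {u v : X → ℝ}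
    (hu : AEStronglyMeasurable u ν) (hv : AEStronglyMeasurable v ν) :
    eLpNorm (fun x => |u x| ^ (p - 1) * v x) (ENNReal.ofReal r) ν ≤
      eLpNorm u (ENNReal.ofReal (r * p)) ν ^ (p - 1) * eLpNorm v (ENNReal.ofReal (r * p)) ν := by
  have hp1 : 0 < p - 1 := by linarith
  have hp0 : 0 < p := by linarith
  have htriple : ENNReal.HolderTriple (ENNReal.ofReal (r * p / (p - 1))) (ENNReal.ofReal (r * p))
      (ENNReal.ofReal r) := by
    constructor
    rw [← ENNReal.ofReal_inv_of_pos (by positivity), ← ENNReal.ofReal_inv_of_pos (by positivity),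
      ← ENNReal.ofReal_inv_of_pos (by positivity), ← ENNReal.ofReal_add (by positivity)
      (by positivity)]
    congr 1
    field_simp
    ring
  have h1 := eLpNorm_smul_le_mul_eLpNorm (p := ENNReal.ofReal (r * p / (p - 1)))
    (q := ENNReal.ofReal (r * p)) (r := ENNReal.ofReal r) (μ := ν) hv
    (φ := fun x => |u x| ^ (p - 1)) (hu.norm.aemeasurable.pow_const (p - 1)).aestronglyMeasurable
  rw [eLpNorm_abs_rpow hp1 (by positivity)] at h1
  rwa [div_mul_cancel₀ _ hp1.ne'] at h1

theorem memLp_rpow_sub_one_mul (hp : 1 < p) (hr : 0 < r) {u v : X → ℝ}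
    (hu : MemLp u (ENNReal.ofReal (r * p)) ν) (hv : MemLp v (ENNReal.ofReal (r * p)) ν) :
    MemLp (fun x => |u x| ^ (p - 1) * v x) (ENNReal.ofReal r) ν :=
  ⟨(hu.1.norm.aemeasurable.pow_const (p - 1)).aestronglyMeasurable.mul hv.1,
    (eLpNorm_rpow_sub_one_mul_le hp hr hu.1 hv.1).trans_lt
      (ENNReal.mul_lt_top (ENNReal.rpow_lt_top_of_nonneg (by linarith) hu.2.ne) hv.2)⟩

theorem memLp_rpow_sub_two_mul (hp : 1 < p) (hr : 0 < r) {u v : X → ℝ}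
    (hu : MemLp u (ENNReal.ofReal (r * p)) ν) (hv : MemLp v (ENNReal.ofReal (r * p)) ν) :
    MemLp (fun x => |u x| ^ (p - 2) * u x * v x) (ENNReal.ofReal r) ν := by
  refine (memLp_rpow_sub_one_mul hp hr hu hv).of_le
    (((hu.1.norm.aemeasurable.pow_const (p - 2)).aestronglyMeasurable.mul hu.1).mul hv.1)
    (Eventually.of_forall fun x => le_of_eq ?_)
  rw [norm_mul, norm_mul (|u x| ^ (p - 1)), Real.norm_eq_abs, Real.norm_eq_abs (|u x| ^ (p - 1)),
    abs_rpow_sub_two_mul hp, abs_of_nonneg (by positivity : 0 ≤ |u x| ^ (p - 1))]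

/-- The exponents of the Nemytskii operator `u ↦ |u|^p` from `L^{r p}` to `L^r`. -/
structure Exponents (p r : ℝ) : Prop where
  one_lt_p : 1 < p
  one_lt_r : 1 < r

/-- The operator `u ↦ |u|^p` from `L^{r p}` to `L^r`. -/
def absPow (h : Exponents p r) (u : Lp ℝ (ENNReal.ofReal (r * p)) ν) :
    Lp ℝ (ENNReal.ofReal r) ν :=
  (memLp_abs_rpow (by linarith [h.one_lt_p]) (by linarith [h.one_lt_r]) (Lp.memLp u)).toLp

theorem coeFn_absPow (h : Exponents p r) (u : Lp ℝ (ENNReal.ofReal (r * p)) ν) :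
    absPow h u =ᵐ[ν] fun x => |u x| ^ p := MemLp.coeFn_toLp _

theorem norm_absPow (h : Exponents p r) (u : Lp ℝ (ENNReal.ofReal (r * p)) ν) :
    ‖absPow h u‖ = ‖u‖ ^ p := by
  rw [absPow, Lp.norm_toLp, eLpNorm_abs_rpow (by linarith [h.one_lt_p]) (by linarith [h.one_lt_r]),
    ← ENNReal.toReal_rpow, Lp.norm_def]

variable [Fact (1 ≤ ENNReal.ofReal (r * p))] [Fact (1 ≤ ENNReal.ofReal r)]

/-- The operator `v ↦ |u|^{p-2} u v` from `L^{r p}` to `L^r`. -/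
def powMul (h : Exponents p r) (u : Lp ℝ (ENNReal.ofReal (r * p)) ν) :
    Lp ℝ (ENNReal.ofReal (r * p)) ν →L[ℝ] Lp ℝ (ENNReal.ofReal r) ν :=
  LinearMap.mkContinuous
    { toFun := fun v => (memLp_rpow_sub_two_mul h.one_lt_p (by linarith [h.one_lt_r])
        (Lp.memLp u) (Lp.memLp v)).toLp
      map_add' := fun v w => by
        rw [← MemLp.toLp_add, MemLp.toLp_eq_toLp_iff]
        filter_upwards [Lp.coeFn_add v w] with x hx
        simp only [Pi.add_apply, hx]
        ring
      map_smul' := fun c v => by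
        rw [RingHom.id_apply, ← MemLp.toLp_const_smul, MemLp.toLp_eq_toLp_iff]
        filter_upwards [Lp.coeFn_smul c v] with x hx
        simp only [Pi.smul_apply, hx, smul_eq_mul]
        ring }
    (‖u‖ ^ (p - 1)) (fun v => by
      have hp := h.one_lt_p
      have hr := h.one_lt_r
      simp only [LinearMap.coe_mk, AddHom.coe_mk]
      rw [Lp.norm_toLp]
      have h1 : eLpNorm (fun x => |u x| ^ (p - 2) * u x * v x) (ENNReal.ofReal r) ν =
          eLpNorm (fun x => |u x| ^ (p - 1) * v x) (ENNReal.ofReal r) ν := by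
        refine eLpNorm_congr_norm_ae (Eventually.of_forall fun x => ?_)
        rw [norm_mul, norm_mul (|u x| ^ (p - 1)), Real.norm_eq_abs, Real.norm_eq_abs (|u x| ^ (p - 1)),
          abs_rpow_sub_two_mul hp, abs_of_nonneg (by positivity : 0 ≤ |u x| ^ (p - 1))]
      have h2 := eLpNorm_rpow_sub_one_mul_le hp (by linarith) (Lp.aestronglyMeasurable u)
        (Lp.aestronglyMeasurable v)
      have h3 := ENNReal.toReal_mono (ENNReal.mul_ne_top
        (ENNReal.rpow_ne_top_of_nonneg (by linarith) (Lp.eLpNorm_ne_top u))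
        (Lp.eLpNorm_ne_top v)) h2
      rw [ENNReal.toReal_mul, ← ENNReal.toReal_rpow, ← Lp.norm_def, ← Lp.norm_def] at h3
      rw [h1]
      exact h3)

theorem coeFn_powMul (h : Exponents p r) (u v : Lp ℝ (ENNReal.ofReal (r * p)) ν) :
    powMul h u v =ᵐ[ν] fun x => |u x| ^ (p - 2) * u x * v x :=
  (memLp_rpow_sub_two_mul h.one_lt_p (by linarith [h.one_lt_r]) (Lp.memLp u)
    (Lp.memLp v)).coeFn_toLp

theorem powMul_self (h : Exponents p r) (u : Lp ℝ (ENNReal.ofReal (r * p)) ν) :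
    powMul h u u = absPow h u := by
  refine Lp.ext ?_
  filter_upwards [coeFn_powMul h u u, coeFn_absPow h u] with x h1 h2
  rw [h1, h2]
  have hp := h.one_lt_p
  rcases eq_or_ne (u x) 0 with ha | ha
  · rw [ha, mul_zero, abs_zero, Real.zero_rpow (by linarith)]
  · have ha' := (abs_pos.2 ha).ne'
    rw [mul_assoc, ← abs_mul_abs_self (u x), ← mul_assoc, ← Real.rpow_add_one ha',
      ← Real.rpow_add_one ha']
    congr 1
    ring

/-- The scalar estimate holds with the same C for all a and b, so it passes to norms directly; no
dominated convergence is needed for differentiability. -/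
theorem norm_absPow_add_sub_le (h : Exponents p r) {ε : ℝ} (hε : 0 < ε) :
    ∃ C : ℝ, 0 ≤ C ∧ ∀ u v : Lp ℝ (ENNReal.ofReal (r * p)) ν,
      ‖absPow h (u + v) - absPow h u - (p • powMul h u) v‖ ≤
        ε * (‖u‖ ^ (p - 1) * ‖v‖) + C * ‖v‖ ^ p := by
  have hp := h.one_lt_p
  have hr := h.one_lt_r
  obtain ⟨C, hC, hCb⟩ := abs_add_rpow_sub_le hp hε
  refine ⟨C, hC, fun u v => ?_⟩
  have hA := memLp_rpow_sub_one_mul hp (by linarith) (Lp.memLp u) (Lp.memLp v).norm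
  have hAn : ‖hA.toLp‖ ≤ ‖u‖ ^ (p - 1) * ‖v‖ := by
    rw [Lp.norm_toLp]
    have h2 := eLpNorm_rpow_sub_one_mul_le hp (by linarith : 0 < r) (Lp.aestronglyMeasurable u)
      (Lp.aestronglyMeasurable v).norm
    rw [eLpNorm_norm] at h2
    have h3 := ENNReal.toReal_mono (ENNReal.mul_ne_top
      (ENNReal.rpow_ne_top_of_nonneg (by linarith) (Lp.eLpNorm_ne_top u))
      (Lp.eLpNorm_ne_top v)) h2
    rwa [ENNReal.toReal_mul, ← ENNReal.toReal_rpow, ← Lp.norm_def, ← Lp.norm_def] at h3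
  have h1 : ‖absPow h (u + v) - absPow h u - (p • powMul h u) v‖ ≤
      ‖ε • hA.toLp + C • absPow h v‖ := by
    refine Lp.norm_le_norm_of_ae_le ?_
    rw [smul_apply]
    filter_upwards [Lp.coeFn_sub (absPow h (u + v) - absPow h u) (p • powMul h u v),
      Lp.coeFn_sub (absPow h (u + v)) (absPow h u), Lp.coeFn_smul p (powMul h u v),
      coeFn_powMul h u v, coeFn_absPow h (u + v), coeFn_absPow h u, Lp.coeFn_add u v,
      Lp.coeFn_add (ε • hA.toLp) (C • absPow h v), Lp.coeFn_smul ε hA.toLp,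
      Lp.coeFn_smul C (absPow h v), coeFn_absPow h v, hA.coeFn_toLp] with x h1 h2 h3 h4 h5 h6 h7
        h8 h9 h10 h11 h12
    rw [h1, Pi.sub_apply, h2, Pi.sub_apply, h3, Pi.smul_apply, h4, h5, h6, h7, Pi.add_apply, h8,
      Pi.add_apply, h9, h10, Pi.smul_apply, Pi.smul_apply, h11, h12, smul_eq_mul, smul_eq_mul,
      smul_eq_mul, Real.norm_eq_abs, Real.norm_eq_abs, Real.norm_eq_abs]
    refine le_trans (le_of_eq ?_) ((hCb (u x) (v x)).trans (le_abs_self _))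
    congr 1
    ring
  refine h1.trans ((norm_add_le _ _).trans ?_)
  rw [norm_smul, norm_smul, norm_absPow, Real.norm_of_nonneg hε.le, Real.norm_of_nonneg hC]
  gcongr

theorem hasFDerivAt_absPow (h : Exponents p r) (u : Lp ℝ (ENNReal.ofReal (r * p)) ν) :
    HasFDerivAt (absPow h) (p • powMul h u) u := by
  have hp := h.one_lt_p
  rw [hasFDerivAt_iff_isLittleO_nhds_zero, Asymptotics.isLittleO_iff]
  intro c hc
  set N := ‖u‖ ^ (p - 1)
  have hN : 0 ≤ N := by positivity
  -- Half of c pays for the term with ‖u‖^(p-1), and N + 1 avoids dividing by zero; the other half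
  -- pays for C‖v‖^p, since ‖v‖^(p-1) → 0.
  obtain ⟨C, hC, hb⟩ := norm_absPow_add_sub_le (ν := ν) h (ε := c / (2 * (N + 1))) (by positivity)
  have hlim : Tendsto (fun v : Lp ℝ (ENNReal.ofReal (r * p)) ν => C * ‖v‖ ^ (p - 1)) (𝓝 0)
      (𝓝 0) := by
    have h1 : Continuous fun v : Lp ℝ (ENNReal.ofReal (r * p)) ν => C * ‖v‖ ^ (p - 1) :=
      continuous_const.mul (continuous_norm.rpow_const fun _ => Or.inr (by linarith))
    have h2 := h1.tendsto 0
    rwa [norm_zero, Real.zero_rpow (by linarith), mul_zero] at h2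
  filter_upwards [hlim.eventually (gt_mem_nhds (half_pos hc))] with v hv
  refine (hb u v).trans ?_
  have e1 : c / (2 * (N + 1)) * (N * ‖v‖) ≤ c / 2 * ‖v‖ := by
    rw [← mul_assoc]
    refine mul_le_mul_of_nonneg_right ?_ (norm_nonneg _)
    rw [div_mul_eq_mul_div, div_le_div_iff₀ (by positivity) (by norm_num)]
    nlinarith
  have e2 : C * ‖v‖ ^ p ≤ c / 2 * ‖v‖ := by
    rcases eq_or_ne ‖v‖ 0 with h0 | h0
    · rw [h0, Real.zero_rpow (by linarith)]
      simp
    · have h1 : ‖v‖ ^ p = ‖v‖ ^ (p - 1) * ‖v‖ := by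
        rw [← Real.rpow_add_one h0, sub_add_cancel]
      rw [h1, ← mul_assoc]
      exact mul_le_mul_of_nonneg_right hv.le (norm_nonneg _)
  linarith

end Nemytskii

/-! ### The Brezis–Lieb mechanism. -/

section Defect

variable {X : Type*} [MeasurableSpace X] {ν : Measure X}

/-- The Brezis–Lieb argument: a sequence that tends to `0` almost everywhere and is dominated by a
small multiple of a bounded sequence plus a fixed function tends to `0` in `L^s`. -/
theorem tendsto_eLpNorm_of_defect {s : ℝ≥0∞} [Fact (1 ≤ s)] (hs : s ≠ ∞) {F V : ℕ → X → ℝ}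
    {G : X → ℝ} (hF : ∀ j, AEStronglyMeasurable (F j) ν) (hV : ∀ j, AEStronglyMeasurable (V j) ν)
    (hG : MemLp G s ν) {M : ℝ≥0} (hM : ∀ j, eLpNorm (V j) s ν ≤ M)
    (hlim : ∀ᵐ x ∂ν, Tendsto (fun j => F j x) atTop (𝓝 0))
    (h : ∀ ε : ℝ, 0 < ε → ∃ C : ℝ, ∀ j, ∀ᵐ x ∂ν, |F j x| ≤ ε * |V j x| + C * |G x|) :
    Tendsto (fun j => eLpNorm (F j) s ν) atTop (𝓝 0) := by
  have hs1 : 1 ≤ s := Fact.out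
  have hs0 : s ≠ 0 := (zero_lt_one.trans_le hs1).ne'
  have hsr : 0 < s.toReal := ENNReal.toReal_pos hs0 hs
  rw [ENNReal.tendsto_nhds_zero]
  intro δ hδ
  obtain ⟨δ', hδ'0, hδ'⟩ : ∃ δ' : ℝ≥0, 0 < δ' ∧ (δ' : ℝ≥0∞) ≤ δ := by
    rcases eq_or_ne δ ∞ with h | h
    · exact ⟨1, one_pos, by simp [h]⟩
    · exact ⟨δ.toNNReal, ENNReal.toNNReal_pos hδ.ne' h, (ENNReal.coe_toNNReal h).le⟩
  set ε : ℝ := δ' / (2 * (M + 1)) with hε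
  have hε0 : 0 < ε := by positivity
  obtain ⟨C, hC⟩ := h ε hε0
  -- The excess of |F j| over ε|V j| is dominated by the fixed function C|G|, so dominated
  -- convergence applies to it even though no fixed function is given that dominates F itself.
  set W : ℕ → X → ℝ := fun j x => max (|F j x| - ε * |V j x|) 0 with hW
  have hWm : ∀ j, AEStronglyMeasurable (W j) ν := fun j =>
    ((hF j).norm.sub ((hV j).norm.const_mul ε)).sup aestronglyMeasurable_const
  have hW0 : ∀ j x, 0 ≤ W j x := fun j x => le_max_right _ _
  have hWlim : Tendsto (fun j => eLpNorm (W j) s ν) atTop (𝓝 0) := by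
    have h1 : Tendsto (fun j => ∫⁻ x, ‖W j x‖ₑ ^ s.toReal ∂ν) atTop (𝓝 (∫⁻ _, 0 ∂ν)) := by
      refine tendsto_lintegral_of_dominated_convergence' (fun x => ‖C * |G x|‖ₑ ^ s.toReal)
        (fun j => (hWm j).enorm.pow_const _) ?_ ?_ ?_
      · intro j
        filter_upwards [hC j] with x hx
        refine ENNReal.rpow_le_rpow ?_ hsr.le
        rw [Real.enorm_of_nonneg (hW0 j x), ← ofReal_norm]
        refine ENNReal.ofReal_le_ofReal (max_le ?_ (norm_nonneg _))
        exact le_trans (by linarith) (le_abs_self _)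
      · exact (lintegral_rpow_enorm_lt_top_of_eLpNorm_lt_top hs0 hs
          (hG.norm.const_mul C).2).ne
      · filter_upwards [hlim] with x hx
        have h2 : Tendsto (fun j => W j x) atTop (𝓝 0) := by
          have h3 : Tendsto (fun j => |F j x|) atTop (𝓝 0) := by simpa using hx.abs
          refine squeeze_zero (fun j => hW0 j x) (fun j => max_le ?_ (abs_nonneg _)) h3
          have : 0 ≤ ε * |V j x| := by positivity
          linarith
        have h3 := (ENNReal.continuous_rpow_const (y := s.toReal)).tendsto _ |>.comp h2.enorm
        simpa [Function.comp_def, hsr] using h3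
    rw [lintegral_zero] at h1
    have h2 := (ENNReal.continuous_rpow_const (y := 1 / s.toReal)).tendsto _ |>.comp h1
    rw [ENNReal.zero_rpow_of_pos (by positivity)] at h2
    refine h2.congr fun j => ?_
    rw [eLpNorm_eq_lintegral_rpow_enorm_toReal hs0 hs]
    rfl
  have hδ2 : (0 : ℝ≥0∞) < (δ' / 2 : ℝ≥0) := by
    exact ENNReal.coe_pos.2 (half_pos hδ'0)
  filter_upwards [(ENNReal.tendsto_nhds_zero.1 hWlim) _ hδ2] with j hj
  have h1 : eLpNorm (F j) s ν ≤ eLpNorm (W j) s ν + eLpNorm (ε • V j) s ν := by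
    have h2 := eLpNorm_add_le (hWm j) ((hV j).norm.const_smul ε) hs1
    have h3 : eLpNorm (F j) s ν ≤ eLpNorm (W j + ε • fun x => ‖V j x‖) s ν := by
      refine eLpNorm_mono fun x => ?_
      simp only [Pi.add_apply, Pi.smul_apply, smul_eq_mul, Real.norm_eq_abs]
      refine le_trans ?_ (le_abs_self _)
      have := le_max_left (|F j x| - ε * |V j x|) 0
      simp only [hW]
      linarith
    refine h3.trans (h2.trans ?_)
    rw [eLpNorm_const_smul, eLpNorm_const_smul, eLpNorm_norm]
  refine h1.trans (le_trans ?_ hδ')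
  rw [eLpNorm_const_smul, Real.enorm_of_nonneg hε0.le]
  calc _ ≤ ((δ' / 2 : ℝ≥0) : ℝ≥0∞) + ENNReal.ofReal ε * M := by gcongr; exact hM j
    _ ≤ ((δ' / 2 : ℝ≥0) : ℝ≥0∞) + ((δ' / 2 : ℝ≥0) : ℝ≥0∞) := by
      gcongr
      rw [← ENNReal.ofReal_coe_nnreal, ← ENNReal.ofReal_coe_nnreal, ← ENNReal.ofReal_mul hε0.le]
      refine ENNReal.ofReal_le_ofReal ?_
      rw [hε, NNReal.coe_div, NNReal.coe_ofNat, div_mul_eq_mul_div,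
        div_le_div_iff₀ (by positivity) (by norm_num)]
      have := hδ'0.le
      have h5 : (0 : ℝ) ≤ δ' := δ'.2
      nlinarith
    _ = δ' := by rw [← ENNReal.coe_add, add_halves]

/-- An L^r bound with r > 1 gives uniform integrability. Here it enters as |s| ≤ ε|s|^r + R, with |f
j|^r as the bounded sequence and a constant as the fixed function. -/
theorem tendsto_eLpNorm_one_of_bounded [IsFiniteMeasure ν] {r : ℝ} (hr : 1 < r) {f : ℕ → X → ℝ}
    (hf : ∀ j, AEStronglyMeasurable (f j) ν) {M : ℝ≥0}
    (hM : ∀ j, eLpNorm (f j) (ENNReal.ofReal r) ν ≤ M)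
    (hlim : ∀ᵐ x ∂ν, Tendsto (fun j => f j x) atTop (𝓝 0)) :
    Tendsto (fun j => eLpNorm (f j) 1 ν) atTop (𝓝 0) := by
  have : Fact ((1 : ℝ≥0∞) ≤ 1) := ⟨le_rfl⟩
  refine tendsto_eLpNorm_of_defect (V := fun j x => |f j x| ^ r) (G := fun _ => (1 : ℝ))
    (M := M ^ r) (by simp) hf
    (fun j => ((hf j).norm.aemeasurable.pow_const r).aestronglyMeasurable) (memLp_const 1) ?_ hlim ?_
  · intro j
    have h := eLpNorm_abs_rpow (r := 1) (by linarith : 0 < r) zero_le_one (f j) (ν := ν)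
    rw [ENNReal.ofReal_one, one_mul] at h
    rw [h, ENNReal.coe_rpow_of_nonneg _ (by linarith)]
    exact ENNReal.rpow_le_rpow (hM j) (by linarith)
  · intro ε hε
    obtain ⟨R, hR⟩ : ∃ R : ℝ, ∀ s : ℝ, |s| ≤ ε * |s| ^ r + R := by
      refine ⟨(1 / ε) ^ (1 / (r - 1)), fun s => ?_⟩
      have hr1 : 0 < r - 1 := by linarith
      rcases le_total |s| ((1 / ε) ^ (1 / (r - 1))) with h | h
      · exact h.trans (le_add_of_nonneg_left (by positivity))
      · refine le_trans ?_ (le_add_of_nonneg_right (by positivity))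
        have hs0 : 0 < |s| := lt_of_lt_of_le (by positivity) h
        have h2 := Real.rpow_le_rpow (by positivity) h hr1.le
        rw [← Real.rpow_mul (by positivity), one_div_mul_cancel hr1.ne', Real.rpow_one] at h2
        have h3 : |s| ^ r = |s| ^ (r - 1) * |s| := by
          rw [← Real.rpow_add_one hs0.ne', sub_add_cancel]
        rw [h3, ← mul_assoc]
        refine le_mul_of_one_le_left hs0.le ?_
        rw [one_div, inv_le_iff_one_le_mul₀ hε] at h2
        linarith
    refine ⟨R, fun j => Eventually.of_forall fun x => ?_⟩
    have := hR (f j x)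
    rwa [abs_one, mul_one, abs_of_nonneg (by positivity : 0 ≤ |f j x| ^ r)]

end Defect

/-! ### Weak continuity of the form along almost everywhere null sequences. -/

section Form

variable {X : Type*} [MeasurableSpace X] {ν : Measure X} [IsFiniteMeasure ν] {r : ℝ}
  {k : X → X → ℝ} [Fact (1 ≤ ENNReal.ofReal r)]

/-- Approximate g in L^r by a simple function bounded by A. Against that function the form costs at
most A K times the L¹ norm of f j, which tends to 0; the remainder is uniformly small by boundedness
of the form. No weak topology on L^r is involved. -/
theorem IsBoundedKernel.tendsto_form_of_ae (h : IsBoundedKernel k (ENNReal.ofReal r) ν)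
    (hr : 1 < r) {K : ℝ≥0} (hK : ∀ z, ∫⁻ w, ‖k z w‖ₑ ∂ν ≤ K)
    {f : ℕ → Lp ℝ (ENNReal.ofReal r) ν} {M : ℝ} (hM : ∀ j, ‖f j‖ ≤ M)
    (hlim : ∀ᵐ x ∂ν, Tendsto (fun j => f j x) atTop (𝓝 0)) (g : Lp ℝ (ENNReal.ofReal r) ν) :
    Tendsto (fun j => h.form (f j) g) atTop (𝓝 0) := by
  have hM0 : 0 ≤ M := (norm_nonneg _).trans (hM 0)
  have hL1 : Tendsto (fun j => eLpNorm (f j) 1 ν) atTop (𝓝 0) := by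
    refine tendsto_eLpNorm_one_of_bounded hr (M := M.toNNReal)
      (fun j => Lp.aestronglyMeasurable (f j)) (fun j => ?_) hlim
    rw [← Lp.enorm_def, ← ofReal_norm]
    exact ENNReal.ofReal_le_ofReal (hM j)
  rw [Metric.tendsto_atTop]
  intro ε hε
  obtain ⟨B, hB0, hB⟩ : ∃ B : ℝ, 0 ≤ B ∧ ∀ f g, ‖h.form f g‖ ≤ B * ‖f‖ * ‖g‖ :=
    ⟨_, norm_nonneg h.form, h.form.le_opNorm₂⟩
  obtain ⟨φ, hφ, hφL⟩ := (Lp.memLp g).exists_simpleFunc_eLpNorm_sub_lt ENNReal.ofReal_ne_top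
    (ε := ENNReal.ofReal (ε / (2 * (B * M + 1)))) (by
      have : 0 < ε / (2 * (B * M + 1)) := by positivity
      simpa using this)
  set g' : Lp ℝ (ENNReal.ofReal r) ν := hφL.toLp with hg'
  have hgg' : ‖g - g'‖ ≤ ε / (2 * (B * M + 1)) := by
    rw [Lp.norm_def]
    refine ENNReal.toReal_le_of_le_ofReal (by positivity) ?_
    refine le_trans (le_of_eq (eLpNorm_congr_ae ?_)) hφ.le
    filter_upwards [Lp.coeFn_sub g g', hφL.coeFn_toLp] with x h1 h2
    rw [h1, Pi.sub_apply, Pi.sub_apply, h2]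
  obtain ⟨A₀, hA₀⟩ := φ.exists_forall_norm_le
  set A := max A₀ 0
  have hA0 : 0 ≤ A := le_max_right _ _
  have hA : ∀ x, ‖φ x‖ ≤ A := fun x => (hA₀ x).trans (le_max_left _ _)
  have hbd : ∀ j, ‖h.form (f j) g'‖ₑ ≤ eLpNorm (f j) 1 ν * (ENNReal.ofReal A * K) := by
    intro j
    rw [h.form_apply]
    refine (enorm_integral_le_lintegral_enorm _).trans ?_
    rw [lintegral_prod _ (h.integrable (f j) g').1.enorm,
      eLpNorm_one_eq_lintegral_enorm,
      ← lintegral_mul_const' _ _ (ENNReal.mul_ne_top ENNReal.ofReal_ne_top ENNReal.coe_ne_top)]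
    refine lintegral_mono fun z => ?_
    calc ∫⁻ w, ‖f j z * g' w * k z w‖ₑ ∂ν
        ≤ ∫⁻ w, ‖f j z‖ₑ * ENNReal.ofReal A * ‖k z w‖ₑ ∂ν := by
          refine lintegral_mono_ae ?_
          filter_upwards [hφL.coeFn_toLp] with w hw
          rw [enorm_mul, enorm_mul, hw]
          gcongr
          rw [← ofReal_norm]
          exact ENNReal.ofReal_le_ofReal (hA w)
      _ = ‖f j z‖ₑ * ENNReal.ofReal A * ∫⁻ w, ‖k z w‖ₑ ∂ν := by
          rw [lintegral_const_mul' _ _ (ENNReal.mul_ne_top enorm_ne_top ENNReal.ofReal_ne_top)]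
      _ ≤ _ := by
          rw [mul_assoc]
          gcongr
          exact hK z
  have hlim' : Tendsto (fun j => h.form (f j) g') atTop (𝓝 0) := by
    rw [tendsto_zero_iff_enorm_tendsto_zero]
    have h1 : Tendsto (fun j => eLpNorm (f j) 1 ν * (ENNReal.ofReal A * K)) atTop (𝓝 0) := by
      have := ENNReal.Tendsto.mul_const hL1
        (b := ENNReal.ofReal A * K) (Or.inr (ENNReal.mul_ne_top ENNReal.ofReal_ne_top
          ENNReal.coe_ne_top))
      rwa [zero_mul] at this
    exact tendsto_of_tendsto_of_tendsto_of_le_of_le tendsto_const_nhds h1 (fun _ => zero_le) hbd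
  obtain ⟨N, hN⟩ := Metric.tendsto_atTop.1 hlim' (ε / 2) (half_pos hε)
  refine ⟨N, fun j hj => ?_⟩
  have h1 := hN j hj
  rw [dist_zero_right] at h1 ⊢
  have h2 : h.form (f j) g = h.form (f j) (g - g') + h.form (f j) g' := by
    rw [map_sub]
    ring
  have h3 : ‖h.form (f j) (g - g')‖ ≤ ε / 2 := by
    calc ‖h.form (f j) (g - g')‖ ≤ B * ‖f j‖ * ‖g - g'‖ := hB _ _
      _ ≤ B * M * (ε / (2 * (B * M + 1))) := by
        gcongr
        exact hM j
      _ ≤ ε / 2 := by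
        rw [mul_div_assoc', div_le_div_iff₀ (by positivity) (by norm_num)]
        have : 0 ≤ B * M := by positivity
        nlinarith
  rw [h2]
  refine (norm_add_le _ _).trans_lt ?_
  linarith

end Form

/-! ### Brezis–Lieb splitting in L^r. -/

section PowerConvergence

variable {X : Type*} [MeasurableSpace X] {ν : Measure X} {p r : ℝ}

theorem tendsto_zero_of_tendsto_eLpNorm {s : ℝ≥0∞} [Fact (1 ≤ s)] {f : ℕ → Lp ℝ s ν}
    {F : ℕ → X → ℝ} (hF : ∀ j, f j =ᵐ[ν] F j)
    (h : Tendsto (fun j => eLpNorm (F j) s ν) atTop (𝓝 0)) : Tendsto f atTop (𝓝 0) := by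
  rw [tendsto_zero_iff_norm_tendsto_zero]
  have h1 := (ENNReal.tendsto_toReal ENNReal.zero_ne_top).comp h
  rw [ENNReal.toReal_zero] at h1
  refine h1.congr fun j => ?_
  rw [Lp.norm_def, eLpNorm_congr_ae (hF j)]
  rfl

theorem eLpNorm_absPow_le (h : Exponents p r) {v : Lp ℝ (ENNReal.ofReal (r * p)) ν} {M : ℝ≥0}
    (hM : ‖v‖ ≤ M) : eLpNorm (fun x => |v x| ^ p) (ENNReal.ofReal r) ν ≤ (M ^ p : ℝ≥0) := by
  have hp := h.one_lt_p
  rw [eLpNorm_abs_rpow (by linarith) (by linarith [h.one_lt_r]),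
    ENNReal.coe_rpow_of_nonneg _ (by linarith)]
  refine ENNReal.rpow_le_rpow ?_ (by linarith)
  rw [← ENNReal.ofReal_toReal (Lp.eLpNorm_ne_top v), ← Lp.norm_def, ← ENNReal.ofReal_coe_nnreal]
  exact ENNReal.ofReal_le_ofReal hM

variable [Fact (1 ≤ ENNReal.ofReal r)]

/-- The Brezis–Lieb lemma for `u ↦ |u|^p` from `L^{r p}` to `L^r`. -/
theorem tendsto_absPow_add_sub (h : Exponents p r) {v : ℕ → Lp ℝ (ENNReal.ofReal (r * p)) ν}
    (u : Lp ℝ (ENNReal.ofReal (r * p)) ν) {M : ℝ≥0} (hM : ∀ j, ‖v j‖ ≤ M)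
    (hlim : ∀ᵐ x ∂ν, Tendsto (fun j => v j x) atTop (𝓝 0)) :
    Tendsto (fun j => absPow h (v j + u) - absPow h (v j) - absPow h u) atTop (𝓝 0) := by
  have hp := h.one_lt_p
  have hr := h.one_lt_r
  refine tendsto_zero_of_tendsto_eLpNorm
    (F := fun j x => |v j x + u x| ^ p - |v j x| ^ p - |u x| ^ p) (fun j => ?_) ?_
  · filter_upwards [Lp.coeFn_sub (absPow h (v j + u) - absPow h (v j)) (absPow h u),
      Lp.coeFn_sub (absPow h (v j + u)) (absPow h (v j)), Lp.coeFn_add (v j) u,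
      coeFn_absPow h (v j + u), coeFn_absPow h (v j), coeFn_absPow h u] with x h1 h2 h3 h4 h5 h6
    rw [h1, Pi.sub_apply, h2, Pi.sub_apply, h4, h5, h6, h3, Pi.add_apply]
  have hvm : ∀ j, AEStronglyMeasurable (v j) ν := fun j => Lp.aestronglyMeasurable _
  have hum : AEStronglyMeasurable u ν := Lp.aestronglyMeasurable _
  have hpow : ∀ f : X → ℝ, AEStronglyMeasurable f ν → AEStronglyMeasurable (fun x => |f x| ^ p) ν :=
    fun f hf => (hf.norm.aemeasurable.pow_const p).aestronglyMeasurable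
  refine tendsto_eLpNorm_of_defect ENNReal.ofReal_ne_top (V := fun j x => |v j x| ^ p)
    (G := fun x => |u x| ^ p) (M := M ^ p)
    (fun j => ((hpow _ ((hvm j).add hum)).sub (hpow _ (hvm j))).sub (hpow _ hum))
    (fun j => hpow _ (hvm j)) (memLp_abs_rpow (by linarith) (by linarith) (Lp.memLp u))
    (fun j => eLpNorm_absPow_le h (hM j)) ?_ ?_
  · filter_upwards [hlim] with x hx
    have hc : Continuous fun s : ℝ => |s + u x| ^ p - |s| ^ p - |u x| ^ p := by
      have h1 : Continuous fun s : ℝ => |s + u x| ^ p :=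
        (continuous_id.add continuous_const).abs.rpow_const fun _ => Or.inr (by linarith)
      have h2 : Continuous fun s : ℝ => |s| ^ p :=
        continuous_abs.rpow_const fun _ => Or.inr (by linarith)
      exact (h1.sub h2).sub continuous_const
    have h3 := (hc.tendsto 0).comp hx
    rwa [zero_add, abs_zero, Real.zero_rpow (by linarith), sub_zero, sub_self] at h3
  · intro ε hε
    obtain ⟨C, hC⟩ := brezis_lieb_defect_le hp hε
    refine ⟨C, fun j => Eventually.of_forall fun x => ?_⟩
    rw [abs_of_nonneg (by positivity : 0 ≤ |v j x| ^ p),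
      abs_of_nonneg (by positivity : 0 ≤ |u x| ^ p)]
    exact hC _ _

theorem tendsto_powMul_add [Fact (1 ≤ ENNReal.ofReal (r * p))] (h : Exponents p r)
    {v : ℕ → Lp ℝ (ENNReal.ofReal (r * p)) ν}
    (u : Lp ℝ (ENNReal.ofReal (r * p)) ν) {M : ℝ≥0} (hM : ∀ j, ‖v j‖ ≤ M)
    (hlim : ∀ᵐ x ∂ν, Tendsto (fun j => v j x) atTop (𝓝 0)) :
    Tendsto (fun j => powMul h (v j + u) u - absPow h u) atTop (𝓝 0) := by
  have hp := h.one_lt_p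
  have hr := h.one_lt_r
  refine tendsto_zero_of_tendsto_eLpNorm
    (F := fun j x => |v j x + u x| ^ (p - 2) * (v j x + u x) * u x - |u x| ^ p) (fun j => ?_) ?_
  · filter_upwards [Lp.coeFn_sub (powMul h (v j + u) u) (absPow h u), Lp.coeFn_add (v j) u,
      coeFn_powMul h (v j + u) u, coeFn_absPow h u] with x h1 h2 h3 h4
    rw [h1, Pi.sub_apply, h3, h4, h2, Pi.add_apply]
  have hvm : ∀ j, AEStronglyMeasurable (v j) ν := fun j => Lp.aestronglyMeasurable _
  have hum : AEStronglyMeasurable u ν := Lp.aestronglyMeasurable _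
  have hpow : ∀ (f : X → ℝ) (s : ℝ), AEStronglyMeasurable f ν →
      AEStronglyMeasurable (fun x => |f x| ^ s) ν :=
    fun f s hf => (hf.norm.aemeasurable.pow_const s).aestronglyMeasurable
  refine tendsto_eLpNorm_of_defect ENNReal.ofReal_ne_top (V := fun j x => |v j x| ^ p)
    (G := fun x => |u x| ^ p) (M := M ^ p)
    (fun j => (((hpow _ (p - 2) ((hvm j).add hum)).mul ((hvm j).add hum)).mul hum).sub
      (hpow _ p hum))
    (fun j => hpow _ p (hvm j)) (memLp_abs_rpow (by linarith) (by linarith) (Lp.memLp u))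
    (fun j => eLpNorm_absPow_le h (hM j)) ?_ ?_
  · filter_upwards [hlim] with x hx
    -- The exponent p - 2 may be negative, so continuity at s = 0 is available only where u x ≠ 0;
    -- elsewhere the whole expression vanishes.
    rcases eq_or_ne (u x) 0 with hu | hu
    · simp only [hu, mul_zero, abs_zero, Real.zero_rpow (by linarith : p ≠ 0), sub_zero]
      exact tendsto_const_nhds
    have hc : ContinuousAt (fun s : ℝ => |s + u x| ^ (p - 2) * (s + u x) * u x - |u x| ^ p) 0 := by
      have h1 : ContinuousAt (fun s : ℝ => |s + u x| ^ (p - 2)) 0 :=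
        (continuousAt_id.add continuousAt_const).abs.rpow_const (Or.inl (by simpa using hu))
      exact ((h1.mul (by fun_prop)).mul continuousAt_const).sub continuousAt_const
    have h3 := hc.tendsto.comp hx
    have h4 : |0 + u x| ^ (p - 2) * (0 + u x) * u x - |u x| ^ p = 0 := by
      have hu' := (abs_pos.2 hu).ne'
      rw [zero_add, mul_assoc, ← abs_mul_abs_self (u x), ← mul_assoc, ← Real.rpow_add_one hu',
        ← Real.rpow_add_one hu', sub_eq_zero]
      congr 1
      ring
    rwa [h4] at h3
  · intro ε hε
    obtain ⟨C, hC⟩ := rpow_sub_two_mul_defect_le hp hε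
    refine ⟨C, fun j => Eventually.of_forall fun x => ?_⟩
    rw [abs_of_nonneg (by positivity : 0 ≤ |v j x| ^ p),
      abs_of_nonneg (by positivity : 0 ≤ |u x| ^ p)]
    exact hC _ _

end PowerConvergence

/-! ### The abstract energy and boundedness of Palais–Smale sequences. -/

section Model

variable {X : Type*} [MeasurableSpace X] {ν : Measure X} [IsFiniteMeasure ν] {p r : ℝ}
  {k : X → X → ℝ} [Fact (1 ≤ ENNReal.ofReal (r * p))] [Fact (1 ≤ ENNReal.ofReal r)]
  {H : Type*} [NormedAddCommGroup H] [InnerProductSpace ℝ H]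

/-- The form `∫∫ |u(z)|^p k(z, w) |u(w)|^p`, pulled back to `H` by `T`. -/
def choquardForm (h : Exponents p r) (hk : IsBoundedKernel k (ENNReal.ofReal r) ν)
    (T : H →L[ℝ] Lp ℝ (ENNReal.ofReal (r * p)) ν) (u : H) : ℝ :=
  hk.form (absPow h (T u)) (absPow h (T u))

/-- The energy `½ ‖u‖² - (λ / 2) |u|₂² - (1 / 2p) D(u)`. -/
def modelEnergy (h : Exponents p r) (hk : IsBoundedKernel k (ENNReal.ofReal r) ν)
    (T : H →L[ℝ] Lp ℝ (ENNReal.ofReal (r * p)) ν) (T₂ : H →L[ℝ] Lp ℝ 2 ν) (lam : ℝ) (u : H) : ℝ :=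
  1 / 2 * ‖u‖ ^ 2 - lam / 2 * ‖T₂ u‖ ^ 2 - 1 / (2 * p) * choquardForm h hk T u

variable (h : Exponents p r) (hk : IsBoundedKernel k (ENNReal.ofReal r) ν)
    (T : H →L[ℝ] Lp ℝ (ENNReal.ofReal (r * p)) ν) (T₂ : H →L[ℝ] Lp ℝ 2 ν) (lam : ℝ)

/-- Symmetry of the kernel makes the two terms of the product rule equal, and the resulting factor
2p cancels 1/(2p). -/
theorem fderiv_modelEnergy (hsymm : ∀ z w, k z w = k w z) (u v : H) :
    fderiv ℝ (modelEnergy h hk T T₂ lam) u v = inner ℝ u v - lam * inner ℝ (T₂ u) (T₂ v) -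
      hk.form (absPow h (T u)) (powMul h (T u) (T v)) := by
  have hp := h.one_lt_p
  have h1 : HasFDerivAt (fun u : H => ‖u‖ ^ 2) (2 • innerSL ℝ u) u :=
    (hasStrictFDerivAt_norm_sq u).hasFDerivAt
  have h2 : HasFDerivAt (fun u : H => ‖T₂ u‖ ^ 2) ((2 • innerSL ℝ (T₂ u)).comp T₂) u :=
    (hasStrictFDerivAt_norm_sq (T₂ u)).hasFDerivAt.comp u T₂.hasFDerivAt
  have h3 : HasFDerivAt (fun u : H => absPow h (T u)) ((p • powMul h (T u)).comp T) u :=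
    (hasFDerivAt_absPow h (T u)).comp u T.hasFDerivAt
  have h4 := hk.form.hasFDerivAt_of_bilinear h3 h3
  have h5 := ((h1.const_mul (1 / 2)).sub (h2.const_mul (lam / 2))).sub (h4.const_mul (1 / (2 * p)))
  have h6 : fderiv ℝ (modelEnergy h hk T T₂ lam) u = _ := h5.fderiv
  rw [h6]
  simp [hk.form_comm hsymm (powMul h (T u) (T v))]
  field_simp
  ring

theorem choquardForm_nonneg (hk0 : ∀ z w, 0 ≤ k z w) (u : H) : 0 ≤ choquardForm h hk T u := by
  rw [choquardForm, hk.form_apply]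
  refine integral_nonneg_of_ae ?_
  have h1 := Measure.quasiMeasurePreserving_fst (μ := ν) (ν := ν) |>.ae (coeFn_absPow h (T u))
  have h2 := Measure.quasiMeasurePreserving_snd (μ := ν) (ν := ν) |>.ae (coeFn_absPow h (T u))
  filter_upwards [h1, h2] with a h1 h2
  rw [Pi.zero_apply, h1, h2]
  have := hk0 a.1 a.2
  positivity

theorem sq_le_rpow_add {q : ℝ} (hq : 2 < q) {ε : ℝ} (hε : 0 < ε) :
    ∃ C : ℝ, 0 ≤ C ∧ ∀ s : ℝ, s ^ 2 ≤ ε * |s| ^ q + C * |s| := by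
  refine ⟨(1 / ε) ^ (1 / (q - 2)), by positivity, fun s => ?_⟩
  have hq2 : 0 < q - 2 := by linarith
  rw [← sq_abs]
  rcases le_total |s| ((1 / ε) ^ (1 / (q - 2))) with h | h
  · refine le_trans ?_ (le_add_of_nonneg_left (by positivity))
    rw [sq]
    exact mul_le_mul_of_nonneg_right h (abs_nonneg _)
  · refine le_trans ?_ (le_add_of_nonneg_right (by positivity))
    have hs0 : 0 < |s| := lt_of_lt_of_le (by positivity) h
    have h2 := Real.rpow_le_rpow (by positivity) h hq2.le
    rw [← Real.rpow_mul (by positivity), one_div_mul_cancel hq2.ne', Real.rpow_one] at h2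
    have h3 : |s| ^ q = |s| ^ (q - 2) * |s| ^ 2 := by
      rw [← Real.rpow_natCast, ← Real.rpow_add hs0]
      congr 1
      push_cast
      ring
    rw [h3, ← mul_assoc]
    refine le_mul_of_one_le_left (by positivity) ?_
    rw [one_div, inv_le_iff_one_le_mul₀ hε] at h2
    linarith

theorem integrable_of_Lp {s : ℝ≥0∞} (hs : 1 ≤ s) (f : Lp ℝ s ν) : Integrable f ν :=
  (Lp.memLp f).integrable hs

omit [Fact (1 ≤ ENNReal.ofReal r)] in
-- On the unit sphere, integrate s² ≤ ε'|s|^q + C|s| with ε' = ε/(‖T‖^q + 1), the L^q norm being at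
-- most ‖T‖. Both sides of the claim are homogeneous of degree 2, so scaling finishes the proof.
theorem norm_sq_le_of_interpolation (hq : 2 < r * p) (hT : ∀ u, T₂ u =ᵐ[ν] T u) {ε : ℝ}
    (hε : 0 < ε) :
    ∃ C : ℝ, 0 ≤ C ∧ ∀ u, ‖T₂ u‖ ^ 2 ≤ ε * ‖u‖ ^ 2 + C * (‖u‖ * ∫ x, |T u x| ∂ν) := by
  set q := r * p with hqdef
  have hq1 : (1 : ℝ≥0∞) ≤ ENNReal.ofReal q := Fact.out
  obtain ⟨C, hC, hCs⟩ := sq_le_rpow_add hq (ε := ε / (‖T‖ ^ q + 1)) (by positivity)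
  refine ⟨C, hC, ?_⟩
  have hunit : ∀ u : H, ‖u‖ = 1 → ‖T₂ u‖ ^ 2 ≤ ε + C * ∫ x, |T u x| ∂ν := by
    intro u hu
    have e1 : ‖T₂ u‖ ^ 2 = ∫ x, T u x ^ 2 ∂ν := by
      rw [← real_inner_self_eq_norm_sq, L2.inner_def]
      refine integral_congr_ae ?_
      filter_upwards [hT u] with x hx
      rw [real_inner_self_eq_norm_sq, Real.norm_eq_abs, sq_abs, hx]
    have e2 : ∫ x, |T u x| ^ q ∂ν = ‖T u‖ ^ q := by
      have h1 := (Lp.memLp (T u)).eLpNorm_eq_integral_rpow_norm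
        (by simpa using by linarith) ENNReal.ofReal_ne_top
      rw [ENNReal.toReal_ofReal (by linarith)] at h1
      rw [Lp.norm_def, h1, ENNReal.toReal_ofReal (by positivity), ← Real.rpow_mul (by positivity),
        inv_mul_cancel₀ (by linarith), Real.rpow_one]
      rfl
    have i1 : Integrable (fun x => |T u x| ^ q) ν := by
      have h1 := (Lp.memLp (T u)).integrable_norm_rpow
        (by simpa using by linarith) ENNReal.ofReal_ne_top
      rwa [ENNReal.toReal_ofReal (by linarith)] at h1
    have i2 : Integrable (fun x => |T u x|) ν := (integrable_of_Lp hq1 (T u)).abs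
    have i3 : Integrable (fun x => T u x ^ 2) ν :=
      ((Lp.memLp (T u)).mono_exponent (p := 2) (by
        rw [show (2 : ℝ≥0∞) = ENNReal.ofReal 2 by simp]
        exact ENNReal.ofReal_le_ofReal hq.le)).integrable_sq
    rw [e1]
    calc ∫ x, T u x ^ 2 ∂ν ≤ ∫ x, (ε / (‖T‖ ^ q + 1) * |T u x| ^ q + C * |T u x|) ∂ν :=
          integral_mono i3 ((i1.const_mul _).add (i2.const_mul _)) fun x => hCs (T u x)
      _ = ε / (‖T‖ ^ q + 1) * ‖T u‖ ^ q + C * ∫ x, |T u x| ∂ν := by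
          rw [integral_add (i1.const_mul _) (i2.const_mul _), integral_const_mul,
            integral_const_mul, e2]
      _ ≤ ε + C * ∫ x, |T u x| ∂ν := by
          gcongr
          have h1 : ‖T u‖ ^ q ≤ ‖T‖ ^ q := by
            refine Real.rpow_le_rpow (norm_nonneg _) ?_ (by linarith)
            simpa [hu] using T.le_opNorm u
          have h2 : 0 ≤ ‖T‖ ^ q := by positivity
          rw [div_mul_eq_mul_div, div_le_iff₀ (by positivity)]
          nlinarith
  intro u
  rcases eq_or_ne u 0 with hu | hu
  · simp [hu]
  have hu' : ‖u‖ ≠ 0 := norm_ne_zero_iff.2 hu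
  have h1 := hunit (‖u‖⁻¹ • u) (by rw [norm_smul, norm_inv, norm_norm, inv_mul_cancel₀ hu'])
  have e3 : ∫ x, |T (‖u‖⁻¹ • u) x| ∂ν = ‖u‖⁻¹ * ∫ x, |T u x| ∂ν := by
    rw [← integral_const_mul]
    refine integral_congr_ae ?_
    rw [map_smul]
    filter_upwards [Lp.coeFn_smul ‖u‖⁻¹ (T u)] with x hx
    rw [hx, Pi.smul_apply, smul_eq_mul, abs_mul, abs_of_nonneg (inv_nonneg.2 (norm_nonneg u))]
  rw [e3, map_smul, norm_smul, norm_inv, norm_norm, mul_pow] at h1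
  have h2 := mul_le_mul_of_nonneg_left h1 (sq_nonneg ‖u‖)
  calc ‖T₂ u‖ ^ 2 = ‖u‖ ^ 2 * (‖u‖⁻¹ ^ 2 * ‖T₂ u‖ ^ 2) := by field_simp
    _ ≤ _ := h2
    _ = _ := by field_simp

theorem fderiv_modelEnergy_self (hsymm : ∀ z w, k z w = k w z) (u : H) :
    fderiv ℝ (modelEnergy h hk T T₂ lam) u u = ‖u‖ ^ 2 - lam * ‖T₂ u‖ ^ 2 -
      choquardForm h hk T u := by
  rw [fderiv_modelEnergy h hk T T₂ lam hsymm, powMul_self, real_inner_self_eq_norm_sq,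
    real_inner_self_eq_norm_sq]
  rfl

/-- With x = ‖u j‖, the combination J - J'(u)u/2 = θD bounds D by K₀(1 + x). Hence the L¹ norm is
O((1 + x)^(1/(2p))), at most O(√(1 + x)), and by interpolation λ|u|₂² ≤ x²/2 + O(x√(1 + x)).
Inserted in J'(u)u = x² - λ|u|₂² - D, this leaves x²/2 on the left against terms of order at most
3/2 in x. -/
theorem palaisSmale_bounded (hsymm : ∀ z w, k z w = k w z) (hk0 : ∀ z w, 0 ≤ k z w)
    (hq : 2 < r * p) (hT : ∀ u, T₂ u =ᵐ[ν] T u) (hlam : 0 < lam) {A : ℝ} (hA : 0 ≤ A)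
    (hlow : ∀ u, ∫ x, |T u x| ∂ν ≤ A * choquardForm h hk T u ^ (1 / (2 * p))) {c : ℝ} {u : ℕ → H}
    (hu : IsPalaisSmaleSeq (modelEnergy h hk T T₂ lam) c u) : ∃ M : ℝ, ∀ j, ‖u j‖ ≤ M := by
  have hp := h.one_lt_p
  obtain ⟨c₀, hc₀⟩ := hu.1.bddAbove_range
  obtain ⟨a, ha⟩ := hu.2.bddAbove_range
  have hJ : ∀ j, modelEnergy h hk T T₂ lam (u j) ≤ c₀ := fun j => hc₀ ⟨j, rfl⟩
  have hJ' : ∀ j, ‖fderiv ℝ (modelEnergy h hk T T₂ lam) (u j)‖ ≤ a := fun j => ha ⟨j, rfl⟩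
  have ha0 : 0 ≤ a := (norm_nonneg _).trans (hJ' 0)
  set θ : ℝ := 1 / 2 - 1 / (2 * p) with hθ
  have hθ0 : 0 < θ := by
    rw [hθ, sub_pos]
    exact one_div_lt_one_div_of_lt (by norm_num) (by linarith)
  obtain ⟨C, hC, hCb⟩ := norm_sq_le_of_interpolation T T₂ hq hT (ε := 1 / (2 * lam))
    (by positivity)
  set K₀ : ℝ := (|c₀| + a) / θ with hK₀
  have hK₀0 : 0 ≤ K₀ := by positivity
  set K₁ : ℝ := lam * C * A * K₀ ^ (1 / (2 * p))
  have hK₁0 : 0 ≤ K₁ := by positivity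
  refine ⟨(2 + 2 * (a + K₀ + K₁)) ^ 2, fun j => ?_⟩
  set x := ‖u j‖ with hx
  have hx0 : 0 ≤ x := norm_nonneg _
  set D := choquardForm h hk T (u j) with hD
  have hD0 : 0 ≤ D := choquardForm_nonneg h hk T hk0 (u j)
  have hder : |x ^ 2 - lam * ‖T₂ (u j)‖ ^ 2 - D| ≤ a * x := by
    rw [← fderiv_modelEnergy_self h hk T T₂ lam hsymm, ← Real.norm_eq_abs]
    exact ((fderiv ℝ (modelEnergy h hk T T₂ lam) (u j)).le_opNorm (u j)).trans
      (mul_le_mul_of_nonneg_right (hJ' j) hx0)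
  have hder' := abs_le.1 hder
  have hDle : D ≤ K₀ * (1 + x) := by
    have h1 := hJ j
    rw [modelEnergy, ← hx, ← hD] at h1
    have h2 : θ * D ≤ |c₀| + a * x := by
      have h3 := le_abs_self c₀
      have h4 : 0 ≤ a * x := by positivity
      rw [hθ]
      nlinarith
    have h4 : 0 ≤ |c₀| * x := by positivity
    rw [hK₀, div_mul_eq_mul_div, le_div_iff₀ hθ0]
    nlinarith
  -- In terms of y all bounds are polynomial: the left side has degree 4 and the right side degree
  -- at most 3. The exponent 1/(2p) is relaxed to 1/2, which is allowed since 1 + x ≥ 1.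
  set y := √(1 + x) with hy
  have hy1 : 1 ≤ y := Real.one_le_sqrt.2 (by linarith)
  have hyx : y ^ 2 = 1 + x := Real.sq_sqrt (by linarith)
  have hL1 : ∫ z, |T (u j) z| ∂ν ≤ A * (K₀ ^ (1 / (2 * p)) * y) := by
    refine (hlow (u j)).trans (mul_le_mul_of_nonneg_left ?_ hA)
    calc D ^ (1 / (2 * p)) ≤ (K₀ * (1 + x)) ^ (1 / (2 * p)) :=
          Real.rpow_le_rpow hD0 hDle (by positivity)
      _ = K₀ ^ (1 / (2 * p)) * (1 + x) ^ (1 / (2 * p)) := Real.mul_rpow hK₀0 (by linarith)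
      _ ≤ K₀ ^ (1 / (2 * p)) * y := by
          gcongr
          rw [hy, Real.sqrt_eq_rpow]
          refine Real.rpow_le_rpow_of_exponent_le (by linarith) ?_
          exact one_div_le_one_div_of_le (by norm_num) (by linarith)
  have hT2 : lam * ‖T₂ (u j)‖ ^ 2 ≤ x ^ 2 / 2 + K₁ * (x * y) := by
    calc lam * ‖T₂ (u j)‖ ^ 2
        ≤ lam * (1 / (2 * lam) * x ^ 2 + C * (x * ∫ z, |T (u j) z| ∂ν)) :=
          mul_le_mul_of_nonneg_left (hCb (u j)) hlam.le
      _ ≤ lam * (1 / (2 * lam) * x ^ 2 + C * (x * (A * (K₀ ^ (1 / (2 * p)) * y)))) := by gcongr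
      _ = _ := by
          simp only [K₁]
          field_simp
  have hmain : x ^ 2 / 2 ≤ a * x + K₀ * (1 + x) + K₁ * (x * y) := by linarith [hder'.2]
  have hxy : x = y ^ 2 - 1 := by linarith
  have hfin : y ≤ 2 + 2 * (a + K₀ + K₁) := by
    by_contra! hcon
    have hy3 : y ^ 2 ≤ y ^ 3 := by nlinarith [sq_nonneg y]
    have h1 : a * x ≤ a * y ^ 3 := by gcongr; linarith
    have h2 : K₀ * (1 + x) ≤ K₀ * y ^ 3 := by gcongr; linarith
    have h3 : K₁ * (x * y) ≤ K₁ * y ^ 3 := by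
      gcongr
      nlinarith
    have h4 : x ^ 2 = y ^ 4 - 2 * y ^ 2 + 1 := by rw [hxy]; ring
    have h6 : (2 + 2 * (a + K₀ + K₁)) * y ^ 3 < y * y ^ 3 :=
      mul_lt_mul_of_pos_right hcon (by positivity)
    linarith
  calc x ≤ y ^ 2 := by linarith
    _ ≤ _ := by gcongr

end Model

/-! ### Strong convergence below the threshold. -/

section Model

variable {X : Type*} [MeasurableSpace X] {ν : Measure X} [IsFiniteMeasure ν] {p r : ℝ}
  {k : X → X → ℝ} [Fact (1 ≤ ENNReal.ofReal (r * p))] [Fact (1 ≤ ENNReal.ofReal r)]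
  {H : Type*} [NormedAddCommGroup H] [InnerProductSpace ℝ H]

theorem tendsto_bilin_zero_of_bounded {E F : Type*} [NormedAddCommGroup E] [NormedSpace ℝ E]
    [NormedAddCommGroup F] [NormedSpace ℝ F] (B : E →L[ℝ] F →L[ℝ] ℝ) {f : ℕ → E} {g : ℕ → F}
    {M : ℝ} (hf : ∀ j, ‖f j‖ ≤ M) (hg : Tendsto g atTop (𝓝 0)) :
    Tendsto (fun j => B (f j) (g j)) atTop (𝓝 0) := by
  have h1 : Tendsto (fun j => ‖B‖ * M * ‖g j‖) atTop (𝓝 0) := by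
    simpa using hg.norm.const_mul (‖B‖ * M)
  refine squeeze_zero_norm (fun j => (B.le_opNorm₂ (f j) (g j)).trans ?_) h1
  gcongr
  exact hf j

theorem le_of_mul_rpow_le {S b p : ℝ} (hp : 1 < p) (hS : 0 ≤ S) (hb : 0 < b)
    (h : S * b ^ (1 / p) ≤ b) : S ^ (p / (p - 1)) ≤ b := by
  have hp1 : 0 < p - 1 := by linarith
  have hp0 : 0 < p := by linarith
  have h1 : S ≤ b ^ (1 - 1 / p) := by
    rw [Real.rpow_sub hb, Real.rpow_one, le_div_iff₀ (by positivity)]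
    exact h
  calc S ^ (p / (p - 1)) ≤ (b ^ (1 - 1 / p)) ^ (p / (p - 1)) :=
        Real.rpow_le_rpow hS h1 (by positivity)
    _ = b := by
        rw [← Real.rpow_mul hb.le, show (1 - 1 / p) * (p / (p - 1)) = 1 by field_simp,
          Real.rpow_one]

variable (h : Exponents p r) (hk : IsBoundedKernel k (ENNReal.ofReal r) ν)
    (T : H →L[ℝ] Lp ℝ (ENNReal.ofReal (r * p)) ν) (T₂ : H →L[ℝ] Lp ℝ 2 ν) (lam : ℝ)

/-- With F, G, E for |v_j|^p, |u₀|^p and the Brezis–Lieb error, D(v_j + u₀) is the form evaluated at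
F + G + E. The terms with E vanish because E → 0 in norm, and the cross term of F with G vanishes by
`IsBoundedKernel.tendsto_form_of_ae`. -/
theorem tendsto_zero_of_palaisSmale (hsymm : ∀ z w, k z w = k w z) (hk0 : ∀ z w, 0 ≤ k z w)
    {K : ℝ≥0} (hK : ∀ z, ∫⁻ w, ‖k z w‖ₑ ∂ν ≤ K) {S : ℝ} (hS0 : 0 ≤ S)
    (hS : ∀ u, S * choquardForm h hk T u ^ (1 / p) ≤ ‖u‖ ^ 2) {c : ℝ}
    (hc : c < (1 / 2 - 1 / (2 * p)) * S ^ (p / (p - 1))) {v : ℕ → H} {u₀ : H}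
    (hu : IsPalaisSmaleSeq (modelEnergy h hk T T₂ lam) c fun j => v j + u₀) {M : ℝ≥0}
    (hM : ∀ j, ‖v j‖ ≤ M) (hweak : Tendsto (fun j => inner ℝ (v j) u₀) atTop (𝓝 0))
    (hT₂ : Tendsto (fun j => T₂ (v j)) atTop (𝓝 0))
    (hlim : ∀ᵐ x ∂ν, Tendsto (fun j => T (v j) x) atTop (𝓝 0)) :
    Tendsto v atTop (𝓝 0) := by
  have hp := h.one_lt_p
  have hr := h.one_lt_r
  set θ : ℝ := 1 / 2 - 1 / (2 * p) with hθ
  have hθ0 : 0 < θ := by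
    rw [hθ, sub_pos]
    exact one_div_lt_one_div_of_lt (by norm_num) (by linarith)
  set J := modelEnergy h hk T T₂ lam with hJ
  set B := hk.form with hB
  set D := choquardForm h hk T with hD
  have hTM : ∀ j, ‖T (v j)‖ ≤ ↑(‖T‖₊ * M) := fun j => by
    rw [NNReal.coe_mul, coe_nnnorm]
    exact (T.le_opNorm _).trans (by gcongr; exact hM j)
  set F : ℕ → Lp ℝ (ENNReal.ofReal r) ν := fun j => absPow h (T (v j)) with hF
  set G := absPow h (T u₀) with hG
  set E : ℕ → Lp ℝ (ENNReal.ofReal r) ν := fun j => absPow h (T (v j) + T u₀) - F j - G with hE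
  set R : ℕ → Lp ℝ (ENNReal.ofReal r) ν := fun j => powMul h (T (v j) + T u₀) (T u₀) - G with hR
  have hE0 : Tendsto E atTop (𝓝 0) := tendsto_absPow_add_sub h (T u₀) hTM hlim
  have hR0 : Tendsto R atTop (𝓝 0) := tendsto_powMul_add h (T u₀) hTM hlim
  have hA : ∀ j, absPow h (T (v j + u₀)) = F j + G + E j := fun j => by
    rw [map_add]
    simp only [hE]
    abel
  have hP : ∀ j, powMul h (T (v j + u₀)) (T u₀) = G + R j := fun j => by
    rw [map_add]
    simp only [hR]
    abel
  have hFM : ∀ j, ‖F j‖ ≤ (‖T‖ * M) ^ p := fun j => by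
    rw [hF, norm_absPow]
    exact Real.rpow_le_rpow (norm_nonneg _) (hTM j) (by linarith)
  have hFlim : ∀ᵐ x ∂ν, Tendsto (fun j => F j x) atTop (𝓝 0) := by
    have h1 : ∀ᵐ x ∂ν, ∀ j, F j x = |T (v j) x| ^ p := ae_all_iff.2 fun j => coeFn_absPow h (T (v j))
    filter_upwards [h1, hlim] with x h1 h2
    simp only [h1]
    have h3 := h2.abs.rpow_const (p := p) (Or.inr (by linarith))
    rwa [abs_zero, Real.zero_rpow (by linarith)] at h3
  have hFg : ∀ g, Tendsto (fun j => B (F j) g) atTop (𝓝 0) :=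
    hk.tendsto_form_of_ae hr hK hFM hFlim
  have hgE : ∀ g, Tendsto (fun j => B g (E j)) atTop (𝓝 0) := fun g => by
    simpa [Function.comp_def] using ((B g).continuous.tendsto 0).comp hE0
  have hFE : Tendsto (fun j => B (F j) (E j)) atTop (𝓝 0) :=
    tendsto_bilin_zero_of_bounded B hFM hE0
  have hFR : Tendsto (fun j => B (F j) (R j)) atTop (𝓝 0) :=
    tendsto_bilin_zero_of_bounded B hFM hR0
  have hER : Tendsto (fun j => B (E j) (R j)) atTop (𝓝 0) := by
    simpa [Function.comp_def] using
      (B.isBoundedBilinearMap.continuous.tendsto (0, 0)).comp (hE0.prodMk_nhds hR0)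
  have hEE : Tendsto (fun j => B (E j) (E j)) atTop (𝓝 0) := by
    simpa [Function.comp_def] using
      (B.isBoundedBilinearMap.continuous.tendsto (0, 0)).comp (hE0.prodMk_nhds hE0)
  have hgR : ∀ g, Tendsto (fun j => B g (R j)) atTop (𝓝 0) := fun g => by
    simpa [Function.comp_def] using ((B g).continuous.tendsto 0).comp hR0
  have hcomm : ∀ f g, B f g = B g f := hk.form_comm hsymm
  have hD0 : D u₀ = B G G := rfl
  have hDv : ∀ j, D (v j) = B (F j) (F j) := fun j => rfl
  -- the Brezis–Lieb splitting of the Choquard term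
  have hDsplit : Tendsto (fun j => D (v j + u₀) - D (v j)) atTop (𝓝 (D u₀)) := by
    have h1 : ∀ j, D (v j + u₀) - D (v j) =
        2 * B (F j) G + 2 * B (F j) (E j) + 2 * B G (E j) + B (E j) (E j) + B G G := fun j => by
      rw [hDv, hD, choquardForm, hA, ← hB]
      simp only [map_add, add_apply]
      rw [hcomm G (F j), hcomm (E j) (F j), hcomm (E j) G]
      ring
    simp only [h1, hD0]
    have h2 := (((((hFg G).const_mul 2).add (hFE.const_mul 2)).add ((hgE G).const_mul 2)).add
      hEE).add_const (B G G)
    simpa using h2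
  have hcross : Tendsto (fun j => B (absPow h (T (v j + u₀))) (powMul h (T (v j + u₀)) (T u₀)))
      atTop (𝓝 (D u₀)) := by
    have h1 : ∀ j, B (absPow h (T (v j + u₀))) (powMul h (T (v j + u₀)) (T u₀)) =
        B (F j) G + B (F j) (R j) + B G (R j) + B G (E j) + B (E j) (R j) + B G G := fun j => by
      rw [hA, hP]
      simp only [map_add, add_apply]
      rw [hcomm (E j) G]
      ring
    simp only [h1, hD0]
    have h2 := (((((hFg G).add hFR).add (hgR G)).add (hgE G)).add hER).add_const (B G G)
    simpa using h2
  have hT₂u : Tendsto (fun j => T₂ (v j + u₀)) atTop (𝓝 (T₂ u₀)) := by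
    simpa using hT₂.add_const (T₂ u₀)
  have hnorm : Tendsto (fun j => ‖v j + u₀‖ ^ 2 - ‖v j‖ ^ 2) atTop (𝓝 (‖u₀‖ ^ 2)) := by
    have h1 : ∀ j, ‖v j + u₀‖ ^ 2 - ‖v j‖ ^ 2 = 2 * inner ℝ (v j) u₀ + ‖u₀‖ ^ 2 := fun j => by
      rw [norm_add_sq_real]
      ring
    simp only [h1]
    simpa using (hweak.const_mul 2).add_const (‖u₀‖ ^ 2)
  -- the weak limit is a critical point in its own direction
  have hcrit : ‖u₀‖ ^ 2 - lam * ‖T₂ u₀‖ ^ 2 - D u₀ = 0 := by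
    have h1 : Tendsto (fun j => fderiv ℝ J (v j + u₀) u₀) atTop (𝓝 0) := by
      refine squeeze_zero_norm (fun j => (fderiv ℝ J (v j + u₀)).le_opNorm u₀) ?_
      simpa using hu.2.mul_const ‖u₀‖
    have h2 : Tendsto (fun j => fderiv ℝ J (v j + u₀) u₀) atTop
        (𝓝 (‖u₀‖ ^ 2 - lam * ‖T₂ u₀‖ ^ 2 - D u₀)) := by
      simp only [hJ, fderiv_modelEnergy h hk T T₂ lam hsymm]
      refine (Tendsto.sub ?_ (Tendsto.const_mul lam ?_)).sub hcross
      · simp only [inner_add_left, real_inner_self_eq_norm_sq]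
        simpa using hweak.add_const (‖u₀‖ ^ 2)
      · rw [← real_inner_self_eq_norm_sq]
        exact hT₂u.inner tendsto_const_nhds
    exact tendsto_nhds_unique h2 h1
  have hself : Tendsto (fun j => ‖v j + u₀‖ ^ 2 - lam * ‖T₂ (v j + u₀)‖ ^ 2 - D (v j + u₀))
      atTop (𝓝 0) := by
    have h1 : Tendsto (fun j => ‖fderiv ℝ J (v j + u₀)‖ * (M + ‖u₀‖)) atTop (𝓝 0) := by
      simpa using hu.2.mul_const (M + ‖u₀‖)
    refine squeeze_zero_norm (fun j => ?_) h1
    rw [← fderiv_modelEnergy_self h hk T T₂ lam hsymm]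
    refine ((fderiv ℝ J (v j + u₀)).le_opNorm (v j + u₀)).trans ?_
    gcongr
    exact (norm_add_le _ _).trans (by gcongr; exact hM j)
  have hvD : Tendsto (fun j => ‖v j‖ ^ 2 - D (v j)) atTop (𝓝 0) := by
    have h1 := ((hself.sub hnorm).add ((hT₂u.norm.pow 2).const_mul lam)).add hDsplit
    have e1 : 0 - ‖u₀‖ ^ 2 + lam * ‖T₂ u₀‖ ^ 2 + D u₀ = 0 := by linarith
    rw [e1] at h1
    exact h1.congr fun j => by ring
  -- Subtracting half of J'(u)u from J leaves θ D along the sequence, so D(v_j + u₀) → c/θ, and the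
  -- splitting removes D(u₀).
  set b := c / θ - D u₀ with hb
  have hDb : Tendsto (fun j => D (v j)) atTop (𝓝 b) := by
    have h1 : Tendsto (fun j => D (v j + u₀)) atTop (𝓝 (c / θ)) := by
      have h2 := (hu.1.sub (hself.const_mul (1 / 2))).div_const θ
      rw [mul_zero, sub_zero] at h2
      refine h2.congr fun j => ?_
      rw [div_eq_iff hθ0.ne', hJ, modelEnergy, ← hD, hθ]
      ring
    exact (h1.sub hDsplit).congr fun j => by ring
  have hvb : Tendsto (fun j => ‖v j‖ ^ 2) atTop (𝓝 b) := by
    simpa using hvD.add hDb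
  have hb0 : 0 ≤ b := ge_of_tendsto' hvb fun j => by positivity
  have hSb : S * b ^ (1 / p) ≤ b :=
    le_of_tendsto_of_tendsto' ((hDb.rpow_const (Or.inr (by positivity))).const_mul S) hvb
      fun j => hS (v j)
  -- A nonzero b would be at least S^(p/(p-1)), while D(u₀) ≥ 0 gives b ≤ c/θ, which is strictly
  -- smaller.
  have hbz : b = 0 := by
    by_contra hne
    have h1 := le_of_mul_rpow_le hp hS0 (lt_of_le_of_ne hb0 (Ne.symm hne)) hSb
    have h2 : 0 ≤ D u₀ := choquardForm_nonneg h hk T hk0 u₀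
    have h3 : c / θ < S ^ (p / (p - 1)) := by
      rw [div_lt_iff₀ hθ0]
      linarith
    linarith
  rw [hbz] at hvb
  rw [tendsto_zero_iff_norm_tendsto_zero]
  have h1 := hvb.sqrt
  rw [Real.sqrt_zero] at h1
  exact h1.congr fun j => Real.sqrt_sq (norm_nonneg _)

/-- The Palais–Smale condition for the energy below the threshold given by the best constant. -/
theorem palaisSmaleCondition_modelEnergy (hsymm : ∀ z w, k z w = k w z) (hk0 : ∀ z w, 0 ≤ k z w)
    {K : ℝ≥0} (hK : ∀ z, ∫⁻ w, ‖k z w‖ₑ ∂ν ≤ K) (hq : 2 < r * p)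
    (hT : ∀ u, T₂ u =ᵐ[ν] T u) (hlam : 0 < lam) {A : ℝ} (hA : 0 ≤ A)
    (hlow : ∀ u, ∫ x, |T u x| ∂ν ≤ A * choquardForm h hk T u ^ (1 / (2 * p)))
    (hweak : ∀ u : ℕ → H, (∃ M : ℝ, ∀ j, ‖u j‖ ≤ M) → ∃ (u₀ : H) (φ : ℕ → ℕ), StrictMono φ ∧
      ∀ v, Tendsto (fun j => inner ℝ (u (φ j)) v) atTop (𝓝 (inner ℝ u₀ v)))
    (hcomp : ∀ v : ℕ → H, (∃ M : ℝ, ∀ j, ‖v j‖ ≤ M) →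
      (∀ w, Tendsto (fun j => inner ℝ (v j) w) atTop (𝓝 0)) →
      Tendsto (fun j => T₂ (v j)) atTop (𝓝 0))
    {S : ℝ} (hS0 : 0 ≤ S) (hS : ∀ u, S * choquardForm h hk T u ^ (1 / p) ≤ ‖u‖ ^ 2) {c : ℝ}
    (hc : c < (1 / 2 - 1 / (2 * p)) * S ^ (p / (p - 1))) :
    PalaisSmaleCondition (modelEnergy h hk T T₂ lam) c := by
  intro u hu
  obtain ⟨M, hM⟩ := palaisSmale_bounded h hk T T₂ lam hsymm hk0 hq hT hlam hA hlow hu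
  obtain ⟨u₀, φ, hφ, hw⟩ := hweak u ⟨M, hM⟩
  set v : ℕ → H := fun j => u (φ j) - u₀ with hv
  have hvM : ∀ j, ‖v j‖ ≤ M + ‖u₀‖ := fun j =>
    (norm_sub_le _ _).trans (by gcongr; exact hM _)
  have hvw : ∀ w, Tendsto (fun j => inner ℝ (v j) w) atTop (𝓝 0) := fun w => by
    simp only [hv, inner_sub_left]
    simpa using (hw w).sub_const (inner ℝ u₀ w)
  have hv2 := hcomp v ⟨_, hvM⟩ hvw
  -- L² convergence supplies the almost everywhere convergence, on a further subsequence, that the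
  -- Brezis–Lieb argument needs.
  obtain ⟨ψ, hψ, hae⟩ := (tendstoInMeasure_of_tendsto_Lp hv2).exists_seq_tendsto_ae
  refine ⟨u₀, φ ∘ ψ, hφ.comp hψ, ?_⟩
  have hlim : ∀ᵐ x ∂ν, Tendsto (fun j => T (v (ψ j)) x) atTop (𝓝 0) := by
    have h1 : ∀ᵐ x ∂ν, ∀ j, T₂ (v (ψ j)) x = T (v (ψ j)) x := ae_all_iff.2 fun j => hT _
    filter_upwards [hae, h1, Lp.coeFn_zero ℝ 2 ν] with x h2 h1 h0
    rw [h0, Pi.zero_apply] at h2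
    exact h2.congr h1
  have hseq : (fun j => v (ψ j) + u₀) = fun j => u (φ (ψ j)) := by
    funext j
    simp [hv]
  have hM0 : 0 ≤ M + ‖u₀‖ := (norm_nonneg _).trans (hvM 0)
  have hmono := (hφ.comp hψ).tendsto_atTop
  have h1 := tendsto_zero_of_palaisSmale h hk T T₂ lam hsymm hk0 hK hS0 hS hc
    (v := fun j => v (ψ j)) (u₀ := u₀) (M := ⟨M + ‖u₀‖, hM0⟩)
    (by rw [hseq]; exact ⟨hu.1.comp hmono, hu.2.comp hmono⟩) (fun j => hvM _)
    ((hvw u₀).comp hψ.tendsto_atTop) (hv2.comp hψ.tendsto_atTop) hlim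
  have h2 := h1.add_const u₀
  rw [zero_add, hseq] at h2
  exact h2

end Model

/-! ### Embeddings of the energy space into Lebesgue spaces. -/

section Embedding

variable {m n : ℕ} {γ : ℝ≥0} {Ω : TopologicalSpace.Opens (Space m n)}

theorem Test.memLp (φ : Test γ Ω) (s : ℝ≥0∞) :
    MemLp φ.fn s (volume.restrict (Ω : Set (Space m n))) :=
  φ.contDiff.continuous.memLp_of_hasCompactSupport φ.hasCompactSupport

theorem Test.contDiff_one (φ : Test γ Ω) : ContDiff ℝ 1 φ.fn :=
  φ.contDiff.of_le (by exact_mod_cast le_top)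

theorem Test.tsupport_subset (φ : Test γ Ω) : tsupport φ.fn ⊆ Ω :=
  TestFunction.tsupport_subset' φ

theorem Test.fn_eq_zero (φ : Test γ Ω) {z : Space m n} (hz : z ∉ Ω) : φ.fn z = 0 :=
  image_eq_zero_of_notMem_tsupport fun h => hz (φ.tsupport_subset h)

theorem Test.grad_eq_zero (φ : Test γ Ω) {z : Space m n} (hz : z ∉ Ω) : grad γ φ.fn z = 0 := by
  rw [grad_eq φ.differentiable]
  have h : fderiv ℝ φ.fn z = 0 :=
    image_eq_zero_of_notMem_tsupport fun h => hz (φ.tsupport_subset (tsupport_fderiv_subset ℝ h))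
  simp [h]

theorem Test.lintegral_fn_rpow (φ : Test γ Ω) {s : ℝ} (hs : 0 < s) :
    ∫⁻ z in (Ω : Set (Space m n)), ‖φ.fn z‖ₑ ^ s = ∫⁻ z, ‖φ.fn z‖ₑ ^ s := by
  refine setLIntegral_eq_of_support_subset fun z hz => ?_
  by_contra h
  exact hz (by simp [φ.fn_eq_zero h, hs])

theorem Test.lintegral_grad_sq (φ : Test γ Ω) :
    ∫⁻ z, ‖grad γ φ.fn z‖ₑ ^ 2 = ENNReal.ofReal (‖φ‖ ^ 2) := by
  have h1 : ∫⁻ z, ‖grad γ φ.fn z‖ₑ ^ 2 =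
      ∫⁻ z in (Ω : Set (Space m n)), ‖grad γ φ.fn z‖ₑ ^ 2 := by
    refine (setLIntegral_eq_of_support_subset fun z hz => ?_).symm
    by_contra h
    exact hz (by simp [φ.grad_eq_zero h])
  have h2 : ‖φ‖ ^ 2 = ∫ z in (Ω : Set (Space m n)), ‖grad γ φ.fn z‖ ^ 2 := by
    rw [← real_inner_self_eq_norm_sq]
    change ∫ z in (Ω : Set (Space m n)), inner ℝ (grad γ φ.fn z) (grad γ φ.fn z) = _
    simp only [real_inner_self_eq_norm_sq]
  rw [h1, h2, ofReal_integral_eq_lintegral_ofReal]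
  · refine lintegral_congr fun z => ?_
    rw [ENNReal.ofReal_pow (norm_nonneg _), ofReal_norm]
  · exact (φ.continuous_grad.memLp_of_hasCompactSupport
      φ.hasCompactSupport_grad (p := 2)).integrable_norm_pow (by norm_num)
  · exact Eventually.of_forall fun z => by positivity

/-- The inclusion `C_c^∞(Ω) → L^s(Ω)`. -/
def Test.toLp (γ : ℝ≥0) (Ω : TopologicalSpace.Opens (Space m n)) (s : ℝ≥0∞) [Fact (1 ≤ s)] :
    Test γ Ω →ₗ[ℝ] Lp ℝ s (volume.restrict (Ω : Set (Space m n))) where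
  toFun φ := (φ.memLp s).toLp
  map_add' φ ψ := by
    rw [← MemLp.toLp_add]
    rfl
  map_smul' c φ := by
    rw [RingHom.id_apply, ← MemLp.toLp_const_smul]
    rfl

theorem Test.coeFn_toLp (φ : Test γ Ω) (s : ℝ≥0∞) [Fact (1 ≤ s)] :
    Test.toLp γ Ω s φ =ᵐ[volume.restrict (Ω : Set (Space m n))] φ.fn :=
  (φ.memLp s).coeFn_toLp

/-- The canonical map `C_c^∞(Ω) → H_γ(Ω)`. -/
def Test.toH (γ : ℝ≥0) (Ω : TopologicalSpace.Opens (Space m n)) : Test γ Ω →ₗ[ℝ] H γ Ω :=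
  (UniformSpace.Completion.toComplL : Test γ Ω →L[ℝ] H γ Ω).toLinearMap

theorem Test.denseRange_toH : DenseRange (Test.toH γ Ω) :=
  UniformSpace.Completion.denseRange_coe

theorem Test.norm_toH (φ : Test γ Ω) : ‖Test.toH γ Ω φ‖ = ‖φ‖ :=
  UniformSpace.Completion.norm_coe φ

/-- The Sobolev inequality gives the top exponent, and Hölder on the finite measure space Ω gives
the lower ones, including the Poincaré inequality at s = 2. -/
theorem exists_norm_toLp_le (hm : 0 < m ∨ γ = 0) (hQ : 2 < homDim m n γ)
    (hΩ : Bornology.IsBounded (Ω : Set (Space m n))) {s : ℝ≥0∞} [Fact (1 ≤ s)]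
    (hs : s ≤ ENNReal.ofReal (sobExp m n γ)) :
    ∃ C : ℝ, ∀ φ : Test γ Ω, ‖Test.toLp γ Ω s φ‖ ≤ C * ‖Test.toH γ Ω φ‖ := by
  set ν := volume.restrict (Ω : Set (Space m n)) with hν
  have hfin : IsFiniteMeasure ν := ⟨by
    rw [hν, Measure.restrict_apply_univ]
    exact hΩ.measure_lt_top⟩
  set q := sobExp m n γ with hq
  have hq2 : 2 < q := two_lt_sobExp hQ
  obtain ⟨C, hC⟩ := sobolev (n := n) hm hQ
  have hsob : ∀ φ : Test γ Ω, eLpNorm φ.fn (ENNReal.ofReal q) ν ≤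
      ENNReal.ofReal (√C * ‖φ‖) := fun φ => by
    have h1 := hC φ.fn φ.contDiff_one φ.hasCompactSupport
    rw [φ.lintegral_grad_sq, ← φ.lintegral_fn_rpow (by linarith)] at h1
    rw [eLpNorm_eq_lintegral_rpow_enorm_toReal (by simpa using by linarith) ENNReal.ofReal_ne_top,
      ENNReal.toReal_ofReal (by linarith)]
    have h2 := ENNReal.rpow_le_rpow h1 (by norm_num : (0 : ℝ) ≤ 1 / 2)
    rw [← ENNReal.rpow_mul, show 2 / q * (1 / 2) = 1 / q by ring] at h2
    refine h2.trans (le_of_eq ?_)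
    rw [← ENNReal.ofReal_coe_nnreal, ← ENNReal.ofReal_mul (by positivity),
      ENNReal.ofReal_rpow_of_nonneg (by positivity) (by norm_num), ← Real.sqrt_eq_rpow,
      Real.sqrt_mul (by positivity), Real.sqrt_sq (norm_nonneg _)]
  set V := ν Set.univ ^ (1 / s.toReal - 1 / (ENNReal.ofReal q).toReal) with hV
  have hVt : V ≠ ∞ := by
    refine ENNReal.rpow_ne_top_of_nonneg ?_ (measure_ne_top _ _)
    have h1 : 0 < s.toReal :=
      ENNReal.toReal_pos (zero_lt_one.trans_le (Fact.out : 1 ≤ s)).ne'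
        (hs.trans_lt ENNReal.ofReal_lt_top).ne
    have h2 := ENNReal.toReal_mono ENNReal.ofReal_ne_top hs
    rw [sub_nonneg]
    exact one_div_le_one_div_of_le h1 h2
  refine ⟨√C * V.toReal, fun φ => ?_⟩
  rw [Test.norm_toH]
  change ‖(φ.memLp s).toLp‖ ≤ _
  rw [Lp.norm_toLp]
  refine ENNReal.toReal_le_of_le_ofReal (by positivity) ?_
  calc eLpNorm φ.fn s ν ≤ eLpNorm φ.fn (ENNReal.ofReal q) ν * V :=
        eLpNorm_le_eLpNorm_mul_rpow_measure_univ hs (φ.memLp s).aestronglyMeasurable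
    _ ≤ ENNReal.ofReal (√C * ‖φ‖) * V := by gcongr; exact hsob φ
    _ = ENNReal.ofReal (√C * V.toReal * ‖φ‖) := by
        rw [mul_right_comm, ENNReal.ofReal_mul (p := √C * ‖φ‖) (by positivity),
          ENNReal.ofReal_toReal hVt]

/-- The embedding `H_γ(Ω) → L^s(Ω)`, for `s` at most the Sobolev exponent. -/
def embed (γ : ℝ≥0) (Ω : TopologicalSpace.Opens (Space m n)) (s : ℝ≥0∞) [Fact (1 ≤ s)] :
    H γ Ω →L[ℝ] Lp ℝ s (volume.restrict (Ω : Set (Space m n))) :=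
  (Test.toLp γ Ω s).extendOfNorm (Test.toH γ Ω)

theorem embed_toH (hm : 0 < m ∨ γ = 0) (hQ : 2 < homDim m n γ)
    (hΩ : Bornology.IsBounded (Ω : Set (Space m n))) {s : ℝ≥0∞} [Fact (1 ≤ s)]
    (hs : s ≤ ENNReal.ofReal (sobExp m n γ)) (φ : Test γ Ω) :
    embed γ Ω s (Test.toH γ Ω φ) = Test.toLp γ Ω s φ :=
  LinearMap.extendOfNorm_eq Test.denseRange_toH (exists_norm_toLp_le hm hQ hΩ hs) φ

theorem exists_seq_toH_tendsto (u : H γ Ω) :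
    ∃ φ : ℕ → Test γ Ω, Tendsto (fun j => Test.toH γ Ω (φ j)) atTop (𝓝 u) := by
  obtain ⟨x, hx, hlim⟩ := mem_closure_iff_seq_limit.1 (Test.denseRange_toH (γ := γ) u)
  choose φ hφ using hx
  exact ⟨φ, by simpa only [hφ] using hlim⟩

/-- The embeddings agree on test functions; along an approximating sequence both converge in
measure, and such limits are unique. -/
theorem embed_ae_eq (hm : 0 < m ∨ γ = 0) (hQ : 2 < homDim m n γ)
    (hΩ : Bornology.IsBounded (Ω : Set (Space m n))) {s s' : ℝ≥0∞} [Fact (1 ≤ s)] [Fact (1 ≤ s')]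
    (hs : s ≤ ENNReal.ofReal (sobExp m n γ)) (hs' : s' ≤ ENNReal.ofReal (sobExp m n γ))
    (u : H γ Ω) :
    embed γ Ω s u =ᵐ[volume.restrict (Ω : Set (Space m n))] embed γ Ω s' u := by
  obtain ⟨φ, hφ⟩ := exists_seq_toH_tendsto u
  have h1 := tendstoInMeasure_of_tendsto_Lp (((embed γ Ω s).continuous.tendsto u).comp hφ)
  have h2 := tendstoInMeasure_of_tendsto_Lp (((embed γ Ω s').continuous.tendsto u).comp hφ)
  refine tendstoInMeasure_ae_unique h1 (h2.congr_left fun j => ?_)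
  simp only [Function.comp_apply]
  rw [embed_toH hm hQ hΩ hs, embed_toH hm hQ hΩ hs']
  exact ((φ j).coeFn_toLp s').trans ((φ j).coeFn_toLp s).symm

theorem two_le_ofReal_sobExp (hQ : 2 < homDim m n γ) :
    (2 : ℝ≥0∞) ≤ ENNReal.ofReal (sobExp m n γ) := by
  rw [show (2 : ℝ≥0∞) = ENNReal.ofReal 2 by simp]
  exact ENNReal.ofReal_le_ofReal (two_lt_sobExp hQ).le

/-- The extension to the completion has the expected values only for a uniformly continuous map. The
bounded operator `embed` provides this for `Test.fnL2`, so `toL2` is the intended extension. -/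
theorem toL2_eq_embed (hm : 0 < m ∨ γ = 0) (hQ : 2 < homDim m n γ)
    (hΩ : Bornology.IsBounded (Ω : Set (Space m n))) (u : H γ Ω) :
    u.toL2 = embed γ Ω 2 u := by
  have h2 := two_le_ofReal_sobExp hQ
  have hcoe : ∀ φ : Test γ Ω, Test.fnL2 φ = embed γ Ω 2 (φ : H γ Ω) := fun φ =>
    (embed_toH hm hQ hΩ h2 φ).symm
  have huc : UniformContinuous (Test.fnL2 : Test γ Ω → _) := by
    rw [show (Test.fnL2 : Test γ Ω → _) = embed γ Ω 2 ∘ ((↑) : Test γ Ω → H γ Ω) from funext hcoe]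
    exact (embed γ Ω 2).uniformContinuous.comp
      (UniformSpace.Completion.uniformContinuous_coe _)
  refine UniformSpace.Completion.induction_on (p := fun u : H γ Ω => u.toL2 = embed γ Ω 2 u) u ?_ ?_
  · exact isClosed_eq UniformSpace.Completion.continuous_extension (embed γ Ω 2).continuous
  · intro φ
    rw [H.toL2, UniformSpace.Completion.extension_coe huc, hcoe]

end Embedding

/-! ### Weak sequential compactness of bounded sets. -/

section WeakCompactness

variable {E : Type*} [NormedAddCommGroup E] [InnerProductSpace ℝ E] [CompleteSpace E]

theorem exists_weak_subseq [TopologicalSpace.SeparableSpace E] (u : ℕ → E)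
    (hu : ∃ M : ℝ, ∀ j, ‖u j‖ ≤ M) :
    ∃ (u₀ : E) (φ : ℕ → ℕ), StrictMono φ ∧
      ∀ v, Tendsto (fun j => inner ℝ (u (φ j)) v) atTop (𝓝 (inner ℝ u₀ v)) := by
  obtain ⟨M, hM⟩ := hu
  obtain ⟨a, -, φ, hφ, ha⟩ := WeakDual.isSeqCompact_closedBall ℝ E (0 : StrongDual ℝ E) M
    (x := fun j => StrongDual.toWeakDual (InnerProductSpace.toDual ℝ E (u j))) (fun j => by
      rw [Set.mem_preimage, mem_closedBall_zero_iff]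
      exact ((InnerProductSpace.toDual ℝ E).norm_map (u j)).le.trans (hM j))
  refine ⟨(InnerProductSpace.toDual ℝ E).symm (WeakDual.toStrongDual a), φ, hφ, fun v => ?_⟩
  rw [InnerProductSpace.toDual_symm_apply]
  exact ((WeakDual.eval_continuous v).tendsto a).comp ha

/-- Separability is inherited from L² through the isometric gradient map. It is what allows weak
limits to be extracted along sequences. -/
instance {m n : ℕ} {γ : ℝ≥0} {Ω : TopologicalSpace.Opens (Space m n)} :
    TopologicalSpace.SeparableSpace (H γ Ω) := by
  have h : Isometry (H.gradL2 : H γ Ω → _) :=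
    Test.isometry_gradL2.completion_extension
  have : Fact ((2 : ℝ≥0∞) ≠ ∞) := ⟨by norm_num⟩
  have : MeasurableSpace.CountablyGenerated (Space m n) :=
    MeasurableSpace.instCountablyGeneratedProd
  exact h.isEmbedding.separableSpace

end WeakCompactness

/-! ### Compactness of the embedding into L². -/

section Rellich

variable {m n : ℕ} {γ : ℝ≥0} {Ω : TopologicalSpace.Opens (Space m n)}

theorem Test.measurable_comp_slide (φ : Test γ Ω) (e : EuclideanSpace ℝ (Fin m)) (t : ℝ) :
    Measurable fun a : Space m n × Space m n => φ.fn (slide γ e t a.1 a.2) :=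
  φ.contDiff.continuous.measurable.comp (measurable_slide γ e t)

theorem Test.integrableOn_comp_slide (φ : Test γ Ω) (e : EuclideanSpace ℝ (Fin m)) (t : ℝ)
    (z : Space m n) :
    IntegrableOn (fun w => φ.fn (slide γ e t z w)) (Metric.ball 0 1) := by
  obtain ⟨C, hC⟩ := φ.hasCompactSupport.exists_bound_of_continuous φ.contDiff.continuous
  exact Measure.integrableOn_of_bounded (M := C) measure_ball_lt_top.ne
    ((φ.measurable_comp_slide e t).comp measurable_prodMk_left).aestronglyMeasurable
    (Eventually.of_forall fun w => hC _)

/-- The average of a test function over the slides of a point. -/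
def slideMean (γ : ℝ≥0) (Ω : TopologicalSpace.Opens (Space m n)) (e : EuclideanSpace ℝ (Fin m))
    (t : ℝ) (z : Space m n) : Test γ Ω →ₗ[ℝ] ℝ where
  toFun φ := ∫ w in Metric.ball 0 1, φ.fn (slide γ e t z w)
  map_add' φ ψ := integral_add (φ.integrableOn_comp_slide e t z) (ψ.integrableOn_comp_slide e t z)
  map_smul' c _ := integral_const_mul c _

theorem slideMean_apply (e : EuclideanSpace ℝ (Fin m)) (t : ℝ) (z : Space m n) (φ : Test γ Ω) :
    slideMean γ Ω e t z φ = ∫ w in Metric.ball 0 1, φ.fn (slide γ e t z w) := rfl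

theorem measurable_slideMean (e : EuclideanSpace ℝ (Fin m)) (t : ℝ) (φ : Test γ Ω) :
    Measurable fun z => slideMean γ Ω e t z φ :=
  ((φ.measurable_comp_slide e t).stronglyMeasurable.integral_prod_right).measurable

/-- For fixed t the mean at each point is a functional bounded by the L¹ norm, hence by the energy
norm, uniformly in z. Weakly null sequences thus have means that tend to 0 pointwise under a
constant bound. -/
theorem exists_norm_slideMean_le (hm : 0 < m ∨ γ = 0) (hQ : 2 < homDim m n γ)
    (hΩ : Bornology.IsBounded (Ω : Set (Space m n))) {e : EuclideanSpace ℝ (Fin m)}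
    (he : γ ≠ 0 → ‖e‖ = 1) {t : ℝ} (ht : 0 < t) :
    ∃ C : ℝ, ∀ (z : Space m n) (φ : Test γ Ω), ‖slideMean γ Ω e t z φ‖ ≤ C * ‖Test.toH γ Ω φ‖ := by
  have h12 : (1 : ℝ≥0∞) ≤ ENNReal.ofReal (sobExp m n γ) :=
    one_le_two.trans (two_le_ofReal_sobExp hQ)
  obtain ⟨C, hC⟩ := exists_norm_toLp_le (s := 1) hm hQ hΩ h12
  refine ⟨(t ^ homDim m n γ)⁻¹ * C, fun z φ => ?_⟩
  have h1 : ∫⁻ w, ‖φ.fn w‖ₑ = ENNReal.ofReal ‖Test.toLp γ Ω 1 φ‖ := by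
    have h2 := φ.lintegral_fn_rpow one_pos
    simp only [ENNReal.rpow_one] at h2
    rw [← h2, ← eLpNorm_one_eq_lintegral_enorm]
    change _ = ENNReal.ofReal ‖(φ.memLp 1).toLp‖
    rw [Lp.norm_toLp, ENNReal.ofReal_toReal (φ.memLp 1).eLpNorm_ne_top]
  have h3 : ‖slideMean γ Ω e t z φ‖ₑ ≤
      ENNReal.ofReal ((t ^ homDim m n γ)⁻¹ * (C * ‖Test.toH γ Ω φ‖)) := by
    calc ‖slideMean γ Ω e t z φ‖ₑ ≤ ∫⁻ w in Metric.ball 0 1, ‖φ.fn (slide γ e t z w)‖ₑ :=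
          enorm_integral_le_lintegral_enorm _
      _ ≤ ENNReal.ofReal (t ^ homDim m n γ)⁻¹ * ∫⁻ w, ‖φ.fn w‖ₑ :=
          lintegral_slide_le e he ht (φ.contDiff.continuous.measurable.enorm) z
      _ ≤ _ := by
          rw [h1, ENNReal.ofReal_mul (by positivity)]
          gcongr
          exact hC φ
  rw [← ofReal_norm] at h3
  have h4 : 0 ≤ C * ‖Test.toH γ Ω φ‖ := (norm_nonneg _).trans (hC φ)
  rw [mul_assoc]
  exact (ENNReal.ofReal_le_ofReal_iff (by positivity)).1 h3

/-- The difference is an integral over the unit ball of φ(slide) - φ; Cauchy–Schwarz and Tonelli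
reduce it to the bound for a single slide. The mean is not normalised, which explains the powers of
the volume of the ball. -/
theorem Test.lintegral_sub_slideMean_sq_le (φ : Test γ Ω) {e : EuclideanSpace ℝ (Fin m)}
    (he : ‖e‖ ≤ 1) {t : ℝ} (ht : 0 < t) :
    ∫⁻ z, ‖volume.real (Metric.ball (0 : Space m n) 1) * φ.fn z - slideMean γ Ω e t z φ‖ₑ ^ 2 ≤
      volume (Metric.ball (0 : Space m n) 1) ^ 2 * ENNReal.ofReal (40 * t ^ 2 * ‖φ‖ ^ 2) := by
  set B := Metric.ball (0 : Space m n) 1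
  have hm : Measurable fun a : Space m n × Space m n =>
      ‖φ.fn (slide γ e t a.1 a.2) - φ.fn a.1‖ₑ ^ 2 :=
    ((φ.measurable_comp_slide e t).sub
      (φ.contDiff.continuous.measurable.comp measurable_fst)).enorm.pow_const 2
  have hpt : ∀ z, ‖volume.real B * φ.fn z - slideMean γ Ω e t z φ‖ₑ ^ 2 ≤
      volume B * ∫⁻ w in B, ‖φ.fn (slide γ e t z w) - φ.fn z‖ₑ ^ 2 := fun z => by
    have h1 : slideMean γ Ω e t z φ - volume.real B * φ.fn z =
        ∫ w in B, (φ.fn (slide γ e t z w) - φ.fn z) := by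
      rw [integral_sub (φ.integrableOn_comp_slide e t z)
        (integrableOn_const measure_ball_lt_top.ne), setIntegral_const, slideMean_apply,
        smul_eq_mul]
    rw [← enorm_neg, neg_sub, h1]
    calc _ ≤ (∫⁻ w in B, ‖φ.fn (slide γ e t z w) - φ.fn z‖ₑ) ^ 2 := by
          gcongr
          exact enorm_integral_le_lintegral_enorm _
      _ ≤ _ := by
          have h2 := lintegral_sq_le (volume.restrict B)
            (g := fun w => ‖φ.fn (slide γ e t z w) - φ.fn z‖ₑ)
            ((((φ.measurable_comp_slide e t).comp measurable_prodMk_left).sub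
              measurable_const).enorm).aemeasurable
          rwa [Measure.restrict_apply_univ] at h2
  calc _ ≤ ∫⁻ z, volume B * ∫⁻ w in B, ‖φ.fn (slide γ e t z w) - φ.fn z‖ₑ ^ 2 :=
        lintegral_mono hpt
    _ = volume B * ∫⁻ w in B, (∫⁻ z, ‖φ.fn (slide γ e t z w) - φ.fn z‖ₑ ^ 2) := by
        rw [lintegral_const_mul _ hm.lintegral_prod_right', lintegral_lintegral_swap hm.aemeasurable]
    _ ≤ volume B * ∫⁻ _ in B, ENNReal.ofReal (40 * t ^ 2 * ‖φ‖ ^ 2) := by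
        refine mul_le_mul_right ?_ _
        refine setLIntegral_mono measurable_const fun w hw => ?_
        rw [ENNReal.ofReal_mul (by positivity), ← φ.lintegral_grad_sq]
        exact lintegral_slide_sub_sq_le γ e he ht φ.contDiff_one
          (by simpa [B] using (mem_ball_zero_iff.1 hw).le)
    _ = _ := by
        rw [setLIntegral_const]
        ring

/-- The embedding of `H_γ(Ω)` into `L^2(Ω)` maps weakly null sequences of test functions to null
sequences. -/
theorem tendsto_lintegral_sq_of_weak (hm : 0 < m ∨ γ = 0) (hQ : 2 < homDim m n γ)
    (hΩ : Bornology.IsBounded (Ω : Set (Space m n))) {φ : ℕ → Test γ Ω} {M : ℝ}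
    (hM : ∀ j, ‖φ j‖ ≤ M)
    (hweak : ∀ w, Tendsto (fun j => inner ℝ (Test.toH γ Ω (φ j)) w) atTop (𝓝 0)) :
    Tendsto (fun j => ∫⁻ z in (Ω : Set (Space m n)), ‖(φ j).fn z‖ₑ ^ 2) atTop (𝓝 0) := by
  obtain ⟨e, he, he'⟩ := exists_direction (γ := γ) hm
  have hM0 : 0 ≤ M := (norm_nonneg _).trans (hM 0)
  set B := Metric.ball (0 : Space m n) 1
  have hB0 : volume B ≠ 0 := (Metric.measure_ball_pos volume 0 one_pos).ne'
  have hBt : volume B ≠ ∞ := measure_ball_lt_top.ne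
  have hmean : ∀ t : ℝ, 0 < t → Tendsto (fun j => ∫⁻ z in (Ω : Set (Space m n)),
      ‖slideMean γ Ω e t z (φ j)‖ₑ ^ 2) atTop (𝓝 0) := by
    intro t ht
    obtain ⟨C, hC⟩ := exists_norm_slideMean_le hm hQ hΩ he' ht
    have hlim : ∀ z, Tendsto (fun j => slideMean γ Ω e t z (φ j)) atTop (𝓝 0) := fun z => by
      -- The mean extends to a bounded functional on the Hilbert space, so weak convergence applies
      -- to its Riesz representative.
      set L : H γ Ω →L[ℝ] ℝ := (slideMean γ Ω e t z).extendOfNorm (Test.toH γ Ω) with hL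
      refine (hweak ((InnerProductSpace.toDual ℝ (H γ Ω)).symm L)).congr fun j => ?_
      rw [real_inner_comm, InnerProductSpace.toDual_symm_apply, hL,
        LinearMap.extendOfNorm_eq Test.denseRange_toH ⟨C, hC z⟩]
    have h1 := tendsto_lintegral_of_dominated_convergence
      (μ := volume.restrict (Ω : Set (Space m n)))
      (F := fun j z => ‖slideMean γ Ω e t z (φ j)‖ₑ ^ 2) (f := fun _ => 0)
      (fun _ => ENNReal.ofReal (|C| * M) ^ 2)
      (fun j => ((measurable_slideMean e t (φ j)).enorm.pow_const 2))
      (fun j => Eventually.of_forall fun z => by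
        beta_reduce
        rw [← ofReal_norm]
        gcongr
        refine (hC z (φ j)).trans ?_
        rw [Test.norm_toH]
        gcongr
        · exact le_abs_self C
        · exact hM j)
      (by
        rw [lintegral_const, Measure.restrict_apply_univ]
        exact ENNReal.mul_ne_top (by finiteness) hΩ.measure_lt_top.ne)
      (Eventually.of_forall fun z => by
        have h2 := (hlim z).enorm
        simpa using ENNReal.Tendsto.pow (n := 2) h2)
    simpa using h1
  refine ENNReal.tendsto_nhds_zero.2 fun ε hε => ?_
  obtain ⟨δ, hδ0, hδ⟩ := ENNReal.lt_iff_exists_nnreal_btwn.1 hε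
  have hδ0' : 0 < (δ : ℝ) := by exact_mod_cast hδ0
  -- First t makes the error of the mean small uniformly in j, then j makes the mean itself small.
  -- Each contributes δ/4, doubled by the inequality for squares of sums.
  obtain ⟨t, ht, htδ⟩ : ∃ t : ℝ, 0 < t ∧ 40 * t ^ 2 * M ^ 2 ≤ δ / 4 := by
    refine ⟨√(δ / (160 * (M ^ 2 + 1))), by positivity, ?_⟩
    rw [Real.sq_sqrt (by positivity), mul_div_assoc', div_mul_eq_mul_div, div_le_iff₀ (by positivity)]
    nlinarith
  have hev := (ENNReal.tendsto_nhds_zero.1 (hmean t ht)) (volume B ^ 2 * ENNReal.ofReal (δ / 4))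
    (by
      refine pos_iff_ne_zero.2 (mul_ne_zero (pow_ne_zero 2 hB0) ?_)
      simpa using hδ0')
  filter_upwards [hev] with j hj
  refine le_trans ?_ hδ.le
  rw [← ENNReal.mul_le_mul_iff_right (pow_ne_zero 2 hB0) (ENNReal.pow_ne_top hBt)]
  have hm1 : Measurable (φ j).fn := (φ j).contDiff.continuous.measurable
  have hm2 := measurable_slideMean e t (φ j)
  have hme : Measurable fun z => ‖volume.real B * (φ j).fn z - slideMean γ Ω e t z (φ j)‖ₑ ^ 2 :=
    ((hm1.const_mul _).sub hm2).enorm.pow_const 2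
  calc volume B ^ 2 * ∫⁻ z in (Ω : Set (Space m n)), ‖(φ j).fn z‖ₑ ^ 2
      = ∫⁻ z in (Ω : Set (Space m n)), volume B ^ 2 * ‖(φ j).fn z‖ₑ ^ 2 :=
        (lintegral_const_mul _ (hm1.enorm.pow_const 2)).symm
    _ ≤ ∫⁻ z in (Ω : Set (Space m n)),
        (2 * ‖volume.real B * (φ j).fn z - slideMean γ Ω e t z (φ j)‖ₑ ^ 2 +
          2 * ‖slideMean γ Ω e t z (φ j)‖ₑ ^ 2) := by
        refine lintegral_mono fun z => ?_
        have h1 : volume B ^ 2 * ‖(φ j).fn z‖ₑ ^ 2 = ‖volume.real B * (φ j).fn z‖ₑ ^ 2 := by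
          rw [enorm_mul, Real.enorm_of_nonneg measureReal_nonneg, measureReal_def,
            ENNReal.ofReal_toReal hBt, mul_pow]
        rw [h1]
        simpa using enorm_add_sq_le (volume.real B * (φ j).fn z - slideMean γ Ω e t z (φ j))
          (slideMean γ Ω e t z (φ j))
    _ = 2 * (∫⁻ z in (Ω : Set (Space m n)),
          ‖volume.real B * (φ j).fn z - slideMean γ Ω e t z (φ j)‖ₑ ^ 2) +
        2 * ∫⁻ z in (Ω : Set (Space m n)), ‖slideMean γ Ω e t z (φ j)‖ₑ ^ 2 := by
        rw [lintegral_add_left (hme.const_mul 2), lintegral_const_mul _ hme,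
          lintegral_const_mul _ (hm2.enorm.pow_const 2)]
    _ ≤ 2 * (volume B ^ 2 * ENNReal.ofReal (δ / 4)) +
        2 * (volume B ^ 2 * ENNReal.ofReal (δ / 4)) := by
        gcongr 2 * ?_ + 2 * ?_
        refine (setLIntegral_le_lintegral _ _).trans
          (((φ j).lintegral_sub_slideMean_sq_le he ht).trans ?_)
        gcongr
        refine le_trans ?_ htδ
        gcongr
        exact hM j
    _ = volume B ^ 2 * δ := by
        rw [← ENNReal.ofReal_coe_nnreal (p := δ),
          show (δ : ℝ) = 4 * (δ / 4) by ring, ENNReal.ofReal_mul (by norm_num)]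
        norm_num
        ring

/-- The Rellich–Kondrachov theorem: weakly null sequences in `H_γ(Ω)` tend to `0` in `L^2(Ω)`. -/
theorem tendsto_embed_two_of_weak (hm : 0 < m ∨ γ = 0) (hQ : 2 < homDim m n γ)
    (hΩ : Bornology.IsBounded (Ω : Set (Space m n))) {v : ℕ → H γ Ω}
    (hM : ∃ M : ℝ, ∀ j, ‖v j‖ ≤ M)
    (hweak : ∀ w, Tendsto (fun j => inner ℝ (v j) w) atTop (𝓝 0)) :
    Tendsto (fun j => embed γ Ω 2 (v j)) atTop (𝓝 0) := by
  obtain ⟨M, hM⟩ := hM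
  have happ : ∀ j, ∃ φ : Test γ Ω, ‖v j - Test.toH γ Ω φ‖ < 1 / ((j : ℝ) + 1) := fun j => by
    obtain ⟨φ, hφ⟩ := Test.denseRange_toH.exists_dist_lt (v j) (by positivity : 0 < 1 / ((j : ℝ) + 1))
    exact ⟨φ, by rwa [← dist_eq_norm]⟩
  choose φ hφ using happ
  have hdiff : Tendsto (fun j => v j - Test.toH γ Ω (φ j)) atTop (𝓝 0) :=
    squeeze_zero_norm (fun j => (hφ j).le) tendsto_one_div_add_atTop_nhds_zero_nat
  have hφM : ∀ j, ‖φ j‖ ≤ M + 1 := fun j => by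
    rw [← Test.norm_toH]
    have h1 := norm_sub_norm_le (Test.toH γ Ω (φ j)) (v j)
    rw [norm_sub_rev] at h1
    have h2 : 1 / ((j : ℝ) + 1) ≤ 1 := by
      rw [div_le_one (by positivity)]
      linarith [(j.cast_nonneg : (0 : ℝ) ≤ j)]
    linarith [hM j, hφ j]
  have hφw : ∀ w, Tendsto (fun j => inner ℝ (Test.toH γ Ω (φ j)) w) atTop (𝓝 0) := fun w => by
    have h1 := (hweak w).sub (hdiff.inner (tendsto_const_nhds (x := w)))
    rw [inner_zero_left, sub_zero] at h1
    exact h1.congr fun j => by rw [inner_sub_left, sub_sub_cancel]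
  have h0 := tendsto_lintegral_sq_of_weak hm hQ hΩ hφM hφw
  have h1 : Tendsto (fun j => embed γ Ω 2 (Test.toH γ Ω (φ j))) atTop (𝓝 0) := by
    refine tendsto_zero_of_tendsto_eLpNorm (F := fun j => (φ j).fn) (fun j => ?_) ?_
    · rw [embed_toH hm hQ hΩ (two_le_ofReal_sobExp hQ)]
      exact (φ j).coeFn_toLp 2
    have h2 := (ENNReal.continuous_rpow_const (y := 1 / 2)).tendsto 0 |>.comp h0
    rw [ENNReal.zero_rpow_of_pos (by norm_num)] at h2
    refine h2.congr fun j => ?_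
    rw [eLpNorm_eq_lintegral_rpow_enorm_toReal (by norm_num) (by norm_num)]
    simp
  have h2 := ((embed γ Ω 2).continuous.tendsto 0).comp hdiff
  rw [map_zero] at h2
  have h3 := h2.add h1
  rw [add_zero] at h3
  exact h3.congr fun j => by simp

end Rellich

/-! ### Bounds for the kernel on a bounded domain. -/

section Instantiation

variable {m n : ℕ} {γ : ℝ≥0} {Ω : TopologicalSpace.Opens (Space m n)} {μ : ℝ}

theorem exists_setLIntegral_kern_le (hμ0 : 0 < μ) (hμ : μ < homDim m n γ)
    (hΩ : Bornology.IsBounded (Ω : Set (Space m n))) :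
    ∃ K : ℝ≥0, ∀ z : Space m n,
      ∫⁻ w in (Ω : Set (Space m n)), ‖kern γ μ (z - w)‖ₑ ≤ K := by
  obtain ⟨C, hC0, hC⟩ := lintegral_kern_near_le (m := m) (n := n) (γ := γ) hμ0 hμ
  set U : Set (Space m n) := {z | homNorm γ z < 1} with hU
  have hUm : MeasurableSet U := measurableSet_lt continuous_homNorm.measurable measurable_const
  have hΩt : volume (Ω : Set (Space m n)) ≠ ∞ := hΩ.measure_lt_top.ne
  have hpt : ∀ z : Space m n, ‖kern γ μ z‖ₑ ≤
      U.indicator (fun z => ENNReal.ofReal (kern γ μ z)) z + 1 := fun z => by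
    rw [Real.enorm_of_nonneg (kern_nonneg z)]
    by_cases hz : z ∈ U
    · rw [Set.indicator_of_mem hz]
      exact le_self_add
    · refine le_trans ?_ le_add_self
      rw [ENNReal.ofReal_le_one, kern]
      exact inv_le_one_of_one_le₀ (Real.one_le_rpow (not_lt.1 hz) hμ0.le)
  have hind : Measurable (U.indicator fun z : Space m n => ENNReal.ofReal (kern γ μ z)) :=
    measurable_kern.ennreal_ofReal.indicator hUm
  refine ⟨(ENNReal.ofReal C + volume (Ω : Set (Space m n))).toNNReal, fun z => ?_⟩
  rw [ENNReal.coe_toNNReal (by finiteness)]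
  calc ∫⁻ w in (Ω : Set (Space m n)), ‖kern γ μ (z - w)‖ₑ
      ≤ ∫⁻ w in (Ω : Set (Space m n)),
        (U.indicator (fun z => ENNReal.ofReal (kern γ μ z)) (z - w) + 1) :=
        lintegral_mono fun w => hpt _
    _ = (∫⁻ w in (Ω : Set (Space m n)),
        U.indicator (fun z => ENNReal.ofReal (kern γ μ z)) (z - w)) +
          volume (Ω : Set (Space m n)) := by
        rw [lintegral_add_right _ measurable_const, setLIntegral_const, one_mul]
    _ ≤ (∫⁻ w, U.indicator (fun z => ENNReal.ofReal (kern γ μ z)) (z - w)) +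
          volume (Ω : Set (Space m n)) := by
        exact add_le_add (setLIntegral_le_lintegral _ _) le_rfl
    _ ≤ _ := by
        gcongr
        rw [lintegral_sub_left_eq_self (fun z => U.indicator
          (fun z => ENNReal.ofReal (kern γ μ z)) z) z, lintegral_indicator hUm]
        simpa using hC 1 one_pos

/-- Differences of points of Ω have bounded homogeneous norm. The bound is only almost everywhere
because the kernel is 0 on the diagonal by convention; the diagonal is null since the space is
nontrivial. -/
theorem exists_le_kern (hN : 0 < m + n) (hμ0 : 0 < μ)
    (hΩ : Bornology.IsBounded (Ω : Set (Space m n))) :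
    ∃ δ : ℝ, 0 < δ ∧ ∀ᵐ a ∂((volume.restrict (Ω : Set (Space m n))).prod
      (volume.restrict (Ω : Set (Space m n)))), δ ≤ kern γ μ (a.1 - a.2) := by
  obtain ⟨R, hR⟩ := ((hΩ.sub hΩ).isCompact_closure.image
    (continuous_homNorm (m := m) (n := n) (γ := γ))).bddAbove
  have hR' : ∀ z ∈ Ω, ∀ w ∈ Ω, homNorm γ (z - w) ≤ |R| + 1 := fun z hz w hw =>
    ((hR ⟨z - w, subset_closure (Set.sub_mem_sub hz hw), rfl⟩).trans (le_abs_self R)).trans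
      (by linarith)
  refine ⟨((|R| + 1) ^ μ)⁻¹, by positivity, ?_⟩
  have hnt : Nontrivial (Space m n) := by
    refine Module.nontrivial_of_finrank_pos (R := ℝ) ?_
    simpa [Module.finrank_prod] using hN
  have hmeas : MeasurableSet {a : Space m n × Space m n |
      ((|R| + 1) ^ μ)⁻¹ ≤ kern γ μ (a.1 - a.2)} :=
    measurableSet_le measurable_const (measurable_kern.comp (measurable_fst.sub measurable_snd))
  refine (Measure.ae_prod_iff_ae_ae hmeas).2 ?_
  filter_upwards [ae_restrict_mem Ω.isOpen.measurableSet] with z hz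
  filter_upwards [ae_restrict_mem Ω.isOpen.measurableSet,
    ae_restrict_of_ae (Measure.ae_ne volume z)] with w hw hne
  have hpos : 0 < homNorm γ (z - w) :=
    lt_of_le_of_ne (homNorm_nonneg _) fun h0 =>
      hne (sub_eq_zero.1 (homNorm_eq_zero h0.symm)).symm
  rw [kern]
  exact inv_anti₀ (by positivity) (Real.rpow_le_rpow hpos.le (hR' z hz w hw) hμ0.le)

end Instantiation

/-! ### The Choquard term controls the L¹ norm. -/

section LowerBound

variable {X : Type*} [MeasurableSpace X] {ν : Measure X} [IsFiniteMeasure ν] {p r : ℝ}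
  {k : X → X → ℝ} [Fact (1 ≤ ENNReal.ofReal (r * p))] [Fact (1 ≤ ENNReal.ofReal r)]
  {H : Type*} [NormedAddCommGroup H] [InnerProductSpace ℝ H]

/-- A kernel bounded below by δ gives D(u) ≥ δ(∫|u|^p)², and Hölder on a finite measure space passes
from L^p to L¹. -/
theorem integral_abs_le_choquardForm (h : Exponents p r)
    (hk : IsBoundedKernel k (ENNReal.ofReal r) ν) (T : H →L[ℝ] Lp ℝ (ENNReal.ofReal (r * p)) ν)
    {δ : ℝ} (hδ : 0 < δ) (hle : ∀ᵐ a ∂(ν.prod ν), δ ≤ k a.1 a.2) :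
    ∃ A : ℝ, 0 ≤ A ∧ ∀ u,
      ∫ x, |T u x| ∂ν ≤ A * choquardForm h hk T u ^ (1 / (2 * p)) := by
  have hp := h.one_lt_p
  have hr := h.one_lt_r
  set V := ν Set.univ ^ (1 / (1 : ℝ≥0∞).toReal - 1 / (ENNReal.ofReal p).toReal) with hV
  have hVt : V ≠ ∞ := by
    refine ENNReal.rpow_ne_top_of_nonneg ?_ (measure_ne_top _ _)
    rw [ENNReal.toReal_one, ENNReal.toReal_ofReal (by linarith), div_one, sub_nonneg,
      div_le_one (by linarith)]
    exact hp.le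
  refine ⟨V.toReal * (1 / δ) ^ (1 / (2 * p)), by positivity, fun u => ?_⟩
  have hmem : MemLp (T u) (ENNReal.ofReal p) ν :=
    (Lp.memLp (T u)).mono_exponent (ENNReal.ofReal_le_ofReal (by nlinarith))
  set I := ∫ x, |T u x| ^ p ∂ν with hI
  have hI0 : 0 ≤ I := integral_nonneg fun x => by positivity
  have hIi : Integrable (fun x => |T u x| ^ p) ν := by
    have h1 := hmem.integrable_norm_rpow (by simpa using by linarith) ENNReal.ofReal_ne_top
    rwa [ENNReal.toReal_ofReal (by linarith)] at h1
  have hD : δ * I ^ 2 ≤ choquardForm h hk T u := by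
    rw [choquardForm, hk.form_apply, sq, hI, ← integral_prod_mul, ← integral_const_mul]
    have h1 := Measure.quasiMeasurePreserving_fst (μ := ν) (ν := ν) |>.ae (coeFn_absPow h (T u))
    have h2 := Measure.quasiMeasurePreserving_snd (μ := ν) (ν := ν) |>.ae (coeFn_absPow h (T u))
    refine integral_mono_ae ((hIi.mul_prod hIi).const_mul δ) (hk.integrable _ _) ?_
    filter_upwards [h1, h2, hle] with a h1 h2 h3
    rw [h1, h2, mul_comm]
    gcongr
  have hJ : ∫ x, |T u x| ∂ν ≤ V.toReal * I ^ (1 / p) := by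
    have h1 := eLpNorm_le_eLpNorm_mul_rpow_measure_univ (μ := ν) (p := 1) (q := ENNReal.ofReal p)
      (by rw [ENNReal.one_le_ofReal]; exact hp.le) (Lp.aestronglyMeasurable (T u))
    rw [← hV, hmem.eLpNorm_eq_integral_rpow_norm (by simpa using by linarith)
      ENNReal.ofReal_ne_top, (memLp_one_iff_integrable.2
        (integrable_of_Lp Fact.out (T u))).eLpNorm_eq_integral_rpow_norm one_ne_zero
        ENNReal.one_ne_top, ENNReal.toReal_ofReal (by linarith), ← ENNReal.ofReal_toReal hVt,
      ← ENNReal.ofReal_mul (by positivity)] at h1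
    simp only [ENNReal.toReal_one, Real.rpow_one, inv_one, Real.norm_eq_abs] at h1
    have h2 := (ENNReal.ofReal_le_ofReal_iff (by positivity)).1 h1
    rw [one_div, mul_comm V.toReal]
    exact h2
  refine hJ.trans ?_
  rw [mul_assoc]
  refine mul_le_mul_of_nonneg_left ?_ ENNReal.toReal_nonneg
  have hD0 : 0 ≤ choquardForm h hk T u := le_trans (by positivity) hD
  rw [← Real.mul_rpow (by positivity) hD0]
  calc I ^ (1 / p) = (I ^ 2) ^ (1 / (2 * p)) := by
        rw [← Real.rpow_natCast, ← Real.rpow_mul hI0]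
        congr 1
        push_cast
        field_simp
    _ ≤ _ := by
        refine Real.rpow_le_rpow (by positivity) ?_ (by positivity)
        rw [one_div, ← div_eq_inv_mul, le_div_iff₀ hδ]
        linarith

end LowerBound

/-! ### The concrete functional as an instance of the abstract one. -/

section Main

variable {m n : ℕ} {γ : ℝ≥0} {Ω : TopologicalSpace.Opens (Space m n)} {μ p r : ℝ}
  [Fact (1 ≤ ENNReal.ofReal (r * p))] [Fact (1 ≤ ENNReal.ofReal r)]

theorem choquard_eq_choquardForm [IsFiniteMeasure (volume.restrict (Ω : Set (Space m n)))]
    (hm : 0 < m ∨ γ = 0) (hQ : 2 < homDim m n γ)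
    (hΩ : Bornology.IsBounded (Ω : Set (Space m n))) (hp : critExp m n γ μ = p)
    (hrp : r * p = sobExp m n γ) (h : Exponents p r)
    (hk : IsBoundedKernel (fun z w : Space m n => kern γ μ (z - w)) (ENNReal.ofReal r)
      (volume.restrict (Ω : Set (Space m n)))) (u : H γ Ω) :
    choquard μ u = choquardForm h hk (embed γ Ω (ENNReal.ofReal (r * p))) u := by
  set A := absPow h (embed γ Ω (ENNReal.ofReal (r * p)) u) with hA
  have hae : ∀ᵐ z ∂(volume.restrict (Ω : Set (Space m n))), A z = |u.toL2 z| ^ p := by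
    rw [toL2_eq_embed hm hQ hΩ]
    filter_upwards [coeFn_absPow h (embed γ Ω (ENNReal.ofReal (r * p)) u),
      embed_ae_eq hm hQ hΩ (s := 2) (s' := ENNReal.ofReal (r * p)) (two_le_ofReal_sobExp hQ)
        (by rw [hrp]) u] with z h1 h2
    rw [hA, h1, h2]
  rw [choquardForm, hk.form_apply, integral_prod _ (hk.integrable _ _), choquard, hp]
  refine integral_congr_ae ?_
  filter_upwards [hae] with z hz
  rw [← hA, hz, mul_comm, ← integral_const_mul]
  refine integral_congr_ae ?_
  filter_upwards [hae] with w hw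
  rw [hw, kern, div_eq_mul_inv, mul_assoc]

theorem energy_eq_modelEnergy [IsFiniteMeasure (volume.restrict (Ω : Set (Space m n)))]
    (hm : 0 < m ∨ γ = 0) (hQ : 2 < homDim m n γ)
    (hΩ : Bornology.IsBounded (Ω : Set (Space m n))) (hp : critExp m n γ μ = p)
    (hrp : r * p = sobExp m n γ) (h : Exponents p r)
    (hk : IsBoundedKernel (fun z w : Space m n => kern γ μ (z - w)) (ENNReal.ofReal r)
      (volume.restrict (Ω : Set (Space m n)))) (lam : ℝ) :
    energy (γ := γ) (Ω := Ω) lam μ =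
      modelEnergy h hk (embed γ Ω (ENNReal.ofReal (r * p))) (embed γ Ω 2) lam := by
  funext u
  have h2 : ∫ z in (Ω : Set (Space m n)), |u.toL2 z| ^ 2 = ‖embed γ Ω 2 u‖ ^ 2 := by
    rw [← toL2_eq_embed hm hQ hΩ, ← real_inner_self_eq_norm_sq, L2.inner_def]
    simp only [real_inner_self_eq_norm_sq, Real.norm_eq_abs]
  rw [energy, modelEnergy, choquard_eq_choquardForm hm hQ hΩ hp hrp h hk, dirichlet_eq_norm_sq, h2,
    hp]

theorem choquard_nonneg (u : H γ Ω) : 0 ≤ choquard μ u := by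
  refine integral_nonneg fun z => mul_nonneg (integral_nonneg fun w => ?_) (by positivity)
  have := homNorm_nonneg (γ := γ) (z - w)
  simp only [Pi.zero_apply]
  positivity

theorem dirichlet_div_choquard_nonneg (u : H γ Ω) :
    0 ≤ dirichlet u / choquard μ u ^ (1 / critExp m n γ μ) := by
  rw [dirichlet_eq_norm_sq]
  have := choquard_nonneg (μ := μ) u
  positivity

theorem bestConst_nonneg : 0 ≤ bestConst γ Ω μ :=
  Real.iInf_nonneg fun u => dirichlet_div_choquard_nonneg u.1

/-- Where the Choquard term vanishes the inequality is trivial, whatever value the quotient takes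
there; elsewhere u ≠ 0 and the infimum applies. -/
theorem bestConst_mul_le (hp : 0 < critExp m n γ μ) (u : H γ Ω) (h0 : u = 0 → choquard μ u = 0) :
    bestConst γ Ω μ * choquard μ u ^ (1 / critExp m n γ μ) ≤ ‖u‖ ^ 2 := by
  rcases (choquard_nonneg (μ := μ) u).eq_or_lt with h | h
  · rw [← h, Real.zero_rpow (by positivity), mul_zero]
    positivity
  · have hu : u ≠ 0 := fun hu => h.ne' (h0 hu)
    rw [← dirichlet_eq_norm_sq, ← le_div_iff₀ (by positivity)]
    exact ciInf_le (f := fun u : {u : H γ Ω // u ≠ 0} =>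
      dirichlet u.1 / choquard μ u.1 ^ (1 / critExp m n γ μ))
      ⟨0, by rintro _ ⟨v, rfl⟩; exact dirichlet_div_choquard_nonneg v.1⟩ ⟨u, hu⟩

end Main

end Grushin

end

theorem lemma3p3 (m n : ℕ) (hN : 3 ≤ m + n) (γ : ℝ≥0) (hm : 0 < m ∨ γ = 0)
    (Ω : TopologicalSpace.Opens (Grushin.Space m n))
    (hΩ : Bornology.IsBounded (Ω : Set (Grushin.Space m n)))
    (lam μ : ℝ) (hlam : 0 < lam) (hμ0 : 0 < μ) (hμ : μ < Grushin.homDim m n γ)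
    (c : ℝ)
    (hc : c < (Grushin.homDim m n γ + 2 - μ) / (4 * Grushin.homDim m n γ - 2 * μ) *
      Grushin.bestConst γ Ω μ ^
        ((2 * Grushin.homDim m n γ - μ) / (Grushin.homDim m n γ + 2 - μ))) :
    Grushin.PalaisSmaleCondition (Grushin.energy (γ := γ) (Ω := Ω) lam μ) c := by
  have hQ3 : 3 ≤ Grushin.homDim m n γ := Grushin.three_le_homDim hN
  have hQ : 2 < Grushin.homDim m n γ := by linarith
  have hq2 := Grushin.two_lt_sobExp hQ
  obtain ⟨p, hp⟩ : ∃ p, Grushin.critExp m n γ μ = p := ⟨_, rfl⟩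
  obtain ⟨r, hr⟩ : ∃ r, r = 2 * Grushin.homDim m n γ / (2 * Grushin.homDim m n γ - μ) := ⟨_, rfl⟩
  have hQ2 : Grushin.homDim m n γ - 2 ≠ 0 := by linarith
  have hQμ : 2 * Grushin.homDim m n γ - μ ≠ 0 := by linarith
  have hQμ2 : Grushin.homDim m n γ + 2 - μ ≠ 0 := by linarith
  have hpQ : p = (2 * Grushin.homDim m n γ - μ) / (Grushin.homDim m n γ - 2) := by
    rw [← hp, Grushin.critExp]
  have hrp : r * p = Grushin.sobExp m n γ := by
    rw [hr, hpQ, Grushin.sobExp]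
    field_simp
  have h : Grushin.Exponents p r := by
    constructor
    · rw [hpQ, lt_div_iff₀ (by linarith)]
      linarith
    · rw [hr, lt_div_iff₀ (by linarith)]
      linarith
  have hp1 := h.one_lt_p
  have hF1 : Fact (1 ≤ ENNReal.ofReal r) := ⟨ENNReal.one_le_ofReal.2 h.one_lt_r.le⟩
  have hF2 : Fact (1 ≤ ENNReal.ofReal (r * p)) :=
    ⟨ENNReal.one_le_ofReal.2 (by rw [hrp]; linarith)⟩
  have hfin : IsFiniteMeasure (volume.restrict (Ω : Set (Grushin.Space m n))) := ⟨by
    rw [Measure.restrict_apply_univ]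
    exact hΩ.measure_lt_top⟩
  have hk := Grushin.isBoundedKernel_kern (r := ENNReal.ofReal r) hμ0 hμ
    (Measure.restrict_le_self (μ := volume) (s := (Ω : Set (Grushin.Space m n)))) (by rw [hr])
  obtain ⟨K, hK⟩ := Grushin.exists_setLIntegral_kern_le hμ0 hμ hΩ
  obtain ⟨δ, hδ, hle⟩ := Grushin.exists_le_kern (γ := γ) (by omega) hμ0 hΩ
  obtain ⟨A, hA, hlow⟩ := Grushin.integral_abs_le_choquardForm h hk
    (Grushin.embed γ Ω (ENNReal.ofReal (r * p))) hδ hle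
  have hD := Grushin.choquard_eq_choquardForm hm hQ hΩ hp hrp h hk
  rw [Grushin.energy_eq_modelEnergy hm hQ hΩ hp hrp h hk]
  refine Grushin.palaisSmaleCondition_modelEnergy h hk _ _ lam
    (fun z w => by rw [← Grushin.kern_neg, neg_sub]) (fun z w => Grushin.kern_nonneg _) hK
    (by rw [hrp]; exact hq2)
    (fun u => Grushin.embed_ae_eq hm hQ hΩ (Grushin.two_le_ofReal_sobExp hQ) (by rw [hrp]) u)
    hlam hA hlow Grushin.exists_weak_subseq
    (fun v => Grushin.tendsto_embed_two_of_weak hm hQ hΩ)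
    (Grushin.bestConst_nonneg (γ := γ) (Ω := Ω) (μ := μ)) (fun u => ?_) ?_
  · rw [← hD, ← hp]
    refine Grushin.bestConst_mul_le (by rw [hp]; linarith) u fun hu => ?_
    have h0 : Grushin.absPow h (Grushin.embed γ Ω (ENNReal.ofReal (r * p)) u) = 0 := by
      rw [← norm_eq_zero, Grushin.norm_absPow, hu, map_zero, norm_zero,
        Real.zero_rpow (by linarith)]
    rw [hD, Grushin.choquardForm, h0, map_zero]
  -- The threshold in terms of Q and μ is θ S^(p/(p-1)) written out: the coefficient is θ = 1/2 -
  -- 1/(2p) and the exponent is p/(p-1).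
  · have e1 : (Grushin.homDim m n γ + 2 - μ) / (4 * Grushin.homDim m n γ - 2 * μ) =
        1 / 2 - 1 / (2 * p) := by
      rw [show 4 * Grushin.homDim m n γ - 2 * μ = 2 * (2 * Grushin.homDim m n γ - μ) by ring,
        show 1 / (2 * p) = (Grushin.homDim m n γ - 2) / (2 * (2 * Grushin.homDim m n γ - μ)) by
          rw [hpQ]; field_simp,
        show (1 : ℝ) / 2 = (2 * Grushin.homDim m n γ - μ) / (2 * (2 * Grushin.homDim m n γ - μ)) by
          rw [eq_div_iff (mul_ne_zero two_ne_zero hQμ)]; ring, ← sub_div]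
      congr 1
      ring
    have e2 : (2 * Grushin.homDim m n γ - μ) / (Grushin.homDim m n γ + 2 - μ) = p / (p - 1) := by
      have h5 : p - 1 = (Grushin.homDim m n γ + 2 - μ) / (Grushin.homDim m n γ - 2) := by
        rw [hpQ]
        field_simp
        ring
      rw [h5, hpQ]
      field_simp
    rwa [e1, e2] at hc
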